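/- Let $A=\{0,1,\infty,x\}$ and $B=\{0,1,\infty,y,z\}$ be sets of labels, let $f|_A:A\to B$ be given by $0\mapsto\infty$, $\infty\mapsto 1$, $1\mapsto y$, $x\mapsto 0$, and let $\iota:A\hookrightarrow B$ be given by $0\mapsto 0$, $1\mapsto 1$, $\infty\mapsto\infty$, $x\mapsto y$. (This is the combinatorics of a map in $\mathrm{Per}_4(0)^*$: a quadratic rational map with a critical $4$-cycle $0\mapsto\infty\mapsto1\mapsto x\mapsto0$ with critical point $0$, whose second critical value $z$ does not lie in the cycle.) A rational curve is a connected complex nodal curve all of whose components are isomorphic to $\mathbb P^1$ and whose dual graph is a tree; marked with distinct smooth points it is called pre-stable, and stable if every component carries at least three nodes or marked points. Let $\mathcal{AM}_f$ be the set of isomorphism classes of commutative squares consisting of a pre-stable rational curve $\mathcal C_U$ marked by $A$, a stable rational curve $\mathcal C_L$ marked by $B$, and a map $F:\mathcal C_U\to\mathcal C_L$ inducing $f|_A$ on the marked points, such that $F$ is a pre-admissible double cover (it is finite, of degree $2$ over every component, the preimage of the set of nodes is the set of nodes, and at every node the two branches map to different branches with equal local degree) whose branch values outside the nodes are exactly the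 points marked $\infty$ and $z$, the point marked $0$ of $\mathcal C_U$ being the critical point over $\infty$. It carries the Zariski topology defined by its embedding in a product of projective lines through the cross ratios of the marked points of $\mathcal C_L$ and of all their preimages in $\mathcal C_U$. Let $\mathcal{AV}_{f,\iota}\subset\mathcal{AM}_f$ be the equalizer of the two maps to the moduli space of stable rational curves marked by $A$ that send a square to the stabilization of $\mathcal C_U$, respectively to the stabilization of $\mathcal C_L$ with the marking pulled back by $\iota$ (that is, $z$ is forgotten and $y$ is renamed $x$). Where $\mathcal C_U$ and $\mathcal C_L$ are irreducible, normalize the points marked $0,1,\infty$ of both curves to $0,1,\infty\in\mathbb P^1$, so that the points marked $x$ in $\mathcal C_U$ and $y$ in $\mathcal C_L$ become coordinates $(x,y)$, and let $\mathcal V$ be the locus $x=y$. Let $\mathcal A_1$ be the set of classes for which $\mathcal C_L$ has exactly two components, with the marked points distributed according to $\{\infty,y,z\}\cup\{0,1\}$, and for which the points marked $\infty$ and $x$ (the marked points over $1$ and $0$) lie on the same component of $\mathcal C_U$. Let $\mathcal A_2$ be the set of classes for which $\mathcal C_L$ has exactly two components, with the marked points distributed according to $\{0,1,z\}\cup\{y,\infty\}$.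 Then $\mathcal V\cup\mathcal A_1\cup\mathcal A_2$ is an algebraic (locally closed) subset of $\mathcal{AM}_f$ of pure dimension $1$, it is contained in $\mathcal{AV}_{f,\iota}$, and its complement in $\mathcal{AV}_{f,\iota}$ is a finite (possibly empty) set of points. -/

import Mathlib

open scoped Polynomial

noncomputable section

namespace AugDef

/-- The complex projective line. -/
abbrev P1 : Type := OnePoint ℂ

/-- The group of matrices acting on `P1` by Möbius transformations. -/
abbrev Mob : Type := GL (Fin 2) ℂ

/-! ### Rational maps of the projective line -/

/-- A rational map `num / den` of the projective line, in lowest terms. -/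
structure RatMap where
  num : ℂ[X]
  den : ℂ[X]
  coprime : IsCoprime num den

namespace RatMap

def degree (F : RatMap) : ℕ := max F.num.natDegree F.den.natDegree

def apply (F : RatMap) : P1 → P1
  | OnePoint.some t =>
      if F.den.eval t = 0 then OnePoint.infty
      else OnePoint.some (F.num.eval t / F.den.eval t)
  | OnePoint.infty =>
      if F.den.coeff F.degree = 0 then OnePoint.infty
      else OnePoint.some (F.num.coeff F.degree / F.den.coeff F.degree)

/-- The polynomial, to be regarded as a binary form of degree `F.degree`, whose zeros form the
fibre of `F` over a point. -/
def fibrePoly (F : RatMap) : P1 → ℂ[X]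
  | OnePoint.some b => F.num - Polynomial.C b * F.den
  | OnePoint.infty => F.den

/-- The local degree (ramification index) of a non-constant rational map at a point. -/
def localDegree (F : RatMap) : P1 → ℕ
  | OnePoint.some t => (F.fibrePoly (F.apply (OnePoint.some t))).rootMultiplicity t
  | OnePoint.infty => F.degree - (F.fibrePoly (F.apply OnePoint.infty)).natDegree

end RatMap

/-! ### Rational nodal curves -/

/-- A rational curve: a nodal curve whose components `0, …, n - 1` are projective lines and whose
dual graph is a tree.  For adjacent `v`, `w`, the point `node v w` of the component `v` is glued to
the point `node w v` of the component `w`; the value of `node` at non-adjacent pairs is irrelevant. -/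
structure RationalCurve where
  n : ℕ
  graph : SimpleGraph (Fin n)
  isTree : graph.IsTree
  node : Fin n → Fin n → P1
  node_inj : ∀ v w w', graph.Adj v w → graph.Adj v w' → node v w = node v w' → w = w'

namespace RationalCurve

/-- Points of the normalization: a component together with a point on it. -/
abbrev Pt (C : RationalCurve) : Type := Fin C.n × P1

def IsNode (C : RationalCurve) (p : C.Pt) : Prop :=
  ∃ w, C.graph.Adj p.1 w ∧ p.2 = C.node p.1 w

/-- Two points of the normalization are the same point of the curve. -/
def Glued (C : RationalCurve) (p q : C.Pt) : Prop :=
  p = q ∨ (C.graph.Adj p.1 q.1 ∧ p.2 = C.node p.1 q.1 ∧ q.2 = C.node q.1 p.1)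

/-- Isomorphisms of rational curves. -/
structure Iso (C D : RationalCurve) where
  comp : Fin C.n ≃ Fin D.n
  mob : Fin C.n → Mob
  adj_iff : ∀ v w, D.graph.Adj (comp v) (comp w) ↔ C.graph.Adj v w
  node_eq : ∀ v w, C.graph.Adj v w → D.node (comp v) (comp w) = mob v • C.node v w

namespace Iso

def apply {C D : RationalCurve} (e : Iso C D) (p : C.Pt) : D.Pt :=
  (e.comp p.1, e.mob p.1 • p.2)

def refl (C : RationalCurve) : Iso C C where
  comp := Equiv.refl _
  mob _ := 1
  adj_iff _ _ := Iff.rfl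
  node_eq _ _ _ := (one_smul _ _).symm

def symm {C D : RationalCurve} (e : Iso C D) : Iso D C where
  comp := e.comp.symm
  mob v := (e.mob (e.comp.symm v))⁻¹
  adj_iff v w := by simp [← e.adj_iff]
  node_eq v w h := by
    have h' : C.graph.Adj (e.comp.symm v) (e.comp.symm w) := by simpa [← e.adj_iff] using h
    have := e.node_eq _ _ h'
    simp only [Equiv.apply_symm_apply] at this
    rw [this, inv_smul_smul]

def trans {C D E : RationalCurve} (e : Iso C D) (e' : Iso D E) : Iso C E where
  comp := e.comp.trans e'.comp
  mob v := e'.mob (e.comp v) * e.mob v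
  adj_iff v w := by simp [e.adj_iff, e'.adj_iff]
  node_eq v w h := by
    simp only [Equiv.trans_apply]
    rw [e'.node_eq _ _ ((e.adj_iff v w).2 h), e.node_eq v w h, mul_smul]

theorem refl_apply (C : RationalCurve) (p : C.Pt) : (refl C).apply p = p :=
  Prod.ext rfl (one_smul _ _)

theorem symm_apply_apply {C D : RationalCurve} (e : Iso C D) (p : C.Pt) :
    e.symm.apply (e.apply p) = p := by
  simp [symm, apply]

theorem apply_symm_apply {C D : RationalCurve} (e : Iso C D) (q : D.Pt) :
    e.apply (e.symm.apply q) = q := by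
  simp [symm, apply]

theorem trans_apply {C D E : RationalCurve} (e : Iso C D) (e' : Iso D E) (p : C.Pt) :
    (e.trans e').apply p = e'.apply (e.apply p) := by
  simp [trans, apply, mul_smul]

end Iso

/-- `t` is the point of the component `v` in the direction of `p`: the point `p` itself if it lies on
`v`, and otherwise the node of `v` towards the component of `p`. -/
def IsProj (C : RationalCurve) (v : Fin C.n) (p : C.Pt) (t : P1) : Prop :=
  (p.1 = v ∧ t = p.2) ∨
    (p.1 ≠ v ∧ ∃ w, C.graph.Adj v w ∧ C.graph.dist w p.1 + 1 = C.graph.dist v p.1 ∧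
      t = C.node v w)

/-- `t` is the cross ratio of four distinct smooth points of `C`: on the unique component on which the
projections of `q 0`, `q 1`, `q 2` differ, take the coordinate in which these are `0`, `1`, `∞`, and
let `t` be the coordinate of the projection of `q 3`. -/
def IsCrossRatio (C : RationalCurve) (q : Fin 4 → C.Pt) (t : P1) : Prop :=
  ∃ (v : Fin C.n) (π : Fin 4 → P1) (g : Mob), (∀ k, C.IsProj v (q k) (π k)) ∧
    g • π 0 = OnePoint.some 0 ∧ g • π 1 = OnePoint.some 1 ∧ g • π 2 = OnePoint.infty ∧
    g • π 3 = t

end RationalCurve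

/-- A pre-stable rational curve with marked points labelled by `Λ`. -/
structure MarkedCurve (Λ : Type) extends RationalCurve where
  mark : Λ → toRationalCurve.Pt
  mark_inj : Function.Injective mark
  mark_smooth : ∀ l, ¬ toRationalCurve.IsNode (mark l)

namespace MarkedCurve

/-- Every component carries at least three distinguished points (nodes or marked points). -/
def IsStable {Λ : Type} (C : MarkedCurve Λ) : Prop :=
  ∀ v : Fin C.n, 3 ≤ Set.encard {t : P1 | C.IsNode (v, t) ∨ ∃ l, C.mark l = (v, t)}

/-- Forget marked points, keeping those labelled by `Λ'`. -/
def restrict {Λ Λ' : Type} (C : MarkedCurve Λ) (e : Λ' ↪ Λ) : MarkedCurve Λ' where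
  toRationalCurve := C.toRationalCurve
  mark l := C.mark (e l)
  mark_inj := C.mark_inj.comp e.injective
  mark_smooth l := C.mark_smooth (e l)

/-- The stable curve `D` is the stabilization of `C`: there is a map `κ` from `C` to `D`, compatible
with the nodes and with the marked points, which contracts some components of `C` to points and maps
each of the other components isomorphically onto a component of `D`, every component of `D` being
obtained from exactly one component of `C`. -/
def IsStabilization {Λ : Type} (C D : MarkedCurve Λ) : Prop :=
  D.IsStable ∧ ∃ κ : C.Pt → D.Pt,
    (∀ p q, C.Glued p q → D.Glued (κ p) (κ q)) ∧
    (∀ l, κ (C.mark l) = D.mark l) ∧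
    (∀ v : Fin C.n, (∃ q : D.Pt, ∀ t, κ (v, t) = q) ∨
      ∃ (v' : Fin D.n) (g : Mob), ∀ t, κ (v, t) = (v', g • t)) ∧
    (∀ v' : Fin D.n, ∃! v : Fin C.n, ∃ g : Mob, ∀ t, κ (v, t) = (v', g • t))

end MarkedCurve

/-! ### Pre-admissible maps -/

/-- A family of rational maps from the components of `U` to components of `L`. -/
structure CurveMap (U L : RationalCurve) where
  comp : Fin U.n → Fin L.n
  map : Fin U.n → RatMap

namespace CurveMap

variable {U L : RationalCurve}

def apply (F : CurveMap U L) (p : U.Pt) : L.Pt := (F.comp p.1, (F.map p.1).apply p.2)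

def localDegree (F : CurveMap U L) (p : U.Pt) : ℕ := (F.map p.1).localDegree p.2

/-- Pre-admissible maps of degree `d`. -/
structure IsPreAdmissible (F : CurveMap U L) (d : ℕ) : Prop where
  /-- no component is contracted -/
  nonconst : ∀ v, 1 ≤ (F.map v).degree
  /-- the degree over every component is `d` -/
  degree_eq : ∀ u : Fin L.n, ∑ v ∈ Finset.univ.filter (fun v => F.comp v = u), (F.map v).degree = d
  /-- nodes go to nodes, the two branches of a node going to the two branches of its image -/
  adj : ∀ v w, U.graph.Adj v w → L.graph.Adj (F.comp v) (F.comp w)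
  node : ∀ v w, U.graph.Adj v w →
    (F.map v).apply (U.node v w) = L.node (F.comp v) (F.comp w)
  /-- only nodes go to nodes -/
  isNode_of_isNode : ∀ p, L.IsNode (F.apply p) → U.IsNode p
  /-- the two branches of a node have the same local degree -/
  localDegree_eq : ∀ v w, U.graph.Adj v w →
    F.localDegree (v, U.node v w) = F.localDegree (w, U.node w v)

end CurveMap

/-! ### The quadratic maps with a critical four-cycle -/

/-- The labels of the critical cycle `0 ↦ ∞ ↦ 1 ↦ x ↦ 0`, whose critical point is `0`. -/
inductive A
  | zero | one | inf | x
  deriving DecidableEq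

/-- The labels of the cycle in the range, together with the extra critical value `z`; the point `x`
of the cycle is called `y` in the range. -/
inductive B
  | zero | one | inf | y | z
  deriving DecidableEq

/-- The labels of all points in the preimage of `B`: those of `A`, the second preimages of
`f ∞ = 1`, `f 1 = y`, `f x = 0`, and the critical point over `z`. -/
inductive Fib
  | zero | one | inf | x | one' | inf' | x' | crit
  deriving DecidableEq

/-- The dynamics `f` on the cycle. -/
def dyn : A → B
  | A.zero => B.inf
  | A.inf => B.one
  | A.one => B.y
  | A.x => B.zero

/-- The identification `ι` of the cycle in the domain with the cycle in the range. -/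
def iota : A ↪ B where
  toFun
    | A.zero => B.zero
    | A.one => B.one
    | A.inf => B.inf
    | A.x => B.y
  inj' a b h := by cases a <;> cases b <;> simp_all

def fibOfA : A → Fib
  | A.zero => Fib.zero
  | A.one => Fib.one
  | A.inf => Fib.inf
  | A.x => Fib.x

def fibMap : Fib → B
  | Fib.zero => B.inf
  | Fib.inf => B.one
  | Fib.inf' => B.one
  | Fib.one => B.y
  | Fib.one' => B.y
  | Fib.x => B.zero
  | Fib.x' => B.zero
  | Fib.crit => B.z

/-- A commutative square consisting of a pre-stable curve `U` marked by `A`, a stable curve `L` marked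
by `B` and a pre-admissible double cover `F : U → L` which induces `dyn` on the marked points and has,
apart from the nodes, the branch values `∞` and `z`, with critical point `0` over `∞`. -/
structure Diagram where
  U : MarkedCurve A
  L : MarkedCurve B
  F : CurveMap U.toRationalCurve L.toRationalCurve
  stable : L.IsStable
  preAdmissible : F.IsPreAdmissible 2
  comm : ∀ a, F.apply (U.mark a) = L.mark (dyn a)
  branch : ∀ p, ¬ U.IsNode p → 2 ≤ F.localDegree p →
    F.apply p = L.mark B.inf ∨ F.apply p = L.mark B.z
  branch_inf : F.localDegree (U.mark A.zero) = 2
  branch_z : ∃ p, F.apply p = L.mark B.z ∧ F.localDegree p = 2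

namespace Diagram

/-- Isomorphism of diagrams. -/
def Equivalent (D E : Diagram) : Prop :=
  ∃ (u : RationalCurve.Iso D.U.toRationalCurve E.U.toRationalCurve)
    (l : RationalCurve.Iso D.L.toRationalCurve E.L.toRationalCurve),
    (∀ a, u.apply (D.U.mark a) = E.U.mark a) ∧ (∀ b, l.apply (D.L.mark b) = E.L.mark b) ∧
    ∀ p, E.F.apply (u.apply p) = l.apply (D.F.apply p)

instance setoid : Setoid Diagram where
  r := Equivalent
  iseqv :=
    { refl := fun D => ⟨.refl _, .refl _, by simp [RationalCurve.Iso.refl_apply],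
        by simp [RationalCurve.Iso.refl_apply], by simp [RationalCurve.Iso.refl_apply]⟩
      symm := by
        rintro D E ⟨u, l, hu, hl, h⟩
        refine ⟨u.symm, l.symm, fun a => ?_, fun b => ?_, fun p => ?_⟩
        · rw [← hu, u.symm_apply_apply]
        · rw [← hl, l.symm_apply_apply]
        · conv_rhs => rw [← u.apply_symm_apply p]
          rw [h, l.symm_apply_apply]
      trans := by
        rintro D E G ⟨u, l, hu, hl, h⟩ ⟨u', l', hu', hl', h'⟩
        refine ⟨u.trans u', l.trans l', fun a => ?_, fun b => ?_, fun p => ?_⟩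
        · rw [u.trans_apply, hu, hu']
        · rw [l.trans_apply, hl, hl']
        · rw [u.trans_apply, l.trans_apply, h', h] }

end Diagram

/-- The augmented moduli space of `f`. -/
def AM : Type := Quotient Diagram.setoid

/-- The class of a diagram in the augmented moduli space. -/
def AM.mk (D : Diagram) : AM := Quotient.mk Diagram.setoid D

/-- The equalizer of the two maps from `AM` to the moduli space of stable curves marked by `A`: the
stabilization of the upper curve, and the stabilization of the lower curve after forgetting `z`. -/
def AV : Set AM :=
  {α | ∃ D : Diagram, AM.mk D = α ∧ ∃ S : MarkedCurve A,
    D.U.IsStabilization S ∧ (D.L.restrict iota).IsStabilization S}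

/-- The diagonal `x = y` in the open stratum, in the coordinates `(x, y)` normalized by placing the
other points of the two cycles at `0`, `1` and `∞`. -/
def V : Set AM :=
  {α | ∃ D : Diagram, AM.mk D = α ∧ D.U.n = 1 ∧ D.L.n = 1 ∧ ∃ x : ℂ,
    ((D.U.mark A.zero).2 = OnePoint.some 0 ∧ (D.U.mark A.one).2 = OnePoint.some 1 ∧
      (D.U.mark A.inf).2 = OnePoint.infty ∧ (D.U.mark A.x).2 = OnePoint.some x) ∧
    ((D.L.mark B.zero).2 = OnePoint.some 0 ∧ (D.L.mark B.one).2 = OnePoint.some 1 ∧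
      (D.L.mark B.inf).2 = OnePoint.infty ∧ (D.L.mark B.y).2 = OnePoint.some x)}

/-- The stratum of the partition `{∞, y, z} ∪ {0, 1}`, where the marked points `∞` and `x` over the
unramified component (with the marked points `1 = f ∞` and `0 = f x`) lie on one component. -/
def A₁ : Set AM :=
  {α | ∃ D : Diagram, AM.mk D = α ∧ D.L.n = 2 ∧
    (D.L.mark B.inf).1 = (D.L.mark B.y).1 ∧ (D.L.mark B.inf).1 = (D.L.mark B.z).1 ∧
    (D.L.mark B.zero).1 = (D.L.mark B.one).1 ∧ (D.L.mark B.inf).1 ≠ (D.L.mark B.zero).1 ∧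
    (D.U.mark A.inf).1 = (D.U.mark A.x).1}

/-- The stratum of the partition `{0, 1, z} ∪ {y, ∞}`. -/
def A₂ : Set AM :=
  {α | ∃ D : Diagram, AM.mk D = α ∧ D.L.n = 2 ∧
    (D.L.mark B.zero).1 = (D.L.mark B.one).1 ∧ (D.L.mark B.zero).1 = (D.L.mark B.z).1 ∧
    (D.L.mark B.y).1 = (D.L.mark B.inf).1 ∧ (D.L.mark B.zero).1 ≠ (D.L.mark B.y).1}

/-! ### The Zariski topology of the augmented moduli space

The space is embedded in a product of projective lines by the cross ratios of the points marked by `B`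
on the lower curve and of all their preimages on the upper curve. -/

/-- `q` labels the preimages of the points marked by `B`. -/
def Diagram.IsFibreLabelling (D : Diagram) (q : Fib → D.U.Pt) : Prop :=
  Function.Injective q ∧ (∀ a, q (fibOfA a) = D.U.mark a) ∧
    ∀ l, D.F.apply (q l) = D.L.mark (fibMap l)

/-- The index set of the cross ratio coordinates. -/
abbrev CoordIdx : Type := (Fin 4 ↪ B) ⊕ (Fin 4 ↪ Fib)

/-- `t` is the point of the product of projective lines with the cross ratios of `D` as entries. -/
def Diagram.IsCoord (D : Diagram) (t : CoordIdx → P1) : Prop :=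
  ∃ q : Fib → D.U.Pt, D.IsFibreLabelling q ∧
    (∀ e : Fin 4 ↪ B, D.L.IsCrossRatio (fun k => D.L.mark (e k)) (t (Sum.inl e))) ∧
    ∀ e : Fin 4 ↪ Fib, D.U.IsCrossRatio (fun k => q (e k)) (t (Sum.inr e))

/-- `(a, b)` are homogeneous coordinates of a point of the projective line. -/
def IsHomCoord (a b : ℂ) : P1 → Prop
  | OnePoint.some s => b ≠ 0 ∧ a = s * b
  | OnePoint.infty => a ≠ 0 ∧ b = 0

/-- The points at which a polynomial in the homogeneous coordinates of the cross ratios vanishes,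
for every choice of homogeneous coordinates. -/
def zeroLocus (P : MvPolynomial (CoordIdx × Fin 2) ℂ) : Set AM :=
  {α | ∃ (D : Diagram) (t : CoordIdx → P1), AM.mk D = α ∧ D.IsCoord t ∧
    ∀ w : CoordIdx × Fin 2 → ℂ, (∀ i, IsHomCoord (w (i, 0)) (w (i, 1)) (t i)) →
      MvPolynomial.eval w P = 0}

instance zariskiTopology : TopologicalSpace AM :=
  TopologicalSpace.generateFrom {O | ∃ P, O = (zeroLocus P)ᶜ}

/-- All irreducible components of the set `S` have dimension `d`. -/
def IsPureDim {X : Type} [TopologicalSpace X] (S : Set X) (d : ℕ) : Prop :=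
  ∀ Z ∈ irreducibleComponents S, topologicalKrullDim Z = d

end AugDef

end

noncomputable section

namespace AugDef

/-! ### Homogeneous coordinates and Möbius transformations -/

/-! Every double cover of the projective line is the squaring map in suitable coordinates
(`RatMap.exists_sqForm`). If the lower curve is irreducible, its branch values marked ∞ and z can be
put at ∞ and 0. The points 1, ∞, x above then become numbers p, q, r, and the points y, 1, 0 below
become p², q², r². The equalizer condition says that (∞, p, q, r) and (r², q², ∞, p²) have the same
cross ratio, which is the conic p² + pq + pr − qr − q² − r² = 0 (`Diagram.conic_of_smul`). This
conic is rational with parameter x (`conic_param`), so `V` is a punctured line.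

For arbitrary curves the equalizer condition is weakened to `Diagram.Match`: some component above
and some component below see the points labelled by `A` alike, with three different images. If a
component of the stable lower curve separates four of the five marks, then the curve is irreducible
or has one more component, which carries exactly two marks i, j
(`MarkedCurve.IsStable.injective_or_split`). If z is not among them, a coincidence of marks on the
matched components has to survive the cover; the combinatorics of f and ι leave only {0, 1} and {∞,
y}, that is `A₁` and `A₂` (`Diagram.Match.split_cases`), and each of these is a family in one
parameter c. If z is among them, only finitely many positions of the marks remain
(`Diagram.Match.exists_excPos`).

Hence outside the three families every lower component sees its marks in one of finitely many
positions up to Möbius maps. There are finitely many combinatorial types, and marks and nodes above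
lie in finite fibres of the cover, so the complement is finite (`Diagram.finite_exceptional`).

The union of the families is the closed locus where the cross ratio of 0, 1, ∞, x above equals that
of 0, 1, ∞, y below, minus a closed set described by two cross ratios involving z (`union_eq_diff`).
The coordinates of each family are polynomial in its parameter, so a closed set contains the family
or meets it in finitely many parameters (`closed_finite_or_all`); pure dimension one is then a
topological argument (`isPureDim_one`). Containment in `AV` is checked on the normal forms. -/

theorem IsHomCoord.ne_zero {a b : ℂ} {p : P1} (h : IsHomCoord a b p) : a ≠ 0 ∨ b ≠ 0 := by
  cases p using OnePoint.rec with
  | infty => exact Or.inl h.1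
  | coe s => exact Or.inr h.1

theorem exists_isHomCoord (p : P1) : ∃ a b, IsHomCoord a b p := by
  cases p using OnePoint.rec with
  | infty => exact ⟨1, 0, one_ne_zero, rfl⟩
  | coe s => exact ⟨s, 1, one_ne_zero, (mul_one s).symm⟩

theorem isHomCoord_some (s : ℂ) : IsHomCoord s 1 (OnePoint.some s) :=
  ⟨one_ne_zero, (mul_one s).symm⟩

theorem isHomCoord_infty : IsHomCoord 1 0 OnePoint.infty := ⟨one_ne_zero, rfl⟩

/-- Equality in the projective line becomes a single polynomial identity without cases for ∞. Nearly
all computations with Möbius maps below reduce to it. -/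
theorem IsHomCoord.eq_iff {a b c d : ℂ} {p q : P1} (hp : IsHomCoord a b p)
    (hq : IsHomCoord c d q) : p = q ↔ a * d = c * b := by
  cases p using OnePoint.rec with
  | infty =>
    cases q using OnePoint.rec with
    | infty =>
      obtain ⟨-, rfl⟩ := hp
      obtain ⟨-, rfl⟩ := hq
      simp
    | coe s =>
      obtain ⟨h1, rfl⟩ := hp
      obtain ⟨h2, rfl⟩ := hq
      simp [h1, h2]
  | coe r =>
    cases q using OnePoint.rec with
    | infty =>
      obtain ⟨h1, rfl⟩ := hp
      obtain ⟨h2, rfl⟩ := hq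
      simp [h1, h2]
    | coe s =>
      obtain ⟨h1, rfl⟩ := hp
      obtain ⟨h2, rfl⟩ := hq
      rw [OnePoint.coe_eq_coe]
      constructor
      · rintro rfl; ring
      · intro h
        have : (b * d) * (r - s) = 0 := by linear_combination h
        rcases mul_eq_zero.1 this with h | h
        · exact absurd h (mul_ne_zero h1 h2)
        · exact sub_eq_zero.1 h

theorem IsHomCoord.ne_iff {a b c d : ℂ} {p q : P1} (hp : IsHomCoord a b p)
    (hq : IsHomCoord c d q) : p ≠ q ↔ a * d - c * b ≠ 0 := by
  rw [Ne, hp.eq_iff hq, sub_ne_zero]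

theorem IsHomCoord.of_mul_eq {a b c d : ℂ} {p : P1} (hp : IsHomCoord a b p)
    (h : c ≠ 0 ∨ d ≠ 0) (he : a * d = c * b) : IsHomCoord c d p := by
  cases p using OnePoint.rec with
  | infty =>
    obtain ⟨h1, rfl⟩ := hp
    simp only [mul_zero, mul_eq_zero, h1, false_or] at he
    subst he
    exact ⟨by simpa using h, rfl⟩
  | coe s =>
    obtain ⟨h1, rfl⟩ := hp
    have hc : c = s * d := by
      apply mul_right_cancel₀ h1
      linear_combination -he
    refine ⟨?_, hc⟩
    rintro rfl
    simp [hc] at h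

theorem Mob.det_ne_zero (g : Mob) : g 0 0 * g 1 1 - g 0 1 * g 1 0 ≠ 0 := by
  rw [← Matrix.det_fin_two]
  exact Matrix.GeneralLinearGroup.det_ne_zero g

theorem IsHomCoord.smul {a b : ℂ} {p : P1} (h : IsHomCoord a b p) (g : Mob) :
    IsHomCoord (g 0 0 * a + g 0 1 * b) (g 1 0 * a + g 1 1 * b) (g • p) := by
  have hd := Mob.det_ne_zero g
  cases p using OnePoint.rec with
  | infty =>
    obtain ⟨h1, rfl⟩ := h
    rw [OnePoint.smul_infty_eq_ite]
    split_ifs with h0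
    · refine ⟨?_, by simp [h0]⟩
      rw [h0, mul_zero, sub_zero] at hd
      simpa [h1] using left_ne_zero_of_mul hd
    · exact ⟨by simp [h0, h1], by rw [div_mul_eq_mul_div, eq_div_iff h0]; ring⟩
  | coe s =>
    obtain ⟨h1, rfl⟩ := h
    rw [OnePoint.smul_some_eq_ite]
    split_ifs with h0
    · refine ⟨?_, by linear_combination b * h0⟩
      intro h2
      have h3 : g 0 0 * s + g 0 1 = 0 := by
        apply mul_right_cancel₀ h1
        linear_combination h2
      exact hd (by
        by_cases hc : g 1 0 = 0
        · have : g 1 1 = 0 := by simpa [hc] using h0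
          simp [hc, this]
        · apply mul_right_cancel₀ hc
          linear_combination g 0 0 * g 1 0 * h0 - g 1 0 * g 1 0 * h3)
    · refine ⟨?_, by rw [div_mul_eq_mul_div, eq_div_iff h0]; ring⟩
      intro h2
      exact h0 (by apply mul_right_cancel₀ h1; linear_combination h2)

/-- The Möbius transformation `t ↦ (a t + b) / (c t + d)`. -/
def mob (a b c d : ℂ) (h : a * d - b * c ≠ 0) : Mob :=
  Matrix.GeneralLinearGroup.mkOfDetNeZero !![a, b; c, d] (by rwa [Matrix.det_fin_two_of])

theorem IsHomCoord.mob {s t : ℂ} {p : P1} (hp : IsHomCoord s t p) {a b c d : ℂ}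
    (h : a * d - b * c ≠ 0) :
    IsHomCoord (a * s + b * t) (c * s + d * t) (AugDef.mob a b c d h • p) := by
  simpa [AugDef.mob, Matrix.GeneralLinearGroup.mkOfDetNeZero] using hp.smul (AugDef.mob a b c d h)

/-- Three distinct points can be moved to `0`, `1`, `∞`. -/
theorem exists_mob_zero_one_infty {p₀ p₁ p₂ : P1} (h01 : p₀ ≠ p₁) (h02 : p₀ ≠ p₂)
    (h12 : p₁ ≠ p₂) : ∃ g : Mob, g • p₀ = OnePoint.some 0 ∧ g • p₁ = OnePoint.some 1 ∧
      g • p₂ = OnePoint.infty := by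
  obtain ⟨a0, b0, h0⟩ := exists_isHomCoord p₀
  obtain ⟨a1, b1, h1⟩ := exists_isHomCoord p₁
  obtain ⟨a2, b2, h2⟩ := exists_isHomCoord p₂
  rw [h0.ne_iff h1] at h01
  rw [h0.ne_iff h2] at h02
  rw [h1.ne_iff h2] at h12
  -- This is the cross ratio: the numerator vanishes at `p₀`, the denominator at `p₂`, and the
  -- factors make the value at `p₁` equal to 1. Up to sign the determinant is the product of the
  -- three brackets.
  refine ⟨mob (b0 * (a1 * b2 - a2 * b1)) (-a0 * (a1 * b2 - a2 * b1))
    (b2 * (a1 * b0 - a0 * b1)) (-a2 * (a1 * b0 - a0 * b1)) ?_, ?_, ?_, ?_⟩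
  · have : (a1 * b2 - a2 * b1) * (a0 * b1 - a1 * b0) * (a0 * b2 - a2 * b0) ≠ 0 := by
      simp [h01, h02, h12]
    intro h
    apply this
    linear_combination -h
  · rw [(h0.mob _).eq_iff (isHomCoord_some 0)]
    ring
  · rw [(h1.mob _).eq_iff (isHomCoord_some 1)]
    ring
  · rw [(h2.mob _).eq_iff isHomCoord_infty]
    ring

theorem smul_eq_self_of_fix {g : Mob} (h0 : g • (OnePoint.some 0 : P1) = OnePoint.some 0)
    (h1 : g • (OnePoint.some 1 : P1) = OnePoint.some 1)
    (h2 : g • (OnePoint.infty : P1) = OnePoint.infty) (p : P1) : g • p = p := by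
  rw [((isHomCoord_some 0).smul g).eq_iff (isHomCoord_some 0)] at h0
  rw [((isHomCoord_some 1).smul g).eq_iff (isHomCoord_some 1)] at h1
  rw [(isHomCoord_infty.smul g).eq_iff isHomCoord_infty] at h2
  obtain ⟨a, b, h⟩ := exists_isHomCoord p
  rw [(h.smul g).eq_iff h]
  linear_combination (b ^ 2 - a * b) * h0 + a * b * h1 + (a ^ 2 - a * b) * h2

/-- A Möbius transformation is determined by its values at three points. -/
theorem smul_eq_smul_of_three {g g' : Mob} {p₀ p₁ p₂ : P1} (h01 : p₀ ≠ p₁) (h02 : p₀ ≠ p₂)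
    (h12 : p₁ ≠ p₂) (h0 : g • p₀ = g' • p₀) (h1 : g • p₁ = g' • p₁) (h2 : g • p₂ = g' • p₂)
    (p : P1) : g • p = g' • p := by
  obtain ⟨k, k0, k1, k2⟩ := exists_mob_zero_one_infty h01 h02 h12
  have key : ∀ {r s : P1}, k • r = s → g • r = g' • r → (k * g'⁻¹ * g * k⁻¹) • s = s := by
    rintro r s rfl h
    simp [mul_smul, h]
  have := smul_eq_self_of_fix (key k0 h0) (key k1 h1) (key k2 h2) (k • p)
  simpa [mul_smul, inv_smul_eq_iff] using this

theorem exists_mob_three {p₀ p₁ p₂ q₀ q₁ q₂ : P1} (h01 : p₀ ≠ p₁) (h02 : p₀ ≠ p₂)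
    (h12 : p₁ ≠ p₂) (k01 : q₀ ≠ q₁) (k02 : q₀ ≠ q₂) (k12 : q₁ ≠ q₂) :
    ∃ g : Mob, g • p₀ = q₀ ∧ g • p₁ = q₁ ∧ g • p₂ = q₂ := by
  obtain ⟨g, g0, g1, g2⟩ := exists_mob_zero_one_infty h01 h02 h12
  obtain ⟨k, k0, k1, k2⟩ := exists_mob_zero_one_infty k01 k02 k12
  exact ⟨k⁻¹ * g, by simp [mul_smul, g0, ← k0], by simp [mul_smul, g1, ← k1],
    by simp [mul_smul, g2, ← k2]⟩

/-- Homogeneous coordinates of the cross ratio. -/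
theorem isHomCoord_crossRatio {a₀ b₀ a₁ b₁ a₂ b₂ a₃ b₃ : ℂ} {p₀ p₁ p₂ p₃ : P1}
    (h0 : IsHomCoord a₀ b₀ p₀) (h1 : IsHomCoord a₁ b₁ p₁) (h2 : IsHomCoord a₂ b₂ p₂)
    (h3 : IsHomCoord a₃ b₃ p₃) {g : Mob} (g0 : g • p₀ = OnePoint.some 0)
    (g1 : g • p₁ = OnePoint.some 1) (g2 : g • p₂ = OnePoint.infty) :
    IsHomCoord ((a₃ * b₀ - a₀ * b₃) * (a₁ * b₂ - a₂ * b₁))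
      ((a₃ * b₂ - a₂ * b₃) * (a₁ * b₀ - a₀ * b₁)) (g • p₃) := by
  have h01 : p₀ ≠ p₁ := by
    rintro rfl
    rw [g0] at g1
    simp at g1
  have h02 : p₀ ≠ p₂ := by
    rintro rfl
    rw [g0] at g2
    simp at g2
  have h12 : p₁ ≠ p₂ := by
    rintro rfl
    rw [g1] at g2
    simp at g2
  have d01 := (h0.ne_iff h1).1 h01
  have d02 := (h0.ne_iff h2).1 h02
  have d12 := (h1.ne_iff h2).1 h12
  have hd : b₀ * (a₁ * b₂ - a₂ * b₁) * (-a₂ * (a₁ * b₀ - a₀ * b₁)) -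
      -a₀ * (a₁ * b₂ - a₂ * b₁) * (b₂ * (a₁ * b₀ - a₀ * b₁)) ≠ 0 := by
    have : (a₁ * b₂ - a₂ * b₁) * (a₀ * b₁ - a₁ * b₀) * (a₀ * b₂ - a₂ * b₀) ≠ 0 := by
      simp [d01, d02, d12]
    intro h
    apply this
    linear_combination -h
  have key := smul_eq_smul_of_three (g := g) (g' := mob _ _ _ _ hd) h01 h02 h12
    (by rw [g0, eq_comm, (h0.mob _).eq_iff (isHomCoord_some 0)]; ring)
    (by rw [g1, eq_comm, (h1.mob _).eq_iff (isHomCoord_some 1)]; ring)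
    (by rw [g2, eq_comm, (h2.mob _).eq_iff isHomCoord_infty]; ring) p₃
  rw [key]
  convert h3.mob hd using 1 <;> ring

/-! ### The squaring map -/

/-- The squaring map of the projective line. -/
def sq : P1 → P1
  | OnePoint.some t => OnePoint.some (t ^ 2)
  | OnePoint.infty => OnePoint.infty

@[simp] theorem sq_some (t : ℂ) : sq (OnePoint.some t) = OnePoint.some (t ^ 2) := rfl

@[simp] theorem sq_infty : sq OnePoint.infty = OnePoint.infty := rfl

theorem IsHomCoord.sq {a b : ℂ} {p : P1} (h : IsHomCoord a b p) :
    IsHomCoord (a ^ 2) (b ^ 2) (sq p) := by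
  cases p using OnePoint.rec with
  | infty =>
    obtain ⟨h1, rfl⟩ := h
    exact ⟨by simpa using h1, by simp⟩
  | coe s =>
    obtain ⟨h1, rfl⟩ := h
    exact ⟨by simpa using h1, by ring⟩

/-- The scaling `t ↦ c t`. -/
def scale (c : ℂ) (hc : c ≠ 0) : Mob := mob c 0 0 1 (by simpa using hc)

@[simp] theorem scale_some (c : ℂ) (hc : c ≠ 0) (t : ℂ) :
    scale c hc • (OnePoint.some t : P1) = OnePoint.some (c * t) := by
  unfold scale
  rw [((isHomCoord_some t).mob _).eq_iff (isHomCoord_some _)]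
  ring

@[simp] theorem scale_infty (c : ℂ) (hc : c ≠ 0) :
    scale c hc • (OnePoint.infty : P1) = OnePoint.infty := by
  unfold scale
  rw [(isHomCoord_infty.mob _).eq_iff isHomCoord_infty]
  ring

theorem sq_scale (c : ℂ) (hc : c ≠ 0) (p : P1) :
    sq (scale c hc • p) = scale (c ^ 2) (pow_ne_zero 2 hc) • sq p := by
  cases p using OnePoint.rec with
  | infty => simp
  | coe t => simp [mul_pow]

/-- The inversion `t ↦ 1 / t`. -/
def invMob : Mob := mob 0 1 1 0 (by norm_num)

@[simp] theorem invMob_infty : invMob • (OnePoint.infty : P1) = OnePoint.some 0 := by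
  unfold invMob
  rw [(isHomCoord_infty.mob _).eq_iff (isHomCoord_some _)]
  ring

@[simp] theorem invMob_zero : invMob • (OnePoint.some 0 : P1) = OnePoint.infty := by
  unfold invMob
  rw [((isHomCoord_some 0).mob _).eq_iff isHomCoord_infty]
  ring

theorem sq_invMob (p : P1) : sq (invMob • p) = invMob • sq p := by
  obtain ⟨a, b, h⟩ := exists_isHomCoord p
  unfold invMob
  rw [(h.mob _).sq.eq_iff (h.sq.mob _)]
  ring

theorem invMob_invMob (p : P1) : invMob • invMob • p = p := by
  obtain ⟨a, b, h⟩ := exists_isHomCoord p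
  unfold invMob
  rw [((h.mob _).mob _).eq_iff h]
  ring

/-- A Möbius transformation fixing `0` and `∞` is a scaling. -/
theorem exists_eq_scale {g : Mob} (h0 : g • (OnePoint.some 0 : P1) = OnePoint.some 0)
    (h2 : g • (OnePoint.infty : P1) = OnePoint.infty) :
    ∃ (c : ℂ) (hc : c ≠ 0), ∀ p : P1, g • p = scale c hc • p := by
  have h1 : g • (OnePoint.some 1 : P1) ≠ OnePoint.infty := by
    rw [← h2]
    intro h
    simpa using smul_left_cancel g h
  obtain ⟨c, hc⟩ := OnePoint.ne_infty_iff_exists.1 h1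
  have hc0 : c ≠ 0 := by
    rintro rfl
    have h : g • (OnePoint.some 1 : P1) = g • (OnePoint.some 0 : P1) := by rw [h0, ← hc]
    simpa using smul_left_cancel g h
  refine ⟨c, hc0, fun p => smul_eq_smul_of_three (p₀ := OnePoint.some 0) (p₁ := OnePoint.some 1)
    (p₂ := OnePoint.infty) (by simp) (by simp) (by simp) ?_ ?_ ?_ p⟩
  · rw [h0]; simp
  · rw [← hc]; simp
  · rw [h2]; simp

theorem sq_eq_zero_iff {p : P1} : sq p = OnePoint.some 0 ↔ p = OnePoint.some 0 := by
  cases p using OnePoint.rec <;> simp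

theorem sq_eq_infty_iff {p : P1} : sq p = OnePoint.infty ↔ p = OnePoint.infty := by
  cases p using OnePoint.rec <;> simp

/-- The fibres of the squaring map. -/
theorem sq_eq_sq_iff {p q : P1} :
    sq p = sq q ↔ p = q ∨ p = scale (-1) (by norm_num) • q := by
  cases p using OnePoint.rec <;> cases q using OnePoint.rec <;> simp [sq_eq_sq_iff_eq_or_eq_neg]

theorem scale_neg_one_eq_self_iff {p : P1} :
    scale (-1) (by norm_num) • p = p ↔ p = OnePoint.some 0 ∨ p = OnePoint.infty := by
  cases p using OnePoint.rec with
  | infty => simp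
  | coe t =>
    simp only [scale_some, OnePoint.coe_eq_coe, OnePoint.coe_ne_infty, or_false]
    constructor
    · intro h
      have : 2 * t = 0 := by linear_combination -h
      simpa using this
    · rintro rfl; simp

theorem exists_sq_eq (p : P1) : ∃ q, sq q = p := by
  cases p using OnePoint.rec with
  | infty => exact ⟨OnePoint.infty, rfl⟩
  | coe t =>
    obtain ⟨s, hs⟩ := IsAlgClosed.exists_pow_nat_eq t (n := 2) (by norm_num)
    exact ⟨OnePoint.some s, by simp [hs]⟩

/-! ### Rational maps of degree at most two -/

namespace RatMap

theorem localDegree_le_degree (F : RatMap) (p : P1) : F.localDegree p ≤ F.degree := by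
  cases p using OnePoint.rec with
  | infty => exact Nat.sub_le _ _
  | coe t =>
    change (F.fibrePoly (F.apply (OnePoint.some t))).rootMultiplicity t ≤ F.degree
    rw [← Polynomial.count_roots]
    refine ((Multiset.count_le_card _ _).trans (Polynomial.card_roots' _)).trans ?_
    cases F.apply (OnePoint.some t) using OnePoint.rec with
    | infty => exact le_max_right _ _
    | coe b =>
      refine (Polynomial.natDegree_sub_le _ _).trans (max_le_max le_rfl ?_)
      exact Polynomial.natDegree_C_mul_le _ _

theorem not_eval_eq_zero (F : RatMap) (t : ℂ) : ¬ (F.num.eval t = 0 ∧ F.den.eval t = 0) := by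
  rintro ⟨h1, h2⟩
  obtain ⟨a, b, h⟩ := F.coprime
  have := congrArg (Polynomial.eval t) h
  simp [h1, h2] at this

theorem not_coeff_eq_zero (F : RatMap) (hF : F.degree ≠ 0) :
    ¬ (F.num.coeff F.degree = 0 ∧ F.den.coeff F.degree = 0) := by
  rintro ⟨h1, h2⟩
  rcases max_choice F.num.natDegree F.den.natDegree with h | h
  · have h' : F.degree = F.num.natDegree := h
    rw [h', Polynomial.coeff_natDegree, Polynomial.leadingCoeff_eq_zero] at h1
    rw [h1, Polynomial.natDegree_zero] at h'
    exact hF h'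
  · have h' : F.degree = F.den.natDegree := h
    rw [h', Polynomial.coeff_natDegree, Polynomial.leadingCoeff_eq_zero] at h2
    rw [h2, Polynomial.natDegree_zero] at h'
    exact hF h'

/-- The fibre polynomial is a member of the pencil spanned by numerator and denominator; in this
form finite values and the value ∞ are treated together. -/
theorem exists_fibrePoly_some (F : RatMap) (t : ℂ) : ∃ e₁ e₂ : ℂ, (e₁ ≠ 0 ∨ e₂ ≠ 0) ∧
    F.fibrePoly (F.apply (OnePoint.some t)) = Polynomial.C e₁ * F.num + Polynomial.C e₂ * F.den ∧
    e₁ * F.num.eval t + e₂ * F.den.eval t = 0 := by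
  by_cases h : F.den.eval t = 0
  · refine ⟨0, 1, Or.inr one_ne_zero, ?_, by simp [h]⟩
    simp [apply, h, fibrePoly]
  · refine ⟨1, -(F.num.eval t / F.den.eval t), Or.inl one_ne_zero, ?_, by field_simp; ring⟩
    simp [apply, h, fibrePoly, sub_eq_add_neg]

theorem exists_fibrePoly_infty (F : RatMap) : ∃ e₁ e₂ : ℂ, (e₁ ≠ 0 ∨ e₂ ≠ 0) ∧
    F.fibrePoly (F.apply OnePoint.infty) = Polynomial.C e₁ * F.num + Polynomial.C e₂ * F.den ∧
    e₁ * F.num.coeff F.degree + e₂ * F.den.coeff F.degree = 0 := by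
  by_cases h : F.den.coeff F.degree = 0
  · refine ⟨0, 1, Or.inr one_ne_zero, ?_, by simp [h]⟩
    simp [apply, h, fibrePoly]
  · refine ⟨1, -(F.num.coeff F.degree / F.den.coeff F.degree), Or.inl one_ne_zero, ?_,
      by field_simp; ring⟩
    simp [apply, h, fibrePoly, sub_eq_add_neg]

end RatMap

/-! ### Pencils of binary quadratic forms -/

theorem exists_zero_binary_quadratic (α β γ : ℂ) :
    ∃ s t : ℂ, (s ≠ 0 ∨ t ≠ 0) ∧ α * s ^ 2 + β * s * t + γ * t ^ 2 = 0 := by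
  by_cases hα : α = 0
  · exact ⟨1, 0, Or.inl one_ne_zero, by simp [hα]⟩
  · obtain ⟨d, hd⟩ := IsAlgClosed.exists_pow_nat_eq (β ^ 2 - 4 * α * γ) (n := 2) (by norm_num)
    refine ⟨(-β + d) / (2 * α), 1, Or.inr one_ne_zero, ?_⟩
    field_simp
    linear_combination hd

theorem exists_eq_sq_of_discrim (a b c : ℂ) (h : b ^ 2 = 4 * a * c) :
    ∃ m n : ℂ, a = m ^ 2 ∧ b = 2 * m * n ∧ c = n ^ 2 := by
  by_cases ha : a = 0
  · obtain ⟨n, hn⟩ := IsAlgClosed.exists_pow_nat_eq c (n := 2) (by norm_num)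
    have : b = 0 := by simpa [ha] using h
    exact ⟨0, n, by simp [ha], by simp [this], hn.symm⟩
  · obtain ⟨m, hm⟩ := IsAlgClosed.exists_pow_nat_eq a (n := 2) (by norm_num)
    have hm0 : m ≠ 0 := by
      rintro rfl
      simp at hm
      exact ha hm.symm
    refine ⟨m, b / (2 * m), hm.symm, by field_simp, ?_⟩
    field_simp
    rw [hm]
    linear_combination -h

/-- Two binary quadratic forms without common zero are combinations of two squares. -/
theorem exists_sum_of_squares (a₂ a₁ a₀ b₂ b₁ b₀ : ℂ)
    (h : ∀ s t : ℂ, (s ≠ 0 ∨ t ≠ 0) → ¬ (a₂ * s ^ 2 + a₁ * s * t + a₀ * t ^ 2 = 0 ∧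
      b₂ * s ^ 2 + b₁ * s * t + b₀ * t ^ 2 = 0)) :
    ∃ g00 g01 g10 g11 h00 h01 h10 h11 : ℂ, g00 * g11 - g01 * g10 ≠ 0 ∧
      h00 * h11 - h01 * h10 ≠ 0 ∧
      a₂ = g00 * h00 ^ 2 + g01 * h10 ^ 2 ∧ a₁ = 2 * g00 * h00 * h01 + 2 * g01 * h10 * h11 ∧
      a₀ = g00 * h01 ^ 2 + g01 * h11 ^ 2 ∧
      b₂ = g10 * h00 ^ 2 + g11 * h10 ^ 2 ∧ b₁ = 2 * g10 * h00 * h01 + 2 * g11 * h10 * h11 ∧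
      b₀ = g10 * h01 ^ 2 + g11 * h11 ^ 2 := by
  -- The discriminant of l·N + m·D is itself a binary quadratic form in (l, m). At a zero of it the
  -- member of the pencil is the square of a linear form u s + v t.
  obtain ⟨l, m, hlm, hdisc⟩ := exists_zero_binary_quadratic (a₁ ^ 2 - 4 * a₂ * a₀)
    (2 * a₁ * b₁ - 4 * a₂ * b₀ - 4 * a₀ * b₂) (b₁ ^ 2 - 4 * b₂ * b₀)
  obtain ⟨u, v, h2, h1, h0⟩ := exists_eq_sq_of_discrim (l * a₂ + m * b₂) (l * a₁ + m * b₁)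
    (l * a₀ + m * b₀) (by linear_combination hdisc)
  obtain ⟨l', m', hΔ⟩ : ∃ l' m' : ℂ, l * m' - m * l' ≠ 0 := by
    rcases hlm with hl | hm
    · exact ⟨0, 1, by simpa using hl⟩
    · exact ⟨-1, 0, by simpa using hm⟩
  have hcomb : ∀ N D : ℂ, l * N + m * D = 0 → l' * N + m' * D = 0 → N = 0 ∧ D = 0 := by
    intro N D e1 e2
    constructor
    · apply (mul_eq_zero.1 (?_ : (l * m' - m * l') * N = 0)).resolve_left hΔ
      linear_combination m' * e1 - m * e2
    · apply (mul_eq_zero.1 (?_ : (l * m' - m * l') * D = 0)).resolve_left hΔ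
      linear_combination l * e2 - l' * e1
  obtain ⟨q2, hq2⟩ : ∃ q2, q2 = l' * a₂ + m' * b₂ := ⟨_, rfl⟩
  obtain ⟨q1, hq1⟩ : ∃ q1, q1 = l' * a₁ + m' * b₁ := ⟨_, rfl⟩
  obtain ⟨q0, hq0⟩ : ∃ q0, q0 = l' * a₀ + m' * b₀ := ⟨_, rfl⟩
  have huv : u ≠ 0 ∨ v ≠ 0 := by
    by_contra hcon
    push Not at hcon
    obtain ⟨rfl, rfl⟩ := hcon
    obtain ⟨s, t, hst, hz⟩ := exists_zero_binary_quadratic q2 q1 q0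
    refine h s t hst (hcomb _ _ ?_ ?_)
    · linear_combination s ^ 2 * h2 + s * t * h1 + t ^ 2 * h0
    · rw [hq2, hq1, hq0] at hz
      linear_combination hz
  -- This is the value of a second member Q of the pencil at the zero (v, −u) of the linear form; if
  -- it vanished, the pencil would have a base point.
  have hκ : q2 * v ^ 2 - q1 * u * v + q0 * u ^ 2 ≠ 0 := by
    intro hz
    refine h v (-u) ?_ (hcomb _ _ ?_ ?_)
    · rcases huv with h | h
      · exact Or.inr (neg_ne_zero.2 h)
      · exact Or.inl h
    · linear_combination v ^ 2 * h2 - u * v * h1 + u ^ 2 * h0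
    · rw [hq2, hq1, hq0] at hz
      linear_combination hz
  obtain ⟨κ, hκd⟩ : ∃ κ, κ = q2 * v ^ 2 - q1 * u * v + q0 * u ^ 2 := ⟨_, rfl⟩
  obtain ⟨Δ, hΔd⟩ : ∃ Δ, Δ = l * m' - m * l' := ⟨_, rfl⟩
  rw [← hκd] at hκ
  rw [← hΔd] at hΔ
  have solve : ∀ N D A Q : ℂ, l * N + m * D = A → l' * N + m' * D = Q →
      N = (m' * A - m * Q) / Δ ∧ D = (l * Q - l' * A) / Δ := by
    intro N D A Q e1 e2
    rw [eq_div_iff hΔ, eq_div_iff hΔ, hΔd]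
    constructor
    · linear_combination m' * e1 - m * e2
    · linear_combination l * e2 - l' * e1
  obtain ⟨sa2, sb2⟩ := solve _ _ _ _ h2 hq2.symm
  obtain ⟨sa1, sb1⟩ := solve _ _ _ _ h1 hq1.symm
  obtain ⟨sa0, sb0⟩ := solve _ _ _ _ h0 hq0.symm
  -- With W the polar form of Q at (v, −u) and δ the discriminant of Q, one has 4κQ = W² − δ(us +
  -- vt)². So W² and (us + vt)² span the pencil.
  have e2 : q2 = ((2 * q2 * v - q1 * u) ^ 2 - (q1 ^ 2 - 4 * q2 * q0) * u ^ 2) / (4 * κ) := by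
    rw [eq_div_iff (by simpa using hκ), hκd]; ring
  have e1 : q1 = (2 * (2 * q2 * v - q1 * u) * (q1 * v - 2 * q0 * u) -
      (q1 ^ 2 - 4 * q2 * q0) * (2 * u * v)) / (4 * κ) := by
    rw [eq_div_iff (by simpa using hκ), hκd]; ring
  have e0 : q0 = ((q1 * v - 2 * q0 * u) ^ 2 - (q1 ^ 2 - 4 * q2 * q0) * v ^ 2) / (4 * κ) := by
    rw [eq_div_iff (by simpa using hκ), hκd]; ring
  obtain ⟨w2, hw2⟩ : ∃ w, w = 2 * q2 * v - q1 * u := ⟨_, rfl⟩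
  obtain ⟨w1, hw1⟩ : ∃ w, w = q1 * v - 2 * q0 * u := ⟨_, rfl⟩
  obtain ⟨δ, hδ⟩ : ∃ w, w = q1 ^ 2 - 4 * q2 * q0 := ⟨_, rfl⟩
  rw [← hw2, ← hδ] at e2
  rw [← hw2, ← hw1, ← hδ] at e1
  rw [← hw1, ← hδ] at e0
  refine ⟨-m / (4 * κ * Δ), m' / Δ + m * δ / (4 * κ * Δ), l / (4 * κ * Δ),
    -l' / Δ - l * δ / (4 * κ * Δ), w2, w1, u, v, ?_, ?_, ?_, ?_, ?_, ?_, ?_, ?_⟩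
  · have : -m / (4 * κ * Δ) * (-l' / Δ - l * δ / (4 * κ * Δ)) -
        (m' / Δ + m * δ / (4 * κ * Δ)) * (l / (4 * κ * Δ)) = -1 / (4 * κ * Δ) := by
      field_simp
      rw [hΔd]
      ring
    rw [this]
    simp [hκ, hΔ]
  · have : w2 * v - w1 * u = 2 * κ := by rw [hw2, hw1, hκd]; ring
    rw [this]
    simpa using hκ
  · rw [sa2, e2]; field_simp; ring
  · rw [sa1, e1]; field_simp; ring
  · rw [sa0, e0]; field_simp; ring
  · rw [sb2, e2]; field_simp; ring
  · rw [sb1, e1]; field_simp; ring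
  · rw [sb0, e0]; field_simp; ring

namespace RatMap

open Polynomial in
/-- A rational map of degree two is the squaring map up to coordinate changes. -/
theorem exists_eq_sq (F : RatMap) (hF : F.degree = 2) :
    ∃ G H : Mob, (∀ p, F.apply p = G • sq (H • p)) ∧
      (∀ p, H • p = OnePoint.some 0 ∨ H • p = OnePoint.infty → F.localDegree p = 2) ∧
      ∀ p, ¬ (H • p = OnePoint.some 0 ∨ H • p = OnePoint.infty) → F.localDegree p = 1 := by
  have hnum : F.num = C (F.num.coeff 2) * X ^ 2 + C (F.num.coeff 1) * X + C (F.num.coeff 0) :=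
    eq_quadratic_of_degree_le_two
      (natDegree_le_iff_degree_le.1 (hF ▸ le_max_left _ _ : F.num.natDegree ≤ 2))
  have hden : F.den = C (F.den.coeff 2) * X ^ 2 + C (F.den.coeff 1) * X + C (F.den.coeff 0) :=
    eq_quadratic_of_degree_le_two
      (natDegree_le_iff_degree_le.1 (hF ▸ le_max_right _ _ : F.den.natDegree ≤ 2))
  have hlead := F.not_coeff_eq_zero (by rw [hF]; norm_num)
  have hinf := F.exists_fibrePoly_infty
  have happinf : F.apply OnePoint.infty = if F.den.coeff F.degree = 0 then OnePoint.infty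
      else OnePoint.some (F.num.coeff F.degree / F.den.coeff F.degree) := rfl
  rw [hF] at hlead hinf happinf
  have heval := F.not_eval_eq_zero
  obtain ⟨a₂, ha2⟩ : ∃ a, a = F.num.coeff 2 := ⟨_, rfl⟩
  obtain ⟨a₁, ha1⟩ : ∃ a, a = F.num.coeff 1 := ⟨_, rfl⟩
  obtain ⟨a₀, ha0⟩ : ∃ a, a = F.num.coeff 0 := ⟨_, rfl⟩
  obtain ⟨b₂, hb2⟩ : ∃ a, a = F.den.coeff 2 := ⟨_, rfl⟩
  obtain ⟨b₁, hb1⟩ : ∃ a, a = F.den.coeff 1 := ⟨_, rfl⟩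
  obtain ⟨b₀, hb0⟩ : ∃ a, a = F.den.coeff 0 := ⟨_, rfl⟩
  rw [← ha2, ← ha1, ← ha0] at hnum
  rw [← hb2, ← hb1, ← hb0] at hden
  rw [← ha2, ← hb2] at hlead hinf happinf
  have evn : ∀ t, F.num.eval t = a₂ * t ^ 2 + a₁ * t + a₀ := by intro t; rw [hnum]; simp
  have evd : ∀ t, F.den.eval t = b₂ * t ^ 2 + b₁ * t + b₀ := by intro t; rw [hden]; simp
  have hne : ∀ s t : ℂ, (s ≠ 0 ∨ t ≠ 0) → ¬ (a₂ * s ^ 2 + a₁ * s * t + a₀ * t ^ 2 = 0 ∧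
      b₂ * s ^ 2 + b₁ * s * t + b₀ * t ^ 2 = 0) := by
    rintro s t hst ⟨h1, h2⟩
    by_cases ht : t = 0
    · subst ht
      have hs : s ≠ 0 := by simpa using hst
      simp [hs] at h1 h2
      exact hlead ⟨h1, h2⟩
    · apply heval (s / t)
      rw [evn, evd]
      constructor
      · field_simp; linear_combination h1
      · field_simp; linear_combination h2
  have happ : ∀ {s t : ℂ} {p : P1}, IsHomCoord s t p →
      IsHomCoord (a₂ * s ^ 2 + a₁ * s * t + a₀ * t ^ 2) (b₂ * s ^ 2 + b₁ * s * t + b₀ * t ^ 2)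
        (F.apply p) := by
    intro s t p hp
    have hN := hne s t hp.ne_zero
    cases p using OnePoint.rec with
    | infty =>
      obtain ⟨hs, rfl⟩ := hp
      rw [happinf]
      simp only [mul_zero, ne_eq, OfNat.ofNat_ne_zero, not_false_eq_true, zero_pow, add_zero] at hN ⊢
      split_ifs with h
      · exact ⟨fun h' => hN ⟨h', by simp [h]⟩, by simp [h]⟩
      · exact ⟨by simp [h, hs], by field_simp⟩
    | coe r =>
      obtain ⟨ht, rfl⟩ := hp
      have e1 : b₂ * (r * t) ^ 2 + b₁ * (r * t) * t + b₀ * t ^ 2 = F.den.eval r * t ^ 2 := by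
        rw [evd]; ring
      have e2 : a₂ * (r * t) ^ 2 + a₁ * (r * t) * t + a₀ * t ^ 2 = F.num.eval r * t ^ 2 := by
        rw [evn]; ring
      rw [e1, e2] at hN ⊢
      change IsHomCoord _ _ (if F.den.eval r = 0 then OnePoint.infty
        else OnePoint.some (F.num.eval r / F.den.eval r))
      split_ifs with h
      · exact ⟨fun h' => hN ⟨h', by simp [h]⟩, by simp [h]⟩
      · exact ⟨mul_ne_zero h (pow_ne_zero _ ht), by field_simp⟩
  obtain ⟨g00, g01, g10, g11, h00, h01, h10, h11, hG, hH, ea2, ea1, ea0, eb2, eb1, eb0⟩ :=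
    exists_sum_of_squares a₂ a₁ a₀ b₂ b₁ b₀ hne
  -- Let A, B be the two linear forms of H. A member of the pencil that vanishes where (A, B) = (u,
  -- v) is a multiple of v²A² − u²B² = (vA − uB)(vA + uB): the two points of a fibre differ by the
  -- sign of A/B.
  have hfac : ∀ e₁ e₂ u v : ℂ, (e₁ ≠ 0 ∨ e₂ ≠ 0) → (u ≠ 0 ∨ v ≠ 0) →
      (e₁ * g00 + e₂ * g10) * u ^ 2 + (e₁ * g01 + e₂ * g11) * v ^ 2 = 0 →
      ∃ κ : ℂ, κ ≠ 0 ∧ C e₁ * F.num + C e₂ * F.den =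
        C κ * ((C (v * h00 - u * h10) * X + C (v * h01 - u * h11)) *
          (C (v * h00 + u * h10) * X + C (v * h01 + u * h11))) := by
    intro e₁ e₂ u v he huv hz
    obtain ⟨f₁, hf1⟩ : ∃ f, f = e₁ * g00 + e₂ * g10 := ⟨_, rfl⟩
    obtain ⟨f₂, hf2⟩ : ∃ f, f = e₁ * g01 + e₂ * g11 := ⟨_, rfl⟩
    rw [← hf1, ← hf2] at hz
    have hf : ¬ (f₁ = 0 ∧ f₂ = 0) := by
      rintro ⟨r1, r2⟩
      rw [r1] at hf1
      rw [r2] at hf2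
      rcases he with he | he
      · apply he
        apply (mul_eq_zero.1 (?_ : (g00 * g11 - g01 * g10) * e₁ = 0)).resolve_left hG
        linear_combination g10 * hf2 - g11 * hf1
      · apply he
        apply (mul_eq_zero.1 (?_ : (g00 * g11 - g01 * g10) * e₂ = 0)).resolve_left hG
        linear_combination g01 * hf1 - g00 * hf2
    obtain ⟨κ, hκ, k1, k2⟩ : ∃ κ : ℂ, κ ≠ 0 ∧ f₁ = κ * v ^ 2 ∧ f₂ = -κ * u ^ 2 := by
      by_cases hv : v = 0
      · subst hv
        have hu : u ≠ 0 := by simpa using huv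
        have : f₁ = 0 := by simpa [hu] using hz
        refine ⟨-f₂ / u ^ 2, ?_, by simp [this], by field_simp⟩
        have : f₂ ≠ 0 := fun h' => hf ⟨this, h'⟩
        simp [this, hu]
      · refine ⟨f₁ / v ^ 2, ?_, by field_simp, by field_simp; linear_combination hz⟩
        have : f₁ ≠ 0 := by
          intro h'
          apply hf ⟨h', ?_⟩
          simpa [h', hv] using hz
        simp [this, hv]
    refine ⟨κ, hκ, ?_⟩
    rw [hnum, hden]
    have c2 : e₁ * a₂ + e₂ * b₂ = κ * ((v * h00 - u * h10) * (v * h00 + u * h10)) := by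
      rw [ea2, eb2]; linear_combination h00 ^ 2 * (k1 - hf1) + h10 ^ 2 * (k2 - hf2)
    have c1 : e₁ * a₁ + e₂ * b₁ = κ * ((v * h00 - u * h10) * (v * h01 + u * h11) +
        (v * h01 - u * h11) * (v * h00 + u * h10)) := by
      rw [ea1, eb1]; linear_combination 2 * h00 * h01 * (k1 - hf1) + 2 * h10 * h11 * (k2 - hf2)
    have c0 : e₁ * a₀ + e₂ * b₀ = κ * ((v * h01 - u * h11) * (v * h01 + u * h11)) := by
      rw [ea0, eb0]; linear_combination h01 ^ 2 * (k1 - hf1) + h11 ^ 2 * (k2 - hf2)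
    have : C e₁ * (C a₂ * X ^ 2 + C a₁ * X + C a₀) + C e₂ * (C b₂ * X ^ 2 + C b₁ * X + C b₀) =
        C (e₁ * a₂ + e₂ * b₂) * X ^ 2 + C (e₁ * a₁ + e₂ * b₁) * X + C (e₁ * a₀ + e₂ * b₀) := by
      simp only [map_add, map_mul]; ring
    rw [this, c2, c1, c0]
    simp only [map_add, map_mul, map_sub]
    ring
  have hHc : ∀ {s t : ℂ} {p : P1}, IsHomCoord s t p →
      IsHomCoord (h00 * s + h01 * t) (h10 * s + h11 * t) (mob h00 h01 h10 h11 hH • p) :=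
    fun hp => hp.mob hH
  have hcrit : ∀ {s t : ℂ} {p : P1}, IsHomCoord s t p →
      ((mob h00 h01 h10 h11 hH • p = OnePoint.some 0 ∨
        mob h00 h01 h10 h11 hH • p = OnePoint.infty) ↔
      (h00 * s + h01 * t) * (h10 * s + h11 * t) = 0) := by
    intro s t p hp
    rw [(hHc hp).eq_iff (isHomCoord_some 0), (hHc hp).eq_iff isHomCoord_infty, mul_eq_zero]
    simp [eq_comm]
  have hdeg : ∀ {s t : ℂ} {p : P1}, IsHomCoord s t p → (s = 1 ∧ t = 0 ∨ t = 1) →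
      ((h00 * s + h01 * t) * (h10 * s + h11 * t) = 0 → F.localDegree p = 2) ∧
      ((h00 * s + h01 * t) * (h10 * s + h11 * t) ≠ 0 → F.localDegree p = 1) := by
    intro s t p hp hst
    have huv := (hHc hp).ne_zero
    cases p using OnePoint.rec with
    | infty =>
      have ht : t = 0 := hp.2
      subst ht
      obtain rfl : s = 1 := by simpa using hst
      obtain ⟨e₁, e₂, he, hpoly, hz⟩ := hinf
      have hz' : (e₁ * g00 + e₂ * g10) * (h00 * 1 + h01 * 0) ^ 2 +
          (e₁ * g01 + e₂ * g11) * (h10 * 1 + h11 * 0) ^ 2 = 0 := by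
        rw [ea2, eb2] at hz
        linear_combination hz
      obtain ⟨κ, hκ, hfacκ⟩ := hfac e₁ e₂ _ _ he huv hz'
      have hl : F.localDegree OnePoint.infty =
          F.degree - (F.fibrePoly (F.apply OnePoint.infty)).natDegree := rfl
      rw [hl, hF, hpoly, hfacκ]
      simp only [mul_one, mul_zero, add_zero] at huv ⊢
      -- At ∞ the factor vA − uB is constant. The local degree is the drop of degree, so it depends
      -- on whether the leading coefficient 2uv of the other factor vanishes.
      have z1 : h10 * h00 - h00 * h10 = 0 := by ring
      have z2 : h10 * h00 + h00 * h10 = 2 * (h00 * h10) := by ring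
      have z3 : h10 * h01 - h00 * h11 ≠ 0 := fun h' => hH (by linear_combination -h')
      rw [z1, z2, map_zero, zero_mul, zero_add, ← mul_assoc, ← map_mul,
        natDegree_C_mul (mul_ne_zero hκ z3)]
      constructor
      · intro h'
        rw [h', mul_zero, map_zero, zero_mul, zero_add, natDegree_C]
      · intro h'
        rw [natDegree_linear (mul_ne_zero two_ne_zero h')]
    | coe r =>
      have ht0 : t ≠ 0 := hp.1
      obtain rfl : t = 1 := by simpa [ht0] using hst
      obtain rfl : s = r := by simpa using hp.2
      obtain ⟨e₁, e₂, he, hpoly, hz⟩ := F.exists_fibrePoly_some s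
      have hz' : (e₁ * g00 + e₂ * g10) * (h00 * s + h01 * 1) ^ 2 +
          (e₁ * g01 + e₂ * g11) * (h10 * s + h11 * 1) ^ 2 = 0 := by
        rw [evn, evd, ea2, eb2, ea1, eb1, ea0, eb0] at hz
        linear_combination hz
      obtain ⟨κ, hκ, hfacκ⟩ := hfac e₁ e₂ _ _ he huv hz'
      have hl : F.localDegree (OnePoint.some s) =
          (F.fibrePoly (F.apply (OnePoint.some s))).rootMultiplicity s := rfl
      rw [hl, hpoly, hfacκ]
      obtain ⟨u, hu⟩ : ∃ u, u = h00 * s + h01 * 1 := ⟨_, rfl⟩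
      obtain ⟨v, hv⟩ : ∃ u, u = h10 * s + h11 * 1 := ⟨_, rfl⟩
      rw [← hu, ← hv] at huv ⊢
      have z1 : C (v * h00 - u * h10) * X + C (v * h01 - u * h11) =
          C (h00 * h11 - h01 * h10) * (X - C s) := by
        have y1 : v * h00 - u * h10 = h00 * h11 - h01 * h10 := by rw [hu, hv]; ring
        have y2 : v * h01 - u * h11 = - ((h00 * h11 - h01 * h10) * s) := by rw [hu, hv]; ring
        rw [y1, y2, map_neg, map_mul]
        ring
      constructor
      · intro h'
        -- If u or v vanishes, the two factors agree up to sign and the root is double.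
        have : ∃ ε : ℂ, ε ≠ 0 ∧ C (v * h00 + u * h10) * X + C (v * h01 + u * h11) =
            C ε * (C (v * h00 - u * h10) * X + C (v * h01 - u * h11)) := by
          rcases mul_eq_zero.1 h' with h' | h'
          · exact ⟨1, one_ne_zero, by simp [h']⟩
          · refine ⟨-1, by norm_num, ?_⟩
            simp only [h', zero_mul, zero_add, zero_sub, map_neg, map_mul, map_one]
            ring
        obtain ⟨ε, hε, hεe⟩ := this
        rw [hεe, z1]
        have : C κ * (C (h00 * h11 - h01 * h10) * (X - C s) *
            (C ε * (C (h00 * h11 - h01 * h10) * (X - C s)))) =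
            C (κ * (h00 * h11 - h01 * h10) * ε * (h00 * h11 - h01 * h10)) * (X - C s) ^ 2 := by
          simp only [map_mul]; ring
        have hne0 : κ * (h00 * h11 - h01 * h10) * ε * (h00 * h11 - h01 * h10) ≠ 0 := by
          simp only [ne_eq, mul_eq_zero, not_or]; exact ⟨⟨⟨hκ, hH⟩, hε⟩, hH⟩
        rw [this, rootMultiplicity_mul (mul_ne_zero (C_ne_zero.2 hne0)
          (pow_ne_zero _ (X_sub_C_ne_zero _))), rootMultiplicity_C, rootMultiplicity_X_sub_C_pow]
      · intro h'
        have hev : (C (v * h00 + u * h10) * X + C (v * h01 + u * h11)).eval s ≠ 0 := by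
          have : (C (v * h00 + u * h10) * X + C (v * h01 + u * h11)).eval s = 2 * (u * v) := by
            simp only [eval_add, eval_mul, eval_C, eval_X]
            linear_combination (-v) * hu - u * hv
          rw [this]
          exact mul_ne_zero two_ne_zero h'
        have hq0 : C (v * h00 + u * h10) * X + C (v * h01 + u * h11) ≠ 0 := by
          intro h''
          rw [h''] at hev
          simp at hev
        have : C κ * (C (h00 * h11 - h01 * h10) * (X - C s) *
            (C (v * h00 + u * h10) * X + C (v * h01 + u * h11))) =
            C (κ * (h00 * h11 - h01 * h10)) * (X - C s) ^ 1 *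
            (C (v * h00 + u * h10) * X + C (v * h01 + u * h11)) := by
          simp only [map_mul]; ring
        have hne0 : C (κ * (h00 * h11 - h01 * h10)) ≠ 0 := C_ne_zero.2 (mul_ne_zero hκ hH)
        rw [z1, this, rootMultiplicity_mul (mul_ne_zero (mul_ne_zero hne0
          (pow_ne_zero _ (X_sub_C_ne_zero _))) hq0), rootMultiplicity_mul (mul_ne_zero hne0
          (pow_ne_zero _ (X_sub_C_ne_zero _))), rootMultiplicity_C, rootMultiplicity_X_sub_C_pow,
          rootMultiplicity_eq_zero hev]
  refine ⟨mob g00 g01 g10 g11 hG, mob h00 h01 h10 h11 hH, ?_, ?_, ?_⟩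
  · intro p
    obtain ⟨s, t, hp⟩ := exists_isHomCoord p
    rw [(happ hp).eq_iff ((hHc hp).sq.mob hG), ea2, ea1, ea0, eb2, eb1, eb0]
    ring
  · intro p hp
    cases p using OnePoint.rec with
    | infty => exact (hdeg isHomCoord_infty (by simp)).1 ((hcrit isHomCoord_infty).1 hp)
    | coe r => exact (hdeg (isHomCoord_some r) (by simp)).1 ((hcrit (isHomCoord_some r)).1 hp)
  · intro p hp
    cases p using OnePoint.rec with
    | infty => exact (hdeg isHomCoord_infty (by simp)).2 (fun h => hp ((hcrit isHomCoord_infty).2 h))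
    | coe r =>
      exact (hdeg (isHomCoord_some r) (by simp)).2 (fun h => hp ((hcrit (isHomCoord_some r)).2 h))

open Polynomial in
/-- A rational map of degree one is a Möbius transformation. -/
theorem exists_eq_mob (F : RatMap) (hF : F.degree = 1) :
    (∃ G : Mob, ∀ p, F.apply p = G • p) ∧ ∀ p, F.localDegree p = 1 := by
  have hnum : F.num = C (F.num.coeff 1) * X + C (F.num.coeff 0) :=
    eq_X_add_C_of_natDegree_le_one (hF ▸ le_max_left _ _ : F.num.natDegree ≤ 1)
  have hden : F.den = C (F.den.coeff 1) * X + C (F.den.coeff 0) :=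
    eq_X_add_C_of_natDegree_le_one (hF ▸ le_max_right _ _ : F.den.natDegree ≤ 1)
  have hlead := F.not_coeff_eq_zero (by rw [hF]; norm_num)
  have hinf := F.exists_fibrePoly_infty
  have happinf : F.apply OnePoint.infty = if F.den.coeff F.degree = 0 then OnePoint.infty
      else OnePoint.some (F.num.coeff F.degree / F.den.coeff F.degree) := rfl
  rw [hF] at hlead hinf happinf
  have heval := F.not_eval_eq_zero
  obtain ⟨a₁, ha1⟩ : ∃ a, a = F.num.coeff 1 := ⟨_, rfl⟩
  obtain ⟨a₀, ha0⟩ : ∃ a, a = F.num.coeff 0 := ⟨_, rfl⟩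
  obtain ⟨b₁, hb1⟩ : ∃ a, a = F.den.coeff 1 := ⟨_, rfl⟩
  obtain ⟨b₀, hb0⟩ : ∃ a, a = F.den.coeff 0 := ⟨_, rfl⟩
  rw [← ha1, ← ha0] at hnum
  rw [← hb1, ← hb0] at hden
  rw [← ha1, ← hb1] at hlead hinf happinf
  have evn : ∀ t, F.num.eval t = a₁ * t + a₀ := by intro t; rw [hnum]; simp
  have evd : ∀ t, F.den.eval t = b₁ * t + b₀ := by intro t; rw [hden]; simp
  have hdet : a₁ * b₀ - a₀ * b₁ ≠ 0 := by
    intro hz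
    by_cases h : b₁ = 0
    · have h1 : a₁ ≠ 0 := fun h' => hlead ⟨h', h⟩
      apply heval (-a₀ / a₁)
      rw [evn, evd]
      refine ⟨by field_simp; ring, ?_⟩
      field_simp
      linear_combination hz
    · apply heval (-b₀ / b₁)
      rw [evn, evd]
      refine ⟨?_, by field_simp; ring⟩
      field_simp
      linear_combination -hz
  have hcomb : ∀ e₁ e₂ : ℂ, C e₁ * F.num + C e₂ * F.den =
      C (e₁ * a₁ + e₂ * b₁) * X + C (e₁ * a₀ + e₂ * b₀) := by
    intro e₁ e₂
    rw [hnum, hden]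
    simp only [map_add, map_mul]
    ring
  have hcne : ∀ e₁ e₂ : ℂ, (e₁ ≠ 0 ∨ e₂ ≠ 0) →
      ¬ (e₁ * a₁ + e₂ * b₁ = 0 ∧ e₁ * a₀ + e₂ * b₀ = 0) := by
    rintro e₁ e₂ he ⟨r1, r2⟩
    rcases he with he | he
    · apply he
      apply (mul_eq_zero.1 (?_ : (a₁ * b₀ - a₀ * b₁) * e₁ = 0)).resolve_left hdet
      linear_combination b₀ * r1 - b₁ * r2
    · apply he
      apply (mul_eq_zero.1 (?_ : (a₁ * b₀ - a₀ * b₁) * e₂ = 0)).resolve_left hdet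
      linear_combination a₁ * r2 - a₀ * r1
  constructor
  · refine ⟨mob a₁ a₀ b₁ b₀ hdet, fun p => ?_⟩
    cases p using OnePoint.rec with
    | infty =>
      have := isHomCoord_infty.mob hdet
      simp only [mul_one, mul_zero, add_zero] at this
      rw [happinf]
      split_ifs with h
      · rw [isHomCoord_infty.eq_iff this]
        simp [h]
      · rw [(isHomCoord_some _).eq_iff this]
        field_simp
    | coe r =>
      have := (isHomCoord_some r).mob hdet
      simp only [mul_one] at this
      change (if F.den.eval r = 0 then OnePoint.infty
        else OnePoint.some (F.num.eval r / F.den.eval r)) = _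
      split_ifs with h
      · rw [isHomCoord_infty.eq_iff this]
        rw [evd] at h
        simp [h]
      · rw [(isHomCoord_some _).eq_iff this, ← evn, ← evd]
        field_simp
  · intro p
    cases p using OnePoint.rec with
    | infty =>
      obtain ⟨e₁, e₂, he, hpoly, hz⟩ := hinf
      have hl : F.localDegree OnePoint.infty =
          F.degree - (F.fibrePoly (F.apply OnePoint.infty)).natDegree := rfl
      rw [hl, hF, hpoly, hcomb, hz, map_zero, zero_mul, zero_add, natDegree_C]
    | coe r =>
      obtain ⟨e₁, e₂, he, hpoly, hz⟩ := F.exists_fibrePoly_some r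
      have hl : F.localDegree (OnePoint.some r) =
          (F.fibrePoly (F.apply (OnePoint.some r))).rootMultiplicity r := rfl
      rw [hl, hpoly, hcomb]
      rw [evn, evd] at hz
      have h0 : e₁ * a₀ + e₂ * b₀ = - ((e₁ * a₁ + e₂ * b₁) * r) := by linear_combination hz
      have h1 : e₁ * a₁ + e₂ * b₁ ≠ 0 := by
        intro h'
        refine hcne e₁ e₂ he ⟨h', ?_⟩
        rw [h0, h', zero_mul, neg_zero]
      have : C (e₁ * a₁ + e₂ * b₁) * X + C (e₁ * a₀ + e₂ * b₀) =
          C (e₁ * a₁ + e₂ * b₁) * (X - C r) ^ 1 := by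
        rw [h0, map_neg, map_mul]; ring
      rw [this, rootMultiplicity_mul (mul_ne_zero (C_ne_zero.2 h1)
          (pow_ne_zero _ (X_sub_C_ne_zero _))), rootMultiplicity_C, rootMultiplicity_X_sub_C_pow]

end RatMap

/-! ### Projections to the components of a rational curve -/

namespace Tree

variable {V : Type*} {G : SimpleGraph V}

theorem exists_step (hG : G.IsTree) {v u : V} (h : u ≠ v) :
    ∃ w, G.Adj v w ∧ G.dist w u + 1 = G.dist v u := by
  obtain ⟨p, hp⟩ := hG.connected.exists_walk_length_eq_dist v u
  cases p with
  | nil => exact absurd rfl h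
  | cons hadj q =>
    rename_i w
    refine ⟨w, hadj, ?_⟩
    rw [SimpleGraph.Walk.length_cons] at hp
    have h1 := SimpleGraph.dist_le q
    have h2 := hG.connected.dist_triangle (u := v) (v := w) (w := u)
    rw [SimpleGraph.dist_eq_one_iff_adj.2 hadj] at h2
    omega

theorem step_unique (hG : G.IsTree) {v u w w' : V} (h : G.Adj v w)
    (hd : G.dist w u + 1 = G.dist v u) (h' : G.Adj v w') (hd' : G.dist w' u + 1 = G.dist v u) :
    w = w' := by
  obtain ⟨p, hp⟩ := hG.connected.exists_walk_length_eq_dist w u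
  obtain ⟨p', hp'⟩ := hG.connected.exists_walk_length_eq_dist w' u
  have c1 : (SimpleGraph.Walk.cons h p).IsPath :=
    SimpleGraph.Walk.isPath_of_length_eq_dist _ (by simp [hp, hd])
  have c2 : (SimpleGraph.Walk.cons h' p').IsPath :=
    SimpleGraph.Walk.isPath_of_length_eq_dist _ (by simp [hp', hd'])
  have := (hG.existsUnique_path v u).unique c1 c2
  simpa using congrArg SimpleGraph.Walk.snd this

open Classical in
/-- The neighbour of `v` in the direction of `u`. -/
def step (hG : G.IsTree) (v u : V) : V :=
  if h : u ≠ v then (exists_step hG h).choose else v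

theorem step_adj (hG : G.IsTree) {v u : V} (h : u ≠ v) : G.Adj v (step hG v u) := by
  rw [step, dif_pos h]
  exact (exists_step hG h).choose_spec.1

theorem step_dist (hG : G.IsTree) {v u : V} (h : u ≠ v) :
    G.dist (step hG v u) u + 1 = G.dist v u := by
  rw [step, dif_pos h]
  exact (exists_step hG h).choose_spec.2

theorem eq_step (hG : G.IsTree) {v u w : V} (h : G.Adj v w)
    (hd : G.dist w u + 1 = G.dist v u) : w = step hG v u := by
  have hne : u ≠ v := by
    rintro rfl
    simp at hd
  exact step_unique hG h hd (step_adj hG hne) (step_dist hG hne)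

theorem step_of_adj (hG : G.IsTree) {v u : V} (h : G.Adj v u) : step hG v u = u :=
  (eq_step hG h (by simp [SimpleGraph.dist_eq_one_iff_adj.2 h])).symm

/-- In a tree the distances from `v` to two adjacent vertices differ by exactly one, so a shortest
path to the nearer vertex extends to the farther one with the same first step. -/
theorem step_eq_step_of_adj (hG : G.IsTree) {v u u' : V} (h : u ≠ v) (h' : u' ≠ v)
    (hadj : G.Adj u u') : step hG v u = step hG v u' := by
  have key : ∀ {u u' : V}, u ≠ v → u' ≠ v → G.Adj u u' → G.dist v u' = G.dist v u + 1 →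
      step hG v u = step hG v u' := by
    intro u u' h h' hadj hd
    refine eq_step hG (step_adj hG h) ?_
    have h1 := step_dist hG h
    have h2 := hG.connected.dist_triangle (u := step hG v u) (v := u) (w := u')
    have h3 := hG.connected.dist_triangle (u := v) (v := step hG v u) (w := u')
    rw [SimpleGraph.dist_eq_one_iff_adj.2 hadj] at h2
    rw [SimpleGraph.dist_eq_one_iff_adj.2 (step_adj hG h)] at h3
    omega
  rcases hG.dist_eq_dist_add_one_of_adj v hadj with hd | hd
  · exact (key h' h hadj.symm hd).symm
  · exact key h h' hadj hd

/-- Induction on a tree, starting at a root. -/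
theorem induction (hG : G.IsTree) (v : V) {P : V → Prop} (h0 : P v)
    (h1 : ∀ u, u ≠ v → P (step hG u v) → P u) (u : V) : P u := by
  obtain ⟨n, hn⟩ : ∃ n, G.dist u v = n := ⟨_, rfl⟩
  induction n generalizing u with
  | zero =>
    rw [hG.connected.dist_eq_zero_iff] at hn
    exact hn ▸ h0
  | succ n ih =>
    have hne : u ≠ v := by
      rintro rfl
      simp at hn
    refine h1 u hne (ih _ ?_)
    have := step_dist hG hne.symm
    omega

/-- No vertex lies behind `v` and behind `v'` at once. The property is transported along edges from
the root `v` by `step_eq_step_of_adj`. -/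
theorem step_eq_or_step_eq (hG : G.IsTree) {v v' : V} (hv : v ≠ v') (u : V) :
    (u ≠ v ∧ step hG v u = step hG v v') ∨ (u ≠ v' ∧ step hG v' u = step hG v' v) := by
  refine induction hG v (P := fun u => (u ≠ v ∧ step hG v u = step hG v v') ∨
    (u ≠ v' ∧ step hG v' u = step hG v' v)) (Or.inr ⟨hv, rfl⟩) ?_ u
  intro u hu ih
  by_cases huv : u = v'
  · subst huv
    exact Or.inl ⟨hu, rfl⟩
  have hadj := step_adj hG hu.symm
  rcases ih with ⟨h1, h2⟩ | ⟨h1, h2⟩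
  · exact Or.inl ⟨hu, (step_eq_step_of_adj hG hu h1 hadj).trans h2⟩
  · exact Or.inr ⟨huv, (step_eq_step_of_adj hG huv h1 hadj).trans h2⟩

end Tree

namespace RationalCurve

variable (C : RationalCurve)

open Classical in
/-- The point of the component `v` in the direction of `p`. -/
def proj (v : Fin C.n) (p : C.Pt) : P1 :=
  if p.1 = v then p.2 else C.node v (Tree.step C.isTree v p.1)

@[simp] theorem proj_self (v : Fin C.n) (t : P1) : C.proj v (v, t) = t := by simp [proj]

theorem proj_of_eq {v : Fin C.n} {p : C.Pt} (h : p.1 = v) : C.proj v p = p.2 := by simp [proj, h]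

theorem proj_of_ne {v : Fin C.n} {p : C.Pt} (h : p.1 ≠ v) :
    C.proj v p = C.node v (Tree.step C.isTree v p.1) := by simp [proj, h]

theorem isProj_iff {v : Fin C.n} {p : C.Pt} {t : P1} : C.IsProj v p t ↔ t = C.proj v p := by
  unfold IsProj
  by_cases h : p.1 = v
  · simp [h, proj]
  · rw [C.proj_of_ne h]
    simp only [h, false_and, ne_eq, not_false_eq_true, true_and, false_or]
    constructor
    · rintro ⟨w, h1, h2, rfl⟩
      rw [Tree.eq_step C.isTree h1 h2]
    · rintro rfl
      exact ⟨_, Tree.step_adj _ h, Tree.step_dist _ h, rfl⟩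

theorem proj_const {v u : Fin C.n} (h : u ≠ v) (s t : P1) : C.proj v (u, s) = C.proj v (u, t) := by
  rw [C.proj_of_ne (p := (u, s)) h, C.proj_of_ne (p := (u, t)) h]

theorem isNode_proj {v : Fin C.n} {p : C.Pt} (h : p.1 ≠ v) : C.IsNode (v, C.proj v p) :=
  ⟨_, Tree.step_adj C.isTree h, C.proj_of_ne h⟩

theorem proj_of_adj {v : Fin C.n} {p : C.Pt} (h : C.graph.Adj v p.1) :
    C.proj v p = C.node v p.1 := by
  rw [C.proj_of_ne h.ne', Tree.step_of_adj C.isTree h]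

/-- The projection descends to the glued curve. Since it is constant on all components other than
`v`, `eq_of_eq_on_component` reduces later identities between projections to the component `v`. -/
theorem proj_glued (v : Fin C.n) {p q : C.Pt} (h : C.Glued p q) : C.proj v p = C.proj v q := by
  rcases h with rfl | ⟨hadj, hp, hq⟩
  · rfl
  by_cases h1 : p.1 = v
  · have h2 : C.graph.Adj v q.1 := h1 ▸ hadj
    rw [C.proj_of_eq h1, C.proj_of_adj h2, hp, h1]
  · by_cases h2 : q.1 = v
    · have h3 : C.graph.Adj v p.1 := h2 ▸ hadj.symm
      rw [C.proj_of_eq h2, C.proj_of_adj h3, hq, h2]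
    · rw [C.proj_of_ne h1, C.proj_of_ne h2, Tree.step_eq_step_of_adj C.isTree h1 h2 hadj]

theorem glued_node {v w : Fin C.n} (h : C.graph.Adj v w) :
    C.Glued (v, C.node v w) (w, C.node w v) := Or.inr ⟨h, rfl, rfl⟩

/-- A function on a rational curve which is constant on all components but one is determined by its
values on that component. -/
theorem eq_of_eq_on_component {α : Type*} (v : Fin C.n) {f g : C.Pt → α}
    (hf : ∀ p q, C.Glued p q → f p = f q) (hg : ∀ p q, C.Glued p q → g p = g q)
    (hf' : ∀ u, u ≠ v → ∀ s t, f (u, s) = f (u, t))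
    (hg' : ∀ u, u ≠ v → ∀ s t, g (u, s) = g (u, t))
    (h : ∀ t, f (v, t) = g (v, t)) (p : C.Pt) : f p = g p := by
  obtain ⟨u, t⟩ := p
  revert t
  refine Tree.induction C.isTree v (P := fun u => ∀ t, f (u, t) = g (u, t)) h ?_ u
  intro u hu ih t
  have hadj := Tree.step_adj C.isTree hu.symm
  rw [hf' u hu t (C.node u (Tree.step C.isTree u v)), hg' u hu t
    (C.node u (Tree.step C.isTree u v)), hf _ _ (C.glued_node hadj), hg _ _ (C.glued_node hadj)]
  exact ih _

theorem proj_eq_or_proj_eq {v v' : Fin C.n} (hv : v ≠ v') (s t : P1) (p : C.Pt) :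
    C.proj v p = C.proj v (v', s) ∨ C.proj v' p = C.proj v' (v, t) := by
  rw [C.proj_of_ne (p := (v', s)) hv.symm, C.proj_of_ne (p := (v, t)) hv]
  rcases Tree.step_eq_or_step_eq C.isTree hv p.1 with ⟨h1, h2⟩ | ⟨h1, h2⟩
  · exact Or.inl (by rw [C.proj_of_ne h1, h2])
  · exact Or.inr (by rw [C.proj_of_ne h1, h2])

variable {C} in
theorem Iso.glued {D : RationalCurve} (e : Iso C D) {p q : C.Pt} (h : C.Glued p q) :
    D.Glued (e.apply p) (e.apply q) := by
  rcases h with rfl | ⟨hadj, hp, hq⟩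
  · exact Or.inl rfl
  · refine Or.inr ⟨(e.adj_iff _ _).2 hadj, ?_, ?_⟩
    · exact (congrArg (e.mob p.1 • ·) hp).trans (e.node_eq _ _ hadj).symm
    · exact (congrArg (e.mob q.1 • ·) hq).trans (e.node_eq _ _ hadj.symm).symm

variable {C} in
theorem Iso.proj {D : RationalCurve} (e : Iso C D) (v : Fin C.n) (p : C.Pt) :
    D.proj (e.comp v) (e.apply p) = e.mob v • C.proj v p := by
  refine C.eq_of_eq_on_component v (f := fun p => D.proj (e.comp v) (e.apply p))
    (g := fun p => e.mob v • C.proj v p) (fun p q h => D.proj_glued _ (e.glued h))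
    (fun p q h => by rw [C.proj_glued v h]) ?_ ?_ ?_ p
  · intro u hu s t
    exact D.proj_const (fun h => hu (e.comp.injective h)) _ _
  · intro u hu s t
    simp only [C.proj_const hu s t]
  · intro t
    simp [Iso.apply]

theorem isCrossRatio_iff {q : Fin 4 → C.Pt} {t : P1} : C.IsCrossRatio q t ↔
    ∃ (v : Fin C.n) (g : Mob), g • C.proj v (q 0) = OnePoint.some 0 ∧
      g • C.proj v (q 1) = OnePoint.some 1 ∧ g • C.proj v (q 2) = OnePoint.infty ∧
      g • C.proj v (q 3) = t := by
  constructor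
  · rintro ⟨v, π, g, hπ, h⟩
    obtain rfl : π = fun k => C.proj v (q k) := funext fun k => C.isProj_iff.1 (hπ k)
    exact ⟨v, g, h⟩
  · rintro ⟨v, g, h⟩
    exact ⟨v, fun k => C.proj v (q k), g, fun k => C.isProj_iff.2 rfl, h⟩

/-- Three points have distinct projections on at most one component. -/
theorem component_unique {v v' : Fin C.n} {q₀ q₁ q₂ : C.Pt}
    (h01 : C.proj v q₀ ≠ C.proj v q₁) (h02 : C.proj v q₀ ≠ C.proj v q₂)
    (h12 : C.proj v q₁ ≠ C.proj v q₂)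
    (h01' : C.proj v' q₀ ≠ C.proj v' q₁) (h02' : C.proj v' q₀ ≠ C.proj v' q₂)
    (h12' : C.proj v' q₁ ≠ C.proj v' q₂) : v = v' := by
  by_contra hv
  -- Each point goes to the node towards `v'` on `v`, or to the node towards `v` on `v'`. Of three
  -- points two fall under the same alternative and are not separated there.
  have h := C.proj_eq_or_proj_eq hv (OnePoint.some 0) (OnePoint.some 0)
  rcases h q₀ with h0 | h0 <;> rcases h q₁ with h1 | h1 <;> rcases h q₂ with h2 | h2 <;>
    simp_all

theorem ne_of_smul {g : Mob} {p q r s : P1} (h : g • p = r) (h' : g • q = s) (hrs : r ≠ s) :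
    p ≠ q := by
  rintro rfl
  exact hrs (h.symm.trans h')

variable {C} in
theorem IsCrossRatio.unique {q : Fin 4 → C.Pt} {t t' : P1} (h : C.IsCrossRatio q t)
    (h' : C.IsCrossRatio q t') : t = t' := by
  obtain ⟨v, g, h0, h1, h2, rfl⟩ := C.isCrossRatio_iff.1 h
  obtain ⟨v', g', h0', h1', h2', rfl⟩ := C.isCrossRatio_iff.1 h'
  have k01 := ne_of_smul h0 h1 (by simp)
  have k02 := ne_of_smul h0 h2 (by simp)
  have k12 := ne_of_smul h1 h2 (by simp)
  obtain rfl := C.component_unique k01 k02 k12 (ne_of_smul h0' h1' (by simp))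
    (ne_of_smul h0' h2' (by simp)) (ne_of_smul h1' h2' (by simp))
  exact smul_eq_smul_of_three k01 k02 k12 (h0.trans h0'.symm) (h1.trans h1'.symm)
    (h2.trans h2'.symm) _

variable {C} in
theorem IsCrossRatio.map {D : RationalCurve} (e : Iso C D) {q : Fin 4 → C.Pt} {t : P1}
    (h : C.IsCrossRatio q t) : D.IsCrossRatio (fun k => e.apply (q k)) t := by
  obtain ⟨v, g, h0, h1, h2, h3⟩ := C.isCrossRatio_iff.1 h
  refine D.isCrossRatio_iff.2 ⟨e.comp v, g * (e.mob v)⁻¹, ?_, ?_, ?_, ?_⟩ <;>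
    simpa only [e.proj, mul_smul, inv_smul_smul]

end RationalCurve

namespace MarkedCurve

variable {Λ : Type}

/-- Among the components behind the node, one at maximal distance from `v` has a single node, so
stability forces a mark on it. -/
theorem IsStable.exists_mark {C : MarkedCurve Λ} (hC : C.IsStable) {v w : Fin C.n}
    (h : C.graph.Adj v w) : ∃ l, C.proj v (C.mark l) = C.node v w := by
  classical
  have hne : (Finset.univ.filter fun u => u ≠ v ∧ Tree.step C.isTree v u = w).Nonempty :=
    ⟨w, by simp [h.ne', Tree.step_of_adj C.isTree h]⟩
  obtain ⟨u, hu, hmax⟩ := Finset.exists_max_image _ (fun u => C.graph.dist v u) hne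
  simp only [Finset.mem_filter, Finset.mem_univ, true_and] at hu hmax
  obtain ⟨huv, huw⟩ := hu
  have hnode : ∀ x, C.graph.Adj u x → x = Tree.step C.isTree u v := by
    intro x hx
    by_cases hxv : x = v
    · rw [hxv] at hx ⊢
      exact (Tree.step_of_adj C.isTree hx).symm
    rcases C.isTree.dist_eq_dist_add_one_of_adj v hx with hd | hd
    · refine Tree.eq_step C.isTree hx ?_
      rw [SimpleGraph.dist_comm (u := x), SimpleGraph.dist_comm (u := u)]
      exact hd.symm
    · have := hmax x ⟨hxv, (Tree.step_eq_step_of_adj C.isTree huv hxv hx).symm.trans huw⟩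
      omega
  by_contra hcon
  push Not at hcon
  have hsub : {t : P1 | C.IsNode (u, t) ∨ ∃ l, C.mark l = (u, t)} ⊆
      {C.node u (Tree.step C.isTree u v)} := by
    rintro t (⟨x, hx, ht⟩ | ⟨l, hl⟩)
    · rw [hnode x hx] at ht
      exact ht
    · refine absurd ?_ (hcon l)
      have h1 : (C.mark l).1 = u := by rw [hl]
      rw [C.proj_of_ne (by rw [h1]; exact huv), h1, huw]
  have := (hC u).trans (Set.encard_le_encard hsub)
  rw [Set.encard_singleton] at this
  norm_num at this

/-- On every component of a stable curve there are marked points with three distinct projections. -/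
theorem IsStable.three_le_encard_proj {C : MarkedCurve Λ} (hC : C.IsStable) (v : Fin C.n) :
    3 ≤ (Set.range fun l => C.proj v (C.mark l)).encard := by
  refine (hC v).trans (Set.encard_le_encard ?_)
  rintro t (⟨w, hw, ht⟩ | ⟨l, hl⟩)
  · obtain ⟨l, hl⟩ := hC.exists_mark hw
    exact ⟨l, hl.trans ht.symm⟩
  · exact ⟨l, by simp [hl]⟩

/-- The component of `C` mapped isomorphically onto `v'` sees the marks as `v'` does: both
projections are constant on all other components and agree on this one. Only this consequence of a
stabilization is used for finiteness. -/
theorem IsStabilization.exists_proj {C D : MarkedCurve Λ} (h : C.IsStabilization D)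
    (v' : Fin D.n) : ∃ (v : Fin C.n) (g : Mob),
      ∀ l, D.proj v' (D.mark l) = g • C.proj v (C.mark l) := by
  obtain ⟨-, κ, hglue, hmark, hcomp, huniq⟩ := h
  obtain ⟨v, ⟨g, hg⟩, hv⟩ := huniq v'
  refine ⟨v, g, fun l => ?_⟩
  rw [← hmark]
  refine C.eq_of_eq_on_component v (f := fun p => D.proj v' (κ p)) (g := fun p => g • C.proj v p)
    (fun p q h => D.proj_glued _ (hglue p q h)) (fun p q h => by rw [C.proj_glued v h]) ?_ ?_ ?_ _
  · intro u hu s t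
    rcases hcomp u with ⟨q, hq⟩ | ⟨u', g', hg'⟩
    · simp only [hq]
    · have : u' ≠ v' := by
        rintro rfl
        exact hu (hv u ⟨g', hg'⟩)
      simp only [hg']
      exact D.proj_const this _ _
  · intro u hu s t
    simp only [C.proj_const hu s t]
  · intro t
    simp [hg]

end MarkedCurve

/-! ### Double covers of the projective line -/

/-- The map `F` is the squaring map in the coordinates `H` of the source and `G⁻¹` of the target. -/
structure SqForm (F : RatMap) (G H : Mob) : Prop where
  apply_eq : ∀ p, F.apply p = G • sq (H • p)
  localDegree_two : ∀ p, H • p = OnePoint.some 0 ∨ H • p = OnePoint.infty → F.localDegree p = 2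
  localDegree_one : ∀ p, ¬ (H • p = OnePoint.some 0 ∨ H • p = OnePoint.infty) →
    F.localDegree p = 1

namespace SqForm

variable {F : RatMap} {G H : Mob}

theorem localDegree_eq_two_iff (h : SqForm F G H) {p : P1} :
    F.localDegree p = 2 ↔ H • p = OnePoint.some 0 ∨ H • p = OnePoint.infty := by
  refine ⟨fun hp => ?_, h.localDegree_two p⟩
  by_contra hcon
  rw [h.localDegree_one p hcon] at hp
  norm_num at hp

theorem apply_eq_apply_iff (h : SqForm F G H) {p q : P1} : F.apply p = F.apply q ↔
    H • p = H • q ∨ H • p = scale (-1) (by norm_num) • H • q := by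
  rw [h.apply_eq, h.apply_eq, smul_left_cancel_iff, sq_eq_sq_iff]

theorem swap (h : SqForm F G H) : SqForm F (G * invMob) (invMob * H) := by
  have key : ∀ p : P1, (invMob * H) • p = OnePoint.some 0 ∨ (invMob * H) • p = OnePoint.infty ↔
      H • p = OnePoint.some 0 ∨ H • p = OnePoint.infty := by
    intro p
    rw [mul_smul, or_comm]
    have e0 : invMob • H • p = OnePoint.infty ↔ H • p = OnePoint.some 0 := by
      rw [← invMob_zero, smul_left_cancel_iff]
    have e1 : invMob • H • p = OnePoint.some 0 ↔ H • p = OnePoint.infty := by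
      rw [← invMob_infty, smul_left_cancel_iff]
    rw [e0, e1]
  refine ⟨fun p => ?_, fun p hp => h.localDegree_two p ((key p).1 hp), fun p hp =>
    h.localDegree_one p (fun h' => hp ((key p).2 h'))⟩
  rw [h.apply_eq, mul_smul, mul_smul, sq_invMob, invMob_invMob]

/-- The normal form leaves the freedom of scaling by c above and by c² below. It is used to remove a
common factor of p, q, r or to place a third point at 1. -/
theorem rescale (h : SqForm F G H) (c : ℂ) (hc : c ≠ 0) :
    SqForm F (G * (scale (c ^ 2) (pow_ne_zero 2 hc))⁻¹) (scale c hc * H) := by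
  have key : ∀ p : P1, (scale c hc * H) • p = OnePoint.some 0 ∨ (scale c hc * H) • p = OnePoint.infty ↔
      H • p = OnePoint.some 0 ∨ H • p = OnePoint.infty := by
    intro p
    rw [mul_smul]
    cases H • p using OnePoint.rec <;> simp [hc]
  refine ⟨fun p => ?_, fun p hp => h.localDegree_two p ((key p).1 hp), fun p hp =>
    h.localDegree_one p (fun h' => hp ((key p).2 h'))⟩
  rw [h.apply_eq, mul_smul, mul_smul, sq_scale, inv_smul_smul]

end SqForm

namespace RatMap

theorem exists_sqForm {F : RatMap} (hF : F.degree = 2) : ∃ G H, SqForm F G H := by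
  obtain ⟨G, H, h1, h2, h3⟩ := F.exists_eq_sq hF
  exact ⟨G, H, h1, h2, h3⟩

/-- A critical point can be placed at `∞`. -/
theorem exists_sqForm_infty {F : RatMap} (hF : F.degree = 2) {p : P1} (hp : F.localDegree p = 2) :
    ∃ G H, SqForm F G H ∧ H • p = OnePoint.infty := by
  obtain ⟨G, H, h⟩ := exists_sqForm hF
  rcases h.localDegree_eq_two_iff.1 hp with h0 | h0
  · exact ⟨_, _, h.swap, by rw [mul_smul, h0, invMob_zero]⟩
  · exact ⟨G, H, h, h0⟩

/-- Two critical points can be placed at `∞` and `0`. -/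
theorem exists_sqForm_infty_zero {F : RatMap} (hF : F.degree = 2) {p q : P1}
    (hp : F.localDegree p = 2) (hq : F.localDegree q = 2) (hpq : p ≠ q) :
    ∃ G H, SqForm F G H ∧ H • p = OnePoint.infty ∧ H • q = OnePoint.some 0 := by
  obtain ⟨G, H, h, h0⟩ := exists_sqForm_infty hF hp
  refine ⟨G, H, h, h0, (h.localDegree_eq_two_iff.1 hq).resolve_right fun h1 => ?_⟩
  exact hpq (smul_left_cancel H (h0.trans h1.symm))

theorem exists_crit {F : RatMap} (hF : F.degree = 2) :
    ∃ c₁ c₂ : P1, c₁ ≠ c₂ ∧ F.localDegree c₁ = 2 ∧ F.localDegree c₂ = 2 ∧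
      F.apply c₁ ≠ F.apply c₂ ∧ ∀ c, F.localDegree c = 2 → c = c₁ ∨ c = c₂ := by
  obtain ⟨G, H, h⟩ := exists_sqForm hF
  refine ⟨H⁻¹ • OnePoint.some 0, H⁻¹ • OnePoint.infty, ?_, ?_, ?_, ?_, ?_⟩
  · simp
  · exact h.localDegree_two _ (by simp)
  · exact h.localDegree_two _ (by simp)
  · rw [h.apply_eq, h.apply_eq]
    simp
  · intro c hc
    rw [eq_inv_smul_iff, eq_inv_smul_iff]
    exact h.localDegree_eq_two_iff.1 hc

/-- The fibre of a critical value is a single point. -/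
theorem eq_of_apply_eq_crit {F : RatMap} (hF : F.degree = 2) {p q : P1}
    (hp : F.localDegree p = 2) (h : F.apply q = F.apply p) : q = p := by
  obtain ⟨G, H, hf, h0⟩ := exists_sqForm_infty hF hp
  rw [hf.apply_eq_apply_iff, h0] at h
  apply smul_left_cancel H
  rw [h0]
  simpa using h

theorem fibre_le_two {F : RatMap} (hF : F.degree = 2) {p q r : P1}
    (h : F.apply p = F.apply q) (h' : F.apply p = F.apply r) : p = q ∨ p = r ∨ q = r := by
  obtain ⟨G, H, hf⟩ := exists_sqForm hF
  rw [hf.apply_eq_apply_iff] at h h'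
  rcases h with h | h
  · exact Or.inl (smul_left_cancel H h)
  rcases h' with h' | h'
  · exact Or.inr (Or.inl (smul_left_cancel H h'))
  · exact Or.inr (Or.inr (smul_left_cancel H (smul_left_cancel _ (h.symm.trans h'))))

theorem exists_apply_eq {F : RatMap} (hF : F.degree = 2) (q : P1) : ∃ p, F.apply p = q := by
  obtain ⟨G, H, hf⟩ := exists_sqForm hF
  obtain ⟨r, hr⟩ := exists_sq_eq (G⁻¹ • q)
  exact ⟨H⁻¹ • r, by simp [hf.apply_eq, hr]⟩

/-- Lifting of Möbius transformations to double covers. -/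
theorem exists_lift {F F' : RatMap} (hF : F.degree = 2) (hF' : F'.degree = 2) {g : Mob}
    (hg : ∀ c, F.localDegree c = 2 → ∃ c', F'.localDegree c' = 2 ∧ F'.apply c' = g • F.apply c)
    {p p' : P1} (hp : F'.apply p' = g • F.apply p) :
    ∃ h : Mob, (∀ t, F'.apply (h • t) = g • F.apply t) ∧ h • p = p' := by
  obtain ⟨c₁, c₂, h12, hc1, hc2, hF12, -⟩ := exists_crit hF
  obtain ⟨c₁', hc1', e1⟩ := hg c₁ hc1
  obtain ⟨c₂', hc2', e2⟩ := hg c₂ hc2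
  have h12' : c₁' ≠ c₂' := by
    rintro rfl
    rw [e1, smul_left_cancel_iff] at e2
    exact hF12 e2
  obtain ⟨G, H, hf, k1, k2⟩ := exists_sqForm_infty_zero hF hc1 hc2 h12
  obtain ⟨G', H', hf', k1', k2'⟩ := exists_sqForm_infty_zero hF' hc1' hc2' h12'
  rw [hf.apply_eq, hf'.apply_eq, k1, k1', sq_infty] at e1
  rw [hf.apply_eq, hf'.apply_eq, k2, k2', sq_some, zero_pow two_ne_zero] at e2
  -- In the normal coordinates `g` fixes the critical values 0 and ∞, so it is a scaling by c; its
  -- lifts are the scalings by the two square roots of c.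
  obtain ⟨c, hc, hsc⟩ := exists_eq_scale (g := G'⁻¹ * g * G)
    (by rw [mul_smul, mul_smul, ← e2, inv_smul_smul])
    (by rw [mul_smul, mul_smul, ← e1, inv_smul_smul])
  obtain ⟨m, hm⟩ := IsAlgClosed.exists_pow_nat_eq c (n := 2) (by norm_num)
  have hm0 : m ≠ 0 := by
    rintro rfl
    exact hc (by simpa using hm.symm)
  have lift : ∀ (m : ℂ) (hm0 : m ≠ 0), m ^ 2 = c → ∀ t,
      F'.apply ((H'⁻¹ * scale m hm0 * H) • t) = g • F.apply t := by
    intro m hm0 hm t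
    have : G' • (G'⁻¹ * g * G) • sq (H • t) = g • G • sq (H • t) := by simp [mul_smul]
    rw [hf.apply_eq, hf'.apply_eq, mul_smul, mul_smul, smul_inv_smul, sq_scale, ← this, hsc]
    congr 2
    simp only [hm]
  have h1 := lift m hm0 hm p
  rw [← hp, hf'.apply_eq_apply_iff] at h1
  -- The two lifts send `p` to the two points of one fibre; the sign of the root is chosen so that
  -- the image is `p'`.
  rcases h1 with h1 | h1
  · exact ⟨_, lift m hm0 hm, smul_left_cancel H' h1⟩
  · refine ⟨_, lift (-m) (neg_ne_zero.2 hm0) (by rw [neg_sq, hm]), smul_left_cancel H' ?_⟩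
    rw [mul_smul, mul_smul, smul_inv_smul] at h1 ⊢
    have e : scale (-m) (neg_ne_zero.2 hm0) • H • p =
        scale (-1) (by norm_num) • scale m hm0 • H • p := by
      cases H • p using OnePoint.rec <;> simp
    rw [e, h1]
    cases H' • p' using OnePoint.rec <;> simp

end RatMap

/-! ### Components of a diagram -/

namespace Diagram

variable (D : Diagram)

/-- The degree of the cover on a component. -/
def deg (w : Fin D.U.n) : ℕ := (D.F.map w).degree

theorem one_le_deg (w : Fin D.U.n) : 1 ≤ D.deg w := D.preAdmissible.nonconst w

/-- Over every component there is either one component of degree two or there are two components of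
degree one. -/
theorem fibre_cases (u : Fin D.L.n) :
    (∃ w, D.deg w = 2 ∧ ∀ w', D.F.comp w' = u ↔ w' = w) ∨
    ∃ w₁ w₂, w₁ ≠ w₂ ∧ D.deg w₁ = 1 ∧ D.deg w₂ = 1 ∧
      ∀ w', D.F.comp w' = u ↔ w' = w₁ ∨ w' = w₂ := by
  have hsum := D.preAdmissible.degree_eq u
  obtain ⟨s, hs⟩ : ∃ s, s = Finset.univ.filter (fun v => D.F.comp v = u) := ⟨_, rfl⟩
  have hmem : ∀ w', D.F.comp w' = u ↔ w' ∈ s := by simp [hs]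
  rw [← hs] at hsum
  have hcard : s.card ≤ 2 := by
    rw [← hsum]
    simpa using Finset.card_nsmul_le_sum s (fun v => (D.F.map v).degree) 1
      (fun w _ => D.one_le_deg w)
  simp only [hmem]
  interval_cases h : s.card
  · rw [Finset.card_eq_zero] at h
    simp [h] at hsum
  · obtain ⟨w, rfl⟩ := Finset.card_eq_one.1 h
    refine Or.inl ⟨w, by simpa [deg] using hsum, by simp⟩
  · obtain ⟨w₁, w₂, h12, rfl⟩ := Finset.card_eq_two.1 h
    rw [Finset.sum_pair h12] at hsum
    have h1 : 1 ≤ (D.F.map w₁).degree := D.one_le_deg w₁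
    have h2 : 1 ≤ (D.F.map w₂).degree := D.one_le_deg w₂
    refine Or.inr ⟨w₁, w₂, h12, ?_, ?_, by simp⟩ <;> unfold deg <;> omega

theorem deg_eq_one_or_two (w : Fin D.U.n) : D.deg w = 1 ∨ D.deg w = 2 := by
  rcases D.fibre_cases (D.F.comp w) with ⟨w', h1, h2⟩ | ⟨w₁, w₂, -, h1, h2, h3⟩
  · exact Or.inr ((h2 w).1 rfl ▸ h1)
  · rcases (h3 w).1 rfl with rfl | rfl
    · exact Or.inl h1
    · exact Or.inl h2

variable {D}

theorem eq_of_comp_eq {w w' : Fin D.U.n} (h : D.deg w = 2) (hw : D.F.comp w' = D.F.comp w) :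
    w' = w := by
  rcases D.fibre_cases (D.F.comp w) with ⟨w₀, -, h2⟩ | ⟨w₁, w₂, -, h1, h2, h3⟩
  · rw [(h2 w').1 hw, (h2 w).1 rfl]
  · rcases (h3 w).1 rfl with rfl | rfl <;> omega

variable (D) in
theorem exists_comp (u : Fin D.L.n) : ∃ w, D.F.comp w = u := by
  rcases D.fibre_cases u with ⟨w, _, h⟩ | ⟨w, _, _, _, _, h⟩
  · exact ⟨w, (h w).2 rfl⟩
  · exact ⟨w, (h w).2 (Or.inl rfl)⟩

theorem deg_eq_two_of_localDegree {p : D.U.Pt} (h : D.F.localDegree p = 2) : D.deg p.1 = 2 := by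
  have h1 := (D.F.map p.1).localDegree_le_degree p.2
  have h2 : (D.F.map p.1).localDegree p.2 = 2 := h
  rcases D.deg_eq_one_or_two p.1 with h3 | h3
  · unfold deg at h3
    omega
  · exact h3

theorem glued_apply {p q : D.U.Pt} (h : D.U.Glued p q) : D.L.Glued (D.F.apply p) (D.F.apply q) := by
  rcases h with rfl | ⟨hadj, hp, hq⟩
  · exact Or.inl rfl
  · refine Or.inr ⟨D.preAdmissible.adj _ _ hadj, ?_, ?_⟩
    · exact (congrArg _ hp).trans (D.preAdmissible.node _ _ hadj)
    · exact (congrArg _ hq).trans (D.preAdmissible.node _ _ hadj.symm)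

/-- A component of degree two maps the projection of a point to the projection of its image. -/
theorem apply_proj {w : Fin D.U.n} (h : D.deg w = 2) (p : D.U.Pt) :
    (D.F.map w).apply (D.U.proj w p) = D.L.proj (D.F.comp w) (D.F.apply p) := by
  refine D.U.eq_of_eq_on_component w (f := fun p => (D.F.map w).apply (D.U.proj w p))
    (g := fun p => D.L.proj (D.F.comp w) (D.F.apply p)) (fun p q h => by rw [D.U.proj_glued w h])
    (fun p q h => D.L.proj_glued _ (glued_apply h)) ?_ ?_ ?_ p
  · intro u hu s t
    simp only [D.U.proj_const hu s t]
  · intro u hu s t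
    exact D.L.proj_const (fun h' => hu (eq_of_comp_eq h h')) _ _
  · intro t
    simp [CurveMap.apply]

theorem isNode_iff {p : D.U.Pt} : D.U.IsNode p ↔ D.L.IsNode (D.F.apply p) := by
  refine ⟨?_, D.preAdmissible.isNode_of_isNode p⟩
  rintro ⟨w, hadj, hp⟩
  exact ⟨D.F.comp w, D.preAdmissible.adj _ _ hadj,
    (congrArg _ hp).trans (D.preAdmissible.node _ _ hadj)⟩

theorem comp_mark (a : A) : D.F.comp (D.U.mark a).1 = (D.L.mark (dyn a)).1 :=
  congrArg Prod.fst (D.comm a)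

theorem apply_mark (a : A) :
    (D.F.map (D.U.mark a).1).apply (D.U.mark a).2 = (D.L.mark (dyn a)).2 :=
  congrArg Prod.snd (D.comm a)

theorem deg_mark_zero : D.deg (D.U.mark A.zero).1 = 2 := deg_eq_two_of_localDegree D.branch_inf

theorem crit_value {w : Fin D.U.n} {t : P1} (h : (D.F.map w).localDegree t = 2) :
    D.L.IsNode (D.F.comp w, (D.F.map w).apply t) ∨
    (D.F.comp w, (D.F.map w).apply t) = D.L.mark B.inf ∨
    (D.F.comp w, (D.F.map w).apply t) = D.L.mark B.z := by
  by_cases hn : D.U.IsNode (w, t)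
  · exact Or.inl (isNode_iff.1 hn)
  · exact Or.inr (D.branch (w, t) hn (le_of_eq h.symm))

variable (D) in
theorem exists_crit_z : ∃ (w : Fin D.U.n) (t : P1), D.deg w = 2 ∧ (D.F.map w).localDegree t = 2 ∧
    D.F.comp w = (D.L.mark B.z).1 ∧ (D.F.map w).apply t = (D.L.mark B.z).2 := by
  obtain ⟨p, h1, h2⟩ := D.branch_z
  exact ⟨p.1, p.2, deg_eq_two_of_localDegree h2, h2, congrArg Prod.fst h1, congrArg Prod.snd h1⟩

/-- A component with a critical point has degree two and is therefore the only one over its image;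
this applies over the components carrying ∞ or z. -/
theorem deg_eq_two_of_mem {w : Fin D.U.n} (h : D.F.comp w = (D.L.mark B.inf).1 ∨
    D.F.comp w = (D.L.mark B.z).1) : D.deg w = 2 := by
  rcases h with h | h
  · have : w = (D.U.mark A.zero).1 :=
      eq_of_comp_eq deg_mark_zero (h.trans (comp_mark A.zero).symm)
    exact this ▸ deg_mark_zero
  · obtain ⟨w', t, h1, -, h3, -⟩ := D.exists_crit_z
    have : w = w' := eq_of_comp_eq h1 (h.trans h3.symm)
    exact this ▸ h1

/-- A critical point over the point marked `∞` or `z`. -/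
theorem exists_crit_mark {w : Fin D.U.n} {b : B} (hb : b = B.inf ∨ b = B.z)
    (h : D.F.comp w = (D.L.mark b).1) :
    ∃ t, (D.F.map w).localDegree t = 2 ∧ (D.F.map w).apply t = (D.L.mark b).2 := by
  rcases hb with rfl | rfl
  · obtain rfl : w = (D.U.mark A.zero).1 :=
      eq_of_comp_eq deg_mark_zero (h.trans (comp_mark A.zero).symm)
    exact ⟨_, D.branch_inf, apply_mark A.zero⟩
  · obtain ⟨w', t, h1, h2, h3, h4⟩ := D.exists_crit_z
    obtain rfl : w = w' := eq_of_comp_eq h1 (h.trans h3.symm)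
    exact ⟨t, h2, h4⟩

theorem exists_apply_eq_smul {w : Fin D.U.n} (h : D.deg w = 1) :
    ∃ G : Mob, ∀ p, (D.F.map w).apply p = G • p := ((D.F.map w).exists_eq_mob h).1

/-- The fibres of the cover have at most two points. -/
theorem fibre_le_two {p q r : D.U.Pt} (h : D.F.apply p = D.F.apply q)
    (h' : D.F.apply p = D.F.apply r) : p = q ∨ p = r ∨ q = r := by
  obtain ⟨w, t⟩ := p
  obtain ⟨w₁, t₁⟩ := q
  obtain ⟨w₂, t₂⟩ := r
  simp only [CurveMap.apply, Prod.mk.injEq] at h h'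
  obtain ⟨h1, h2⟩ := h
  obtain ⟨h1', h2'⟩ := h'
  rcases D.deg_eq_one_or_two w with hd | hd
  · have inj : ∀ {w s s'}, D.deg w = 1 → (D.F.map w).apply s = (D.F.map w).apply s' → s = s' := by
      intro w s s' hw hs
      obtain ⟨G, hG⟩ := exists_apply_eq_smul hw
      rw [hG, hG] at hs
      exact smul_left_cancel G hs
    rcases D.fibre_cases (D.F.comp w) with ⟨w₀, k1, k2⟩ | ⟨u₁, u₂, -, k1, k2, k3⟩
    · rw [(k2 w).1 rfl] at hd
      omega
    have c0 := (k3 w).1 rfl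
    have c1 := (k3 w₁).1 h1.symm
    have c2 := (k3 w₂).1 h1'.symm
    have e1 : w = w₁ → (w, t) = (w₁, t₁) := by
      rintro rfl
      rw [inj hd h2]
    have e2 : w = w₂ → (w, t) = (w₂, t₂) := by
      rintro rfl
      rw [inj hd h2']
    have e3 : w₁ = w₂ → (w₁, t₁) = (w₂, t₂) := by
      rintro rfl
      have : D.deg w₁ = 1 := by rcases c1 with rfl | rfl <;> assumption
      rw [inj this (h2.symm.trans h2')]
    grind
  · obtain rfl := eq_of_comp_eq hd h1.symm
    obtain rfl := eq_of_comp_eq hd h1'.symm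
    rcases RatMap.fibre_le_two hd h2 h2' with rfl | rfl | rfl <;> simp

end Diagram

/-! ### The cross ratio coordinates -/

namespace RationalCurve.Iso

theorem apply_injective {C D : RationalCurve} (e : Iso C D) : Function.Injective e.apply :=
  fun p q h => by rw [← e.symm_apply_apply p, h, e.symm_apply_apply]

end RationalCurve.Iso

namespace Diagram

/-- Fibres have at most two points, so once the point marked by `A` is fixed there is only one
choice for the second preimage, and over z the fibre is a single critical point. Hence a diagram has
at most one coordinate vector. -/
theorem IsFibreLabelling.unique {D : Diagram} {q q' : Fib → D.U.Pt} (h : D.IsFibreLabelling q)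
    (h' : D.IsFibreLabelling q') : q = q' := by
  obtain ⟨hinj, hA, hF⟩ := h
  obtain ⟨hinj', hA', hF'⟩ := h'
  have hmain : ∀ a, q (fibOfA a) = q' (fibOfA a) := fun a => (hA a).trans (hA' a).symm
  have hsecond : ∀ (l : Fib) (a : A), fibOfA a ≠ l → fibMap l = fibMap (fibOfA a) →
      q l = q' l := by
    intro l a hne hl
    have e1 : D.F.apply (q l) = D.F.apply (q' l) := (hF l).trans (hF' l).symm
    have e2 : D.F.apply (q l) = D.F.apply (q (fibOfA a)) := by rw [hF, hF, hl]
    rcases fibre_le_two e1 e2 with h | h | h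
    · exact h
    · exact absurd (hinj h).symm hne
    · rw [hmain] at h
      exact absurd (hinj' h).symm hne
  funext l
  cases l with
  | zero => exact hmain A.zero
  | one => exact hmain A.one
  | inf => exact hmain A.inf
  | x => exact hmain A.x
  | one' => exact hsecond _ A.one (by simp [fibOfA]) rfl
  | inf' => exact hsecond _ A.inf (by simp [fibOfA]) rfl
  | x' => exact hsecond _ A.x (by simp [fibOfA]) rfl
  | crit =>
    obtain ⟨w, t, h1, h2, h3, h4⟩ := D.exists_crit_z
    have key : ∀ p : D.U.Pt, D.F.apply p = D.L.mark B.z → p = (w, t) := by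
      rintro ⟨w', t'⟩ hp
      have c1 : D.F.comp w' = (D.L.mark B.z).1 := congrArg Prod.fst hp
      have c2 : (D.F.map w').apply t' = (D.L.mark B.z).2 := congrArg Prod.snd hp
      obtain rfl := eq_of_comp_eq h1 (c1.trans h3.symm)
      rw [RatMap.eq_of_apply_eq_crit h1 h2 (c2.trans h4.symm)]
    exact (key _ (hF Fib.crit)).trans (key _ (hF' Fib.crit)).symm

theorem IsCoord.of_equivalent {D E : Diagram} (h : D.Equivalent E) {t : CoordIdx → P1}
    (hD : D.IsCoord t) : E.IsCoord t := by
  obtain ⟨u, l, hu, hl, hF⟩ := h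
  obtain ⟨q, ⟨hinj, hA, hq⟩, h1, h2⟩ := hD
  refine ⟨fun k => u.apply (q k), ⟨u.apply_injective.comp hinj, ?_, ?_⟩, ?_, ?_⟩
  · intro a
    simp only [hA, hu]
  · intro k
    simp only [hF, hq, hl]
  · intro e
    have := (h1 e).map l
    simpa only [hl] using this
  · intro e
    exact (h2 e).map u

theorem IsCoord.unique_self {D : Diagram} {t t' : CoordIdx → P1} (h : D.IsCoord t)
    (h' : D.IsCoord t') : t = t' := by
  obtain ⟨q, hq, h1, h2⟩ := h
  obtain ⟨q', hq', h1', h2'⟩ := h'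
  obtain rfl := hq.unique hq'
  funext i
  rcases i with e | e
  · exact (h1 e).unique (h1' e)
  · exact (h2 e).unique (h2' e)

theorem IsCoord.unique {D E : Diagram} (h : AM.mk D = AM.mk E) {t t' : CoordIdx → P1}
    (hD : D.IsCoord t) (hE : E.IsCoord t') : t = t' :=
  (hD.of_equivalent (Quotient.exact h)).unique_self hE

theorem IsCoord.mem_zeroLocus_iff {D : Diagram} {t : CoordIdx → P1} (hD : D.IsCoord t)
    (P : MvPolynomial (CoordIdx × Fin 2) ℂ) : AM.mk D ∈ zeroLocus P ↔
      ∀ w : CoordIdx × Fin 2 → ℂ, (∀ i, IsHomCoord (w (i, 0)) (w (i, 1)) (t i)) →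
        MvPolynomial.eval w P = 0 := by
  constructor
  · rintro ⟨E, t', hE, ht', h⟩
    obtain rfl := hD.unique hE.symm ht'
    exact h
  · exact fun h => ⟨D, t, rfl, hD, h⟩

end Diagram

theorem isClosed_zeroLocus (P : MvPolynomial (CoordIdx × Fin 2) ℂ) : IsClosed (zeroLocus P) :=
  ⟨TopologicalSpace.isOpen_generateFrom_of_mem ⟨P, rfl⟩⟩

theorem exists_homCoords (t : CoordIdx → P1) :
    ∃ w : CoordIdx × Fin 2 → ℂ, ∀ i, IsHomCoord (w (i, 0)) (w (i, 1)) (t i) := by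
  choose a b h using fun i => exists_isHomCoord (t i)
  exact ⟨fun k => if k.2 = 0 then a k.1 else b k.1, fun i => by simpa using h i⟩

/-- The closed locus where a cross ratio has a given value with homogeneous coordinates `(a, b)`. -/
def valueLocus (i : CoordIdx) (a b : ℂ) : Set AM :=
  zeroLocus (MvPolynomial.C b * MvPolynomial.X (i, 0) - MvPolynomial.C a * MvPolynomial.X (i, 1))

theorem isClosed_valueLocus (i : CoordIdx) (a b : ℂ) : IsClosed (valueLocus i a b) :=
  isClosed_zeroLocus _

theorem Diagram.IsCoord.mem_valueLocus_iff {D : Diagram} {t : CoordIdx → P1} (hD : D.IsCoord t)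
    {i : CoordIdx} {a b : ℂ} {p : P1} (hp : IsHomCoord a b p) :
    AM.mk D ∈ valueLocus i a b ↔ t i = p := by
  rw [valueLocus, hD.mem_zeroLocus_iff]
  simp only [map_sub, map_mul, MvPolynomial.eval_C, MvPolynomial.eval_X]
  constructor
  · intro h
    obtain ⟨w, hw⟩ := exists_homCoords t
    rw [(hw i).eq_iff hp]
    linear_combination h w hw
  · intro h w hw
    rw [(hw i).eq_iff hp] at h
    linear_combination h

/-- The closed locus where two cross ratios agree. -/
def equalLocus (i j : CoordIdx) : Set AM :=
  zeroLocus (MvPolynomial.X (i, 0) * MvPolynomial.X (j, 1) -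
    MvPolynomial.X (j, 0) * MvPolynomial.X (i, 1))

theorem Diagram.IsCoord.mem_equalLocus_iff {D : Diagram} {t : CoordIdx → P1} (hD : D.IsCoord t)
    {i j : CoordIdx} : AM.mk D ∈ equalLocus i j ↔ t i = t j := by
  rw [equalLocus, hD.mem_zeroLocus_iff]
  simp only [map_sub, map_mul, MvPolynomial.eval_X]
  constructor
  · intro h
    obtain ⟨w, hw⟩ := exists_homCoords t
    rw [(hw i).eq_iff (hw j)]
    linear_combination h w hw
  · intro h w hw
    rw [(hw i).eq_iff (hw j)] at h
    linear_combination h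

/-- Points with coordinates which specialize to each other have the same coordinates. -/
theorem Diagram.IsCoord.eq_of_mem_closure {D E : Diagram} {t s : CoordIdx → P1}
    (hD : D.IsCoord t) (hE : E.IsCoord s) (h : AM.mk D ∈ closure {AM.mk E}) : t = s := by
  funext i
  obtain ⟨a, b, hp⟩ := exists_isHomCoord (s i)
  rw [← hD.mem_valueLocus_iff hp]
  refine closure_minimal ?_ (isClosed_valueLocus i a b) h
  rw [Set.singleton_subset_iff, hE.mem_valueLocus_iff hp]

/-- Basic open sets see only the coordinates, so classes with equal coordinates are topologically
indistinguishable. This serves in place of injectivity of the coordinates. -/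
theorem Diagram.IsCoord.mem_closure {D E : Diagram} {t : CoordIdx → P1}
    (hD : D.IsCoord t) (hE : E.IsCoord t) : AM.mk D ∈ closure {AM.mk E} := by
  have key : ∀ O : Set AM, IsOpen O → (AM.mk D ∈ O ↔ AM.mk E ∈ O) := by
    intro O hO
    induction hO with
    | basic O h =>
      obtain ⟨P, rfl⟩ := h
      rw [Set.mem_compl_iff, Set.mem_compl_iff, hD.mem_zeroLocus_iff, hE.mem_zeroLocus_iff]
    | univ => simp
    | inter s t _ _ h1 h2 => simp [h1, h2]
    | sUnion S _ h =>
      simp only [Set.mem_sUnion]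
      exact exists_congr fun O => and_congr_right fun hO => h O hO
  rw [mem_closure_iff]
  intro O hO hD'
  exact ⟨_, (key O hO).1 hD', rfl⟩

/-! ### Families with polynomial coordinates -/

/-- A function with values in the projective line given by polynomials on `T`. -/
def IsPolyOn (T : Set ℂ) (p : ℂ → P1) : Prop :=
  ∃ a b : ℂ[X], ∀ c ∈ T, IsHomCoord (a.eval c) (b.eval c) (p c)

theorem IsPolyOn.const (T : Set ℂ) (p : P1) : IsPolyOn T fun _ => p := by
  obtain ⟨a, b, h⟩ := exists_isHomCoord p
  exact ⟨Polynomial.C a, Polynomial.C b, fun c _ => by simpa using h⟩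

theorem IsPolyOn.some_eval (T : Set ℂ) (a : ℂ[X]) : IsPolyOn T fun c => OnePoint.some (a.eval c) :=
  ⟨a, 1, fun c _ => by simpa using isHomCoord_some _⟩

theorem IsPolyOn.crossRatio {T : Set ℂ} {p₀ p₁ p₂ p₃ t : ℂ → P1} (h0 : IsPolyOn T p₀)
    (h1 : IsPolyOn T p₁) (h2 : IsPolyOn T p₂) (h3 : IsPolyOn T p₃)
    (h : ∀ c ∈ T, ∃ g : Mob, g • p₀ c = OnePoint.some 0 ∧ g • p₁ c = OnePoint.some 1 ∧
      g • p₂ c = OnePoint.infty ∧ g • p₃ c = t c) : IsPolyOn T t := by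
  obtain ⟨a0, b0, h0⟩ := h0
  obtain ⟨a1, b1, h1⟩ := h1
  obtain ⟨a2, b2, h2⟩ := h2
  obtain ⟨a3, b3, h3⟩ := h3
  refine ⟨(a3 * b0 - a0 * b3) * (a1 * b2 - a2 * b1), (a3 * b2 - a2 * b3) * (a1 * b0 - a0 * b1),
    fun c hc => ?_⟩
  obtain ⟨g, g0, g1, g2, g3⟩ := h c hc
  rw [← g3]
  simpa using isHomCoord_crossRatio (h0 c hc) (h1 c hc) (h2 c hc) (h3 c hc) g0 g1 g2

theorem IsHomCoord.exists_scalar {a b c d : ℂ} {p : P1} (h : IsHomCoord a b p)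
    (h' : IsHomCoord c d p) : ∃ l : ℂ, c = l * a ∧ d = l * b := by
  have he := (h.eq_iff h').1 rfl
  rcases h.ne_zero with h0 | h0
  · exact ⟨c / a, by field_simp, by field_simp; linear_combination he⟩
  · exact ⟨d / b, by field_simp; linear_combination -he, by field_simp⟩

/-- Substituting the polynomial coordinates of the family into P gives a polynomial in the
parameter, which is zero or has finitely many roots. As P need not be homogeneous, each coordinate
pair carries an arbitrary nonzero factor `l i`: if all the polynomials `Q l` vanish, P vanishes on
the whole family, and otherwise the roots of one nonzero `Q l` bound the parameters. -/
theorem zeroLocus_finite_or_all {T : Set ℂ} {D : ℂ → Diagram} {t : ℂ → CoordIdx → P1}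
    (hD : ∀ c ∈ T, (D c).IsCoord (t c)) (ht : ∀ i, IsPolyOn T fun c => t c i)
    (P : MvPolynomial (CoordIdx × Fin 2) ℂ) :
    (∀ c ∈ T, AM.mk (D c) ∈ zeroLocus P) ∨ {c ∈ T | AM.mk (D c) ∈ zeroLocus P}.Finite := by
  choose a b hab using ht
  let Q : (CoordIdx → ℂ) → ℂ[X] := fun l => MvPolynomial.aeval
    (fun k : CoordIdx × Fin 2 => Polynomial.C (l k.1) * (if k.2 = 0 then a k.1 else b k.1)) P
  have hQ : ∀ l c, (Q l).eval c = MvPolynomial.eval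
      (fun k => l k.1 * (if k.2 = 0 then (a k.1).eval c else (b k.1).eval c)) P := by
    intro l c
    have := MvPolynomial.map_aeval (fun k : CoordIdx × Fin 2 =>
      Polynomial.C (l k.1) * (if k.2 = 0 then a k.1 else b k.1)) (Polynomial.evalRingHom c) P
    rw [Polynomial.coe_evalRingHom] at this
    rw [show (Q l).eval c = _ from this, MvPolynomial.eval, MvPolynomial.coe_eval₂Hom,
      MvPolynomial.coe_eval₂Hom]
    congr 1
    · ext x
      simp
    · funext k
      split_ifs <;> simp
  by_cases hall : ∀ l : CoordIdx → ℂ, (∀ i, l i ≠ 0) → Q l = 0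
  · refine Or.inl fun c hc => ((hD c hc).mem_zeroLocus_iff P).2 fun w hw => ?_
    choose l hl using fun i => (hab i c hc).exists_scalar (hw i)
    have hl0 : ∀ i, l i ≠ 0 := by
      intro i h0
      have := (hw i).ne_zero
      simp [(hl i).1, (hl i).2, h0] at this
    have := hQ l c
    rw [hall l hl0, Polynomial.eval_zero] at this
    rw [this]
    congr 2
    funext ⟨i, j⟩
    fin_cases j
    · simpa using (hl i).1
    · simpa using (hl i).2
  · push Not at hall
    obtain ⟨l, hl, hl0⟩ := hall
    refine Or.inr (Set.Finite.subset ((Q l).roots.toFinset.finite_toSet) ?_)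
    rintro c ⟨hc, hz⟩
    have := ((hD c hc).mem_zeroLocus_iff P).1 hz
      (fun k => l k.1 * (if k.2 = 0 then (a k.1).eval c else (b k.1).eval c)) (fun i => by
        refine (hab i c hc).of_mul_eq ?_ ?_
        · rcases (hab i c hc).ne_zero with h | h
          · exact Or.inl (by simpa using ⟨hl i, h⟩)
          · exact Or.inr (by simpa using ⟨hl i, h⟩)
        · simp
          ring)
    rw [← hQ] at this
    simpa [Polynomial.mem_roots hl0] using this

/-- The alternative for complements of basic open sets passes to finite intersections and arbitrary
unions of open sets. -/
theorem closed_finite_or_all {T : Set ℂ} {D : ℂ → Diagram} {t : ℂ → CoordIdx → P1}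
    (hD : ∀ c ∈ T, (D c).IsCoord (t c)) (ht : ∀ i, IsPolyOn T fun c => t c i)
    (K : Set AM) (hK : IsClosed K) :
    (∀ c ∈ T, AM.mk (D c) ∈ K) ∨ {c ∈ T | AM.mk (D c) ∈ K}.Finite := by
  suffices h : ∀ O : Set AM, IsOpen O →
      (∀ c ∈ T, AM.mk (D c) ∉ O) ∨ {c ∈ T | AM.mk (D c) ∉ O}.Finite by
    simpa using h Kᶜ hK.isOpen_compl
  intro O hO
  induction hO with
  | basic O h =>
    obtain ⟨P, rfl⟩ := h
    simpa using zeroLocus_finite_or_all hD ht P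
  | univ => exact Or.inr (by simp)
  | inter s t _ _ h1 h2 =>
    rcases h1 with h1 | h1
    · exact Or.inl fun c hc h => h1 c hc h.1
    rcases h2 with h2 | h2
    · exact Or.inl fun c hc h => h2 c hc h.2
    · refine Or.inr ((h1.union h2).subset ?_)
      rintro c ⟨hc, h⟩
      by_cases hs : AM.mk (D c) ∈ s
      · exact Or.inr ⟨hc, fun ht => h ⟨hs, ht⟩⟩
      · exact Or.inl ⟨hc, hs⟩
  | sUnion S _ h =>
    by_cases hall : ∀ O ∈ S, ∀ c ∈ T, AM.mk (D c) ∉ O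
    · refine Or.inl fun c hc => ?_
      rintro ⟨O, hO, hm⟩
      exact hall O hO c hc hm
    · push Not at hall
      obtain ⟨O, hO, c, hc, hm⟩ := hall
      rcases h O hO with h' | h'
      · exact absurd hm (h' c hc)
      · exact Or.inr (h'.subset fun c hc => ⟨hc.1, fun h => hc.2 ⟨O, hO, h⟩⟩)

/-! ### Unions of curves -/

section Curves

variable {X ι : Type} [TopologicalSpace X] {T : ι → Set ℂ} {φ : ι → ℂ → X} {S : Set X}

/-- Open sets that meet the curve have cofinite preimages in the infinite parameter set, so any two
of them meet on the curve. -/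
theorem isIrreducible_curve (hT : ∀ i, (T i).Infinite)
    (hclosed : ∀ i (K : Set X), IsClosed K →
      (∀ c ∈ T i, φ i c ∈ K) ∨ {c ∈ T i | φ i c ∈ K}.Finite)
    (hS : S = ⋃ i, φ i '' T i) (i : ι) :
    IsIrreducible {y : S | ∃ c ∈ T i, (y : X) = φ i c} := by
  have hmem : ∀ c ∈ T i, φ i c ∈ S := fun c hc => by
    rw [hS]
    exact Set.mem_iUnion.2 ⟨i, c, hc, rfl⟩
  obtain ⟨c₀, hc₀⟩ := (hT i).nonempty
  refine ⟨⟨⟨φ i c₀, hmem c₀ hc₀⟩, c₀, hc₀, rfl⟩, ?_⟩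
  rintro u v hu hv ⟨y, ⟨c, hc, hyc⟩, hyu⟩ ⟨y', ⟨c', hc', hyc'⟩, hyv⟩
  obtain ⟨u', hu', rfl⟩ := isOpen_induced_iff.1 hu
  obtain ⟨v', hv', rfl⟩ := isOpen_induced_iff.1 hv
  have h1 := (hclosed i u'ᶜ hu'.isClosed_compl).resolve_left fun h => h c hc (hyc ▸ hyu)
  have h2 := (hclosed i v'ᶜ hv'.isClosed_compl).resolve_left fun h => h c' hc' (hyc' ▸ hyv)
  obtain ⟨d, hd, hdn⟩ := ((hT i).sdiff (h1.union h2)).nonempty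
  simp only [Set.mem_union, Set.mem_ofPred_eq, Set.mem_compl_iff, not_or, not_and, not_not] at hdn
  exact ⟨⟨φ i d, hmem d hd⟩, ⟨d, hd, rfl⟩, hdn.1 hd, hdn.2 hd⟩

/-- A finite union of curves, each parametrized by an infinite set of complex numbers in such a way
that closed sets pull back to finite sets or to everything, has pure dimension one. -/
theorem isPureDim_one [Finite ι] (hT : ∀ i, (T i).Infinite)
    (hclosed : ∀ i (K : Set X), IsClosed K →
      (∀ c ∈ T i, φ i c ∈ K) ∨ {c ∈ T i | φ i c ∈ K}.Finite)
    (hS : S = ⋃ i, φ i '' T i)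
    (hsep : ∀ i j, i ≠ j → ∃ K, IsClosed K ∧ (∀ c ∈ T i, φ i c ∈ K) ∧ ∃ c ∈ T j, φ j c ∉ K)
    (hR0 : ∀ x ∈ S, ∀ y ∈ S, x ∈ closure {y} → y ∈ closure {x})
    (hnc : ∀ i, ∃ c ∈ T i, ∃ c' ∈ T i, φ i c' ∉ closure {φ i c}) : IsPureDim S 1 := by
  intro Z hZ
  have hmem : ∀ i, ∀ c ∈ T i, φ i c ∈ S := fun i c hc => by
    rw [hS]
    exact Set.mem_iUnion.2 ⟨i, c, hc, rfl⟩
  let R : ι → Set S := fun i => {y : S | ∃ c ∈ T i, (y : X) = φ i c}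
  have hR : ∀ i, IsIrreducible (R i) := isIrreducible_curve hT hclosed hS
  have hcov : ∀ y : S, ∃ i, y ∈ R i := by
    rintro ⟨y, hy⟩
    have hy' := hy
    rw [hS] at hy'
    obtain ⟨i, c, hc, rfl⟩ := Set.mem_iUnion.1 hy'
    exact ⟨i, c, hc, rfl⟩
  have hZirr : IsIrreducible Z := hZ.1
  -- An irreducible set covered by finitely many closed sets lies in one of them; by maximality Z is
  -- then the closure of one curve.
  obtain ⟨i, hZi⟩ : ∃ i, Z ⊆ closure (R i) := by
    have hfin : (Set.range fun i => closure (R i)).Finite := Set.finite_range _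
    have := (isIrreducible_iff_sUnion_isClosed.1 hZirr) hfin.toFinset (by
      intro K hK
      obtain ⟨i, rfl⟩ := hfin.mem_toFinset.1 hK
      exact isClosed_closure) (by
      intro y _
      obtain ⟨i, hi⟩ := hcov y
      exact ⟨closure (R i), by simp, subset_closure hi⟩)
    obtain ⟨K, hK, hZK⟩ := this
    obtain ⟨i, rfl⟩ := hfin.mem_toFinset.1 hK
    exact ⟨i, hZK⟩
  have hZeq : Z = closure (R i) := hZi.antisymm (hZ.2 (hR i).closure hZi)
  have hRZ : R i ⊆ Z := hZeq ▸ subset_closure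
  have hZuniv : IsIrreducible (Set.univ : Set Z) := by
    have := Subtype.irreducibleSpace hZirr
    exact IrreducibleSpace.isIrreducible_univ Z
  -- A proper closed subset of Z does not contain the curve i, so it meets that curve in finitely
  -- many parameters; the other curves meet the closure of the curve i in finitely many parameters
  -- by separation.
  have hfinite : ∀ x : TopologicalSpace.IrreducibleCloseds Z, (x : Set Z) ≠ Set.univ →
      (x : Set Z).Finite := by
    intro x hx
    obtain ⟨K', hK', hxK'⟩ := isClosed_induced_iff.1 x.isClosed
    obtain ⟨K, hK, hKK'⟩ := isClosed_induced_iff.1 hK'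
    have hxmem : ∀ z : Z, z ∈ (x : Set Z) ↔ ((z : S) : X) ∈ K := by
      intro z
      rw [← hxK', ← hKK']
      rfl
    have hnot : ¬ ∀ c ∈ T i, φ i c ∈ K := by
      intro hall
      apply hx
      have hsub : R i ⊆ K' := by
        rintro y ⟨c, hc, hy⟩
        rw [← hKK']
        change (y : X) ∈ K
        rw [hy]
        exact hall c hc
      rw [← hxK', Set.eq_univ_iff_forall]
      rintro ⟨z, hz⟩
      exact closure_minimal hsub hK' (hZi hz)
    have hj : ∀ j, {c ∈ T j | φ j c ∈ K ∧ ∃ h : φ j c ∈ S, (⟨φ j c, h⟩ : S) ∈ Z}.Finite := by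
      intro j
      by_cases hij : i = j
      · subst hij
        exact ((hclosed i K hK).resolve_left hnot).subset fun c hc => ⟨hc.1, hc.2.1⟩
      · obtain ⟨M, hM, hM1, c, hc, hM2⟩ := hsep i j hij
        refine ((hclosed j M hM).resolve_left fun h => hM2 (h c hc)).subset ?_
        rintro c ⟨hc, -, hS', hcZ⟩
        refine ⟨hc, ?_⟩
        have : closure (R i) ⊆ Subtype.val ⁻¹' M := by
          refine closure_minimal ?_ (hM.preimage continuous_subtype_val)
          rintro y ⟨d, hd, hy⟩
          change (y : X) ∈ M
          rw [hy]
          exact hM1 d hd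
        exact this (hZi hcZ)
    have hunion : (⋃ j, φ j '' {c ∈ T j | φ j c ∈ K ∧
        ∃ h : φ j c ∈ S, (⟨φ j c, h⟩ : S) ∈ Z}).Finite :=
      Set.finite_iUnion fun j => (hj j).image _
    refine Set.Finite.of_finite_image (f := fun z : Z => ((z : S) : X)) (hunion.subset ?_)
      (fun a _ b _ h => Subtype.ext (Subtype.ext h))
    rintro _ ⟨z, hz, rfl⟩
    obtain ⟨j, c, hc, hzc⟩ := hcov z
    refine Set.mem_iUnion.2 ⟨j, c, ⟨hc, ?_, ?_⟩, hzc.symm⟩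
    · rw [← hzc]
      exact (hxmem z).1 hz
    · refine ⟨hmem j c hc, ?_⟩
      have : (⟨φ j c, hmem j c hc⟩ : S) = z := Subtype.ext hzc.symm
      rw [this]
      exact z.2
  have hclos : ∀ a b : Z, a ∈ closure {b} ↔ ((a : S) : X) ∈ closure {((b : S) : X)} := by
    intro a b
    rw [closure_subtype, Set.image_singleton, closure_subtype, Set.image_singleton]
  apply le_antisymm
  · change Order.krullDim _ ≤ 1
    rw [Order.krullDim_le_one_iff]
    intro x
    by_cases hx : (x : Set Z) = Set.univ
    · right
      intro y _ p _
      change p ∈ (x : Set Z)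
      rw [hx]
      trivial
    left
    have hfin := hfinite x hx
    -- A finite irreducible closed set is the closure of one of its points. Since specialization is
    -- symmetric on S, it has no smaller nonempty closed subset, so it is minimal.
    obtain ⟨p, hp, hxp⟩ : ∃ p ∈ (x : Set Z), (x : Set Z) ⊆ closure {p} := by
      have hfin' : ((fun p => closure {p}) '' (x : Set Z)).Finite := hfin.image _
      obtain ⟨K, hK, hxK⟩ := (isIrreducible_iff_sUnion_isClosed.1 x.isIrreducible)
        hfin'.toFinset (by
          intro K hK
          obtain ⟨p, -, rfl⟩ := hfin'.mem_toFinset.1 hK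
          exact isClosed_closure) (by
          intro p hp
          exact ⟨closure {p}, hfin'.mem_toFinset.2 ⟨p, hp, rfl⟩, subset_closure rfl⟩)
      obtain ⟨p, hp, rfl⟩ := hfin'.mem_toFinset.1 hK
      exact ⟨p, hp, hxK⟩
    intro y hyx
    obtain ⟨r, hr⟩ := y.isIrreducible.nonempty
    have h1 : r ∈ closure {p} := hxp (hyx hr)
    have h2 : p ∈ closure {r} := by
      rw [hclos] at h1 ⊢
      exact hR0 _ r.1.2 _ p.1.2 h1
    have h3 : p ∈ (y : Set Z) := closure_minimal (Set.singleton_subset_iff.2 hr) y.isClosed h2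
    exact hxp.trans (closure_minimal (Set.singleton_subset_iff.2 h3) y.isClosed)
  · change 1 ≤ Order.krullDim _
    rw [Order.one_le_krullDim_iff]
    -- The closure of a point is a proper irreducible closed subset of Z, which gives a chain of
    -- length one.
    obtain ⟨c, hc, c', hc', hcc⟩ := hnc i
    let p : Z := ⟨⟨φ i c, hmem i c hc⟩, hRZ ⟨c, hc, rfl⟩⟩
    let p' : Z := ⟨⟨φ i c', hmem i c' hc'⟩, hRZ ⟨c', hc', rfl⟩⟩
    refine ⟨⟨closure {p}, isIrreducible_singleton.closure, isClosed_closure⟩,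
      ⟨Set.univ, hZuniv, isClosed_univ⟩, ?_⟩
    refine lt_of_le_not_ge (fun _ _ => trivial) fun h => ?_
    have : p' ∈ closure {p} := h (Set.mem_univ p')
    rw [hclos] at this
    exact hcc this

end Curves

/-! ### Standard curves and standard maps -/

theorem three_le_encard {α : Type*} {s : Set α} {a b c : α} (ha : a ∈ s) (hb : b ∈ s) (hc : c ∈ s)
    (hab : a ≠ b) (hac : a ≠ c) (hbc : b ≠ c) : 3 ≤ s.encard := by
  have h : ({a, b, c} : Set α).encard = 3 := Set.encard_eq_three.2 ⟨a, b, c, hab, hac, hbc, rfl⟩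
  rw [← h]
  apply Set.encard_le_encard
  rintro x (rfl | rfl | rfl) <;> assumption

theorem RationalCurve.proj_of_leaf (C : RationalCurve) {v w : Fin C.n} {p : C.Pt} (h : p.1 ≠ v)
    (hv : ∀ x, C.graph.Adj v x → x = w) : C.proj v p = C.node v w := by
  rw [C.proj_of_ne h, hv _ (Tree.step_adj C.isTree h)]

/-- The projective line. -/
def line : RationalCurve where
  n := 1
  graph := ⊥
  isTree := SimpleGraph.IsTree.of_subsingleton
  node _ _ := OnePoint.infty
  node_inj _ w w' _ _ _ := Subsingleton.elim w w'

/-- Two projective lines, glued at a point. -/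
def twoLines (s t : P1) : RationalCurve where
  n := 2
  graph := ⊤
  isTree := ⟨SimpleGraph.connected_top, SimpleGraph.IsAcyclic.of_card_le_two (by simp)⟩
  node v _ := if v = 0 then s else t
  node_inj v w w' h h' _ := by
    simp only [SimpleGraph.top_adj] at h h'
    omega

/-- A projective line with two more projective lines glued to it at the points `s` and `t`. -/
def threeLines (s t : P1) (h : s ≠ t) : RationalCurve where
  n := 3
  graph := SimpleGraph.starGraph 0
  isTree := SimpleGraph.isTree_starGraph 0
  node v w := if v = 0 then if w = 1 then s else t else OnePoint.infty
  node_inj v w w' hw hw' he := by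
    obtain ⟨h1, h2⟩ := SimpleGraph.starGraph_adj.1 hw
    obtain ⟨h1', h2'⟩ := SimpleGraph.starGraph_adj.1 hw'
    by_cases hv : v = 0
    · subst hv
      simp only [if_true] at he
      by_cases hw1 : w = 1
      · by_cases hw1' : w' = 1
        · rw [hw1, hw1']
        · simp only [hw1, hw1', if_true, if_false] at he
          exact absurd he h
      · by_cases hw1' : w' = 1
        · simp only [hw1, hw1', if_true, if_false] at he
          exact absurd he.symm h
        · omega
    · rw [h2.resolve_left hv, h2'.resolve_left hv]

theorem line_not_isNode (p : line.Pt) : ¬ line.IsNode p := by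
  rintro ⟨w, h, -⟩
  exact h

/-- The squaring map as a rational map. -/
def sqRat : RatMap := ⟨Polynomial.X ^ 2, 1, isCoprime_one_right⟩

/-- The identity as a rational map. -/
def idRat : RatMap := ⟨Polynomial.X, 1, isCoprime_one_right⟩

theorem sqRat_degree : sqRat.degree = 2 := by simp [sqRat, RatMap.degree]

theorem idRat_degree : idRat.degree = 1 := by simp [idRat, RatMap.degree]

@[simp] theorem idRat_apply (p : P1) : idRat.apply p = p := by
  cases p using OnePoint.rec with
  | infty =>
    change (if idRat.den.coeff idRat.degree = 0 then OnePoint.infty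
      else OnePoint.some (idRat.num.coeff idRat.degree / idRat.den.coeff idRat.degree)) = _
    rw [idRat_degree, if_pos (by simp [idRat, Polynomial.coeff_one])]
  | coe t =>
    change (if idRat.den.eval t = 0 then OnePoint.infty
      else OnePoint.some (idRat.num.eval t / idRat.den.eval t)) = _
    simp [idRat]

@[simp] theorem sqRat_apply (p : P1) : sqRat.apply p = sq p := by
  cases p using OnePoint.rec with
  | infty =>
    change (if sqRat.den.coeff sqRat.degree = 0 then OnePoint.infty
      else OnePoint.some (sqRat.num.coeff sqRat.degree / sqRat.den.coeff sqRat.degree)) = _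
    rw [sqRat_degree, if_pos (by simp [sqRat, Polynomial.coeff_one])]
    rfl
  | coe t =>
    change (if sqRat.den.eval t = 0 then OnePoint.infty
      else OnePoint.some (sqRat.num.eval t / sqRat.den.eval t)) = _
    simp [sqRat]

/-- The form of a double cover can be read off from its values. -/
theorem sqForm_of_apply {F : RatMap} (hF : F.degree = 2) {G H : Mob}
    (h : ∀ p, F.apply p = G • sq (H • p)) : SqForm F G H := by
  obtain ⟨G', H', h'⟩ := RatMap.exists_sqForm hF
  -- The critical points are those that are alone in their fibre, a description independent of the
  -- choice of G and H.
  have key : ∀ {G H : Mob}, (∀ p, F.apply p = G • sq (H • p)) → ∀ p,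
      (H • p = OnePoint.some 0 ∨ H • p = OnePoint.infty) ↔
      ∀ q, F.apply q = F.apply p → q = p := by
    intro G H h p
    rw [← scale_neg_one_eq_self_iff]
    constructor
    · intro hp q hq
      rw [h, h, smul_left_cancel_iff, sq_eq_sq_iff, hp, or_self] at hq
      exact smul_left_cancel H hq
    · intro hp
      have := hp (H⁻¹ • scale (-1) (by norm_num) • H • p) (by
        rw [h, h, smul_inv_smul, smul_left_cancel_iff, sq_eq_sq_iff]
        exact Or.inr rfl)
      rwa [inv_smul_eq_iff] at this
  have e : ∀ p : P1, (H • p = OnePoint.some 0 ∨ H • p = OnePoint.infty) ↔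
      (H' • p = OnePoint.some 0 ∨ H' • p = OnePoint.infty) := fun p =>
    (key h p).trans (key h'.apply_eq p).symm
  exact ⟨h, fun p hp => h'.localDegree_two p ((e p).1 hp),
    fun p hp => h'.localDegree_one p fun h'' => hp ((e p).2 h'')⟩

theorem sqRat_sqForm : SqForm sqRat 1 1 := sqForm_of_apply sqRat_degree (by simp)

theorem sqRat_localDegree_two {p : P1} (h : p = OnePoint.some 0 ∨ p = OnePoint.infty) :
    sqRat.localDegree p = 2 := sqRat_sqForm.localDegree_two p (by simpa using h)

theorem sqRat_localDegree_one {p : P1} (h : ¬ (p = OnePoint.some 0 ∨ p = OnePoint.infty)) :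
    sqRat.localDegree p = 1 := sqRat_sqForm.localDegree_one p (by simpa using h)

theorem idRat_localDegree (p : P1) : idRat.localDegree p = 1 := (idRat.exists_eq_mob idRat_degree).2 p

/-! ### The open stratum -/

instance : Fintype A := ⟨{A.zero, A.one, A.inf, A.x}, fun a => by cases a <;> decide⟩

instance : Fintype B := ⟨{B.zero, B.one, B.inf, B.y, B.z}, fun a => by cases a <;> decide⟩

instance : Fintype Fib := ⟨{Fib.zero, Fib.one, Fib.inf, Fib.x, Fib.one', Fib.inf', Fib.x', Fib.crit},
  fun a => by cases a <;> decide⟩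

/-- The positions of the marked points in coordinates in which the cover is the squaring map. -/
def upos (p q r : ℂ) : A → P1
  | A.zero => OnePoint.infty
  | A.one => OnePoint.some p
  | A.inf => OnePoint.some q
  | A.x => OnePoint.some r

/-- The positions of the marked points of the lower curve. -/
def lpos (p q r : ℂ) : B → P1
  | B.zero => OnePoint.some (r ^ 2)
  | B.one => OnePoint.some (q ^ 2)
  | B.inf => OnePoint.infty
  | B.y => OnePoint.some (p ^ 2)
  | B.z => OnePoint.some 0

/-- The positions of all preimages of the marked points. -/
def fpos (p q r : ℂ) : Fib → P1
  | Fib.zero => OnePoint.infty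
  | Fib.one => OnePoint.some p
  | Fib.inf => OnePoint.some q
  | Fib.x => OnePoint.some r
  | Fib.one' => OnePoint.some (-p)
  | Fib.inf' => OnePoint.some (-q)
  | Fib.x' => OnePoint.some (-r)
  | Fib.crit => OnePoint.some 0

theorem fpos_fibOfA (p q r : ℂ) (a : A) : fpos p q r (fibOfA a) = upos p q r a := by cases a <;> rfl

theorem sq_upos (p q r : ℂ) (a : A) : sq (upos p q r a) = lpos p q r (dyn a) := by cases a <;> rfl

theorem sq_fpos (p q r : ℂ) (l : Fib) : sq (fpos p q r l) = lpos p q r (fibMap l) := by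
  cases l <;> simp [fpos, lpos, fibMap]

/-- The non-degeneracy condition for the positions of the marked points. -/
structure Generic (p q r : ℂ) : Prop where
  p0 : p ≠ 0
  q0 : q ≠ 0
  r0 : r ≠ 0
  pq : p ^ 2 ≠ q ^ 2
  pr : p ^ 2 ≠ r ^ 2
  qr : q ^ 2 ≠ r ^ 2

theorem Generic.lpos_injective {p q r : ℂ} (h : Generic p q r) :
    Function.Injective (lpos p q r) := by
  obtain ⟨p0, q0, r0, pq, pr, qr⟩ := h
  have p1 : 0 ≠ p ^ 2 := (pow_ne_zero 2 p0).symm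
  have q1 : 0 ≠ q ^ 2 := (pow_ne_zero 2 q0).symm
  have r1 : 0 ≠ r ^ 2 := (pow_ne_zero 2 r0).symm
  intro b b' he
  cases b <;> cases b' <;> simp_all [lpos]

theorem ne_of_sq_ne {a b : ℂ} (h : a ^ 2 ≠ b ^ 2) : a ≠ b ∧ a ≠ -b :=
  ⟨fun e => h (by rw [e]), fun e => h (by rw [e, neg_sq])⟩

theorem Generic.fpos_injective {p q r : ℂ} (h : Generic p q r) :
    Function.Injective (fpos p q r) := by
  obtain ⟨p0, q0, r0, pq, pr, qr⟩ := h
  obtain ⟨pq1, pq2⟩ := ne_of_sq_ne pq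
  obtain ⟨pr1, pr2⟩ := ne_of_sq_ne pr
  obtain ⟨qr1, qr2⟩ := ne_of_sq_ne qr
  have n1 : -p ≠ q := fun e => pq2 (by rw [← e, neg_neg])
  have n2 : -p ≠ r := fun e => pr2 (by rw [← e, neg_neg])
  have n3 : -q ≠ r := fun e => qr2 (by rw [← e, neg_neg])
  have s1 : p ≠ -p := fun e => p0 (by linear_combination e / 2)
  have s2 : q ≠ -q := fun e => q0 (by linear_combination e / 2)
  have s3 : r ≠ -r := fun e => r0 (by linear_combination e / 2)
  intro b b' he
  cases b <;> cases b' <;> simp_all [fpos, eq_comm]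

theorem Generic.upos_injective {p q r : ℂ} (h : Generic p q r) :
    Function.Injective (upos p q r) := by
  intro a a' he
  rw [← fpos_fibOfA, ← fpos_fibOfA] at he
  have := h.fpos_injective he
  cases a <;> cases a' <;> simp_all [fibOfA]

/-- The positions `p`, `q`, `r` on the diagonal `x = y`, as functions of `x`. -/
def vp (x : ℂ) : ℂ := 3 * x ^ 2 - 3 * x + 1
/-- See `vp`. -/
def vq (x : ℂ) : ℂ := 1 - x - x ^ 2
/-- See `vp`. -/
def vr (x : ℂ) : ℂ := -x ^ 2 + 3 * x - 1

/-- The parameters of the open stratum of the diagonal. -/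
def TV : Set ℂ := {x | x ≠ 0 ∧ x ≠ 1 ∧ 2 * x ≠ 1 ∧ vp x ≠ 0 ∧ vq x ≠ 0 ∧ vr x ≠ 0}

/-- The differences of the squares of `vp`, `vq`, `vr` are products of x, x − 1 and 2x − 1; this is
the origin of the first three conditions in `TV`. -/
theorem generic_of_mem_TV {x : ℂ} (hx : x ∈ TV) : Generic (vp x) (vq x) (vr x) := by
  obtain ⟨h0, h1, h2, hp, hq, hr⟩ := hx
  have h1' : x - 1 ≠ 0 := sub_ne_zero.2 h1
  have h2' : 2 * x - 1 ≠ 0 := sub_ne_zero.2 h2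
  refine ⟨hp, hq, hr, ?_, ?_, ?_⟩ <;> rw [← sub_ne_zero]
  · have : vp x ^ 2 - vq x ^ 2 = 4 * x * (2 * x - 1) * (x - 1) ^ 2 := by unfold vp vq; ring
    rw [this]
    simp [h0, h1', h2']
  · have : vp x ^ 2 - vr x ^ 2 = 4 * x ^ 2 * (2 * x - 1) * (x - 1) := by unfold vp vr; ring
    rw [this]
    simp [h0, h1', h2']
  · have : vq x ^ 2 - vr x ^ 2 = 4 * x * (2 * x - 1) * (x - 1) := by unfold vq vr; ring
    rw [this]
    simp [h0, h1', h2']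

/-- The cover on the diagonal. -/
def vRat (p q r : ℂ) (h : Generic p q r) : RatMap where
  -- The map is t ↦ ((q + (p − q)/t)² − r²)/(q² − r²). The inner Möbius map sends 0, 1, ∞ to ∞, p,
  -- q, and the outer affine map sends r², q², ∞ to 0, 1, ∞.
  num := (Polynomial.C q * Polynomial.X + Polynomial.C (p - q)) ^ 2 -
    Polynomial.C (r ^ 2) * Polynomial.X ^ 2
  den := Polynomial.C (q ^ 2 - r ^ 2) * Polynomial.X ^ 2
  coprime := by
    have hu : IsUnit (Polynomial.C (q ^ 2 - r ^ 2)) :=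
      Polynomial.isUnit_C.2 (isUnit_iff_ne_zero.2 (sub_ne_zero.2 h.qr))
    have hpq : p - q ≠ 0 := sub_ne_zero.2 (ne_of_sq_ne h.pq).1
    refine (isCoprime_mul_unit_left_right hu _ _).2 ?_
    apply IsCoprime.pow_right
    have e : (Polynomial.C q * Polynomial.X + Polynomial.C (p - q)) ^ 2 -
        Polynomial.C (r ^ 2) * Polynomial.X ^ 2 = Polynomial.C ((p - q) ^ 2) + Polynomial.X *
        (Polynomial.C (q ^ 2) * Polynomial.X + 2 * Polynomial.C q * Polynomial.C (p - q) -
          Polynomial.C (r ^ 2) * Polynomial.X) := by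
      simp only [map_pow]; ring
    rw [e]
    refine IsCoprime.add_mul_left_left ?_ _
    refine ⟨Polynomial.C ((p - q) ^ 2)⁻¹, 0, ?_⟩
    rw [zero_mul, add_zero, ← map_mul, inv_mul_cancel₀ (pow_ne_zero 2 hpq), map_one]

/-- The coordinate change of the upper curve. -/
def vH (p q r : ℂ) (h : Generic p q r) : Mob :=
  mob q (p - q) 1 0 (by
    have : q - p ≠ 0 := sub_ne_zero.2 (ne_of_sq_ne h.pq).1.symm
    simpa using this)

/-- The coordinate change of the lower curve. -/
def vG (p q r : ℂ) (h : Generic p q r) : Mob :=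
  mob 1 (-r ^ 2) 0 (q ^ 2 - r ^ 2) (by simpa using sub_ne_zero.2 h.qr)

theorem vRat_num_eq (p q r : ℂ) (h : Generic p q r) : (vRat p q r h).num =
    Polynomial.C (q ^ 2 - r ^ 2) * Polynomial.X ^ 2 + Polynomial.C (2 * q * (p - q)) * Polynomial.X +
      Polynomial.C ((p - q) ^ 2) := by
  simp only [vRat, map_pow, map_sub, map_mul, Polynomial.C_ofNat]
  ring

theorem vRat_degree (p q r : ℂ) (h : Generic p q r) : (vRat p q r h).degree = 2 := by
  have hqr : q ^ 2 - r ^ 2 ≠ 0 := sub_ne_zero.2 h.qr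
  have h1 : (vRat p q r h).den.natDegree = 2 := by
    simp only [vRat]
    exact Polynomial.natDegree_C_mul_X_pow 2 _ hqr
  have h2 : (vRat p q r h).num.natDegree = 2 := by
    rw [vRat_num_eq]
    exact Polynomial.natDegree_quadratic hqr
  rw [RatMap.degree, h1, h2, max_self]

theorem vRat_sqForm (p q r : ℂ) (h : Generic p q r) :
    SqForm (vRat p q r h) (vG p q r h) (vH p q r h) := by
  refine sqForm_of_apply (vRat_degree p q r h) fun t => ?_
  have hqr : q ^ 2 - r ^ 2 ≠ 0 := sub_ne_zero.2 h.qr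
  unfold vG vH
  cases t using OnePoint.rec with
  | infty =>
    change (if (vRat p q r h).den.coeff (vRat p q r h).degree = 0 then OnePoint.infty
      else OnePoint.some ((vRat p q r h).num.coeff (vRat p q r h).degree /
        (vRat p q r h).den.coeff (vRat p q r h).degree)) = _
    have c1 : (vRat p q r h).den.coeff 2 = q ^ 2 - r ^ 2 := by
      simp only [vRat, Polynomial.coeff_C_mul, Polynomial.coeff_X_pow, if_true, mul_one]
    have c2 : (vRat p q r h).num.coeff 2 = q ^ 2 - r ^ 2 := by
      rw [vRat_num_eq]
      simp only [Polynomial.coeff_add, Polynomial.coeff_C_mul, Polynomial.coeff_X_pow,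
        Polynomial.coeff_X, Polynomial.coeff_C]
      norm_num
    rw [vRat_degree, c1, c2, if_neg hqr, div_self hqr,
      (isHomCoord_some _).eq_iff ((isHomCoord_infty.mob _).sq.mob _)]
    ring
  | coe s =>
    change (if (vRat p q r h).den.eval s = 0 then OnePoint.infty
      else OnePoint.some ((vRat p q r h).num.eval s / (vRat p q r h).den.eval s)) = _
    have c1 : (vRat p q r h).den.eval s = (q ^ 2 - r ^ 2) * s ^ 2 := by simp [vRat]
    have c2 : (vRat p q r h).num.eval s = (q * s + (p - q)) ^ 2 - r ^ 2 * s ^ 2 := by simp [vRat]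
    rw [c1, c2]
    split_ifs with h0
    · rw [isHomCoord_infty.eq_iff (((isHomCoord_some s).mob _).sq.mob _)]
      linear_combination h0
    · rw [(isHomCoord_some _).eq_iff (((isHomCoord_some s).mob _).sq.mob _)]
      have hs : s ≠ 0 := by
        rintro rfl
        simp at h0
      field_simp
      ring

/-- The diagram in the open stratum with the given positions of the marked points. -/
def vDiagram (p q r : ℂ) (h : Generic p q r) : Diagram where
  U :=
    { toRationalCurve := line
      mark := fun a => ((0 : Fin 1), (vH p q r h)⁻¹ • upos p q r a)
      mark_inj := fun a a' he => h.upos_injective (smul_left_cancel _ (congrArg Prod.snd he))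
      mark_smooth := fun _ => line_not_isNode _ }
  L :=
    { toRationalCurve := line
      mark := fun b => ((0 : Fin 1), vG p q r h • lpos p q r b)
      mark_inj := fun b b' he => h.lpos_injective (smul_left_cancel _ (congrArg Prod.snd he))
      mark_smooth := fun _ => line_not_isNode _ }
  F := { comp := fun _ => (0 : Fin 1), map := fun _ => vRat p q r h }
  stable := by
    intro v
    have hv : v = (0 : Fin 1) := Subsingleton.elim (α := Fin 1) _ _
    subst hv
    have hne : ∀ {b b' : B}, b ≠ b' → vG p q r h • lpos p q r b ≠ vG p q r h • lpos p q r b' :=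
      fun hb he => hb (h.lpos_injective (smul_left_cancel _ he))
    exact three_le_encard (Or.inr ⟨B.zero, rfl⟩) (Or.inr ⟨B.one, rfl⟩) (Or.inr ⟨B.inf, rfl⟩)
      (hne (by simp)) (hne (by simp)) (hne (by simp))
  preAdmissible :=
    { nonconst := fun _ => by simp [vRat_degree]
      degree_eq := fun u => by
        have hu : u = (0 : Fin 1) := Subsingleton.elim (α := Fin 1) _ _
        subst hu
        simp only [vRat_degree]
        rfl
      adj := fun _ _ h => absurd h id
      node := fun _ _ h => absurd h id
      isNode_of_isNode := fun p hp => absurd hp (line_not_isNode _)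
      localDegree_eq := fun _ _ h => absurd h id }
  comm a := by
    refine Prod.ext rfl ?_
    change (vRat p q r h).apply _ = vG p q r h • lpos p q r (dyn a)
    rw [(vRat_sqForm p q r h).apply_eq, smul_inv_smul, sq_upos]
  branch := by
    rintro ⟨v, t⟩ - hd
    have hd' : 2 ≤ (vRat p q r h).localDegree t := hd
    have hle := (vRat p q r h).localDegree_le_degree t
    rw [vRat_degree] at hle
    rcases (vRat_sqForm p q r h).localDegree_eq_two_iff.1 (le_antisymm hle hd') with h0 | h0
    · right
      refine Prod.ext rfl ?_
      change (vRat p q r h).apply t = vG p q r h • lpos p q r B.z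
      rw [(vRat_sqForm p q r h).apply_eq, h0]
      simp [lpos]
    · left
      refine Prod.ext rfl ?_
      change (vRat p q r h).apply t = vG p q r h • lpos p q r B.inf
      rw [(vRat_sqForm p q r h).apply_eq, h0]
      simp [lpos]
  branch_inf := (vRat_sqForm p q r h).localDegree_two _ (Or.inr (smul_inv_smul _ _))
  branch_z := by
    refine ⟨((0 : Fin 1), (vH p q r h)⁻¹ • OnePoint.some 0), Prod.ext rfl ?_,
      (vRat_sqForm p q r h).localDegree_two _ (Or.inl (smul_inv_smul _ _))⟩
    change (vRat p q r h).apply _ = vG p q r h • lpos p q r B.z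
    rw [(vRat_sqForm p q r h).apply_eq, smul_inv_smul]
    simp [lpos]

/-! ### The boundary strata -/

/-- The parameters of the boundary strata. -/
def TA : Set ℂ := {c | c ≠ 0 ∧ c ≠ 1 ∧ c ≠ -1}

theorem sq_ne_of_mem_TA {c : ℂ} (hc : c ∈ TA) : c ^ 2 ≠ 0 ∧ c ^ 2 ≠ 1 := by
  obtain ⟨h0, h1, h2⟩ := hc
  refine ⟨pow_ne_zero 2 h0, fun h => ?_⟩
  rcases (sq_eq_sq_iff_eq_or_eq_neg (a := c) (b := 1)).1 (by rw [h, one_pow]) with h | h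
  · exact h1 h
  · exact h2 h

theorem ne_neg_of_mem_TA {c : ℂ} (hc : c ∈ TA) : c ≠ -c :=
  fun h => hc.1 (by linear_combination h / 2)

theorem twoLines_isNode_iff {s t r : P1} {v : Fin 2} :
    (twoLines s t).IsNode (v, r) ↔ (v = 0 ∧ r = s) ∨ (v = 1 ∧ r = t) := by
  constructor
  · rintro ⟨w, hw, hp⟩
    change r = if v = (0 : Fin 2) then s else t at hp
    fin_cases v
    · exact Or.inl ⟨rfl, hp⟩
    · exact Or.inr ⟨rfl, hp⟩
  · rintro (⟨rfl, rfl⟩ | ⟨rfl, rfl⟩)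
    · exact ⟨(1 : Fin 2), (by decide : (0 : Fin 2) ≠ 1), rfl⟩
    · exact ⟨(0 : Fin 2), (by decide : (1 : Fin 2) ≠ 0), rfl⟩

theorem threeLines_isNode_iff {s t r : P1} {h : s ≠ t} {v : Fin 3} :
    (threeLines s t h).IsNode (v, r) ↔
    (v = 0 ∧ (r = s ∨ r = t)) ∨ (v ≠ 0 ∧ r = OnePoint.infty) := by
  constructor
  · rintro ⟨w, hw, hp⟩
    change Fin 3 at w
    change r = if v = (0 : Fin 3) then if w = (1 : Fin 3) then s else t else OnePoint.infty at hp
    by_cases hv : v = 0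
    · refine Or.inl ⟨hv, ?_⟩
      rw [if_pos hv] at hp
      split_ifs at hp
      · exact Or.inl hp
      · exact Or.inr hp
    · rw [if_neg hv] at hp
      exact Or.inr ⟨hv, hp⟩
  · rintro (⟨rfl, rfl | rfl⟩ | ⟨h1, rfl⟩)
    · exact ⟨(1 : Fin 3), SimpleGraph.starGraph_adj.2 ⟨Fin.zero_ne_one, Or.inl rfl⟩, rfl⟩
    · exact ⟨(2 : Fin 3), SimpleGraph.starGraph_adj.2
        ⟨(by decide : (0 : Fin 3) ≠ 2), Or.inl rfl⟩, rfl⟩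
    · exact ⟨(0 : Fin 3), SimpleGraph.starGraph_adj.2 ⟨h1, Or.inr rfl⟩, by simp [threeLines, h1]⟩

/-- The components and positions of the marked points of the upper curve over the first boundary
stratum. -/
def upos₁ : A → Fin 3 × P1
  | A.zero => (0, OnePoint.infty)
  | A.one => (0, OnePoint.some 1)
  | A.inf => (1, OnePoint.some 1)
  | A.x => (1, OnePoint.some 0)

/-- The components and positions of the marked points of the lower curve in the first boundary
stratum. -/
def lpos₁ : B → Fin 2 × P1
  | B.inf => (0, OnePoint.infty)
  | B.y => (0, OnePoint.some 1)
  | B.z => (0, OnePoint.some 0)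
  | B.zero => (1, OnePoint.some 0)
  | B.one => (1, OnePoint.some 1)

/-- The components and positions of all preimages of the marked points over the first boundary
stratum. -/
def fpos₁ : Fib → Fin 3 × P1
  | Fib.zero => (0, OnePoint.infty)
  | Fib.one => (0, OnePoint.some 1)
  | Fib.one' => (0, OnePoint.some (-1))
  | Fib.crit => (0, OnePoint.some 0)
  | Fib.inf => (1, OnePoint.some 1)
  | Fib.x => (1, OnePoint.some 0)
  | Fib.inf' => (2, OnePoint.some 1)
  | Fib.x' => (2, OnePoint.some 0)

/-- The components of the cover over the first boundary stratum. -/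
def comp₁ : Fin 3 → Fin 2 := ![0, 1, 1]

/-- The maps of the cover over the first boundary stratum. -/
def map₁ : Fin 3 → RatMap := ![sqRat, idRat, idRat]

theorem upos₁_injective : Function.Injective upos₁ := by
  intro a a' h
  cases a <;> cases a' <;> simp_all [upos₁]

theorem lpos₁_injective : Function.Injective lpos₁ := by
  intro a a' h
  cases a <;> cases a' <;> simp_all [lpos₁]

theorem fpos₁_injective : Function.Injective fpos₁ := by
  intro a a' h
  cases a <;> cases a' <;> first | rfl | (exfalso; revert h; simp [fpos₁]; try norm_num)

/-- The upper curve over the first boundary stratum. -/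
def curveU₁ (c : ℂ) (hc : c ∈ TA) : RationalCurve :=
  threeLines (OnePoint.some c) (OnePoint.some (-c)) (by simpa using ne_neg_of_mem_TA hc)

/-- The lower curve in the first boundary stratum. -/
def curveL₁ (c : ℂ) : RationalCurve := twoLines (OnePoint.some (c ^ 2)) OnePoint.infty

theorem curveL₁_isNode_iff {c : ℂ} {r : P1} {v : Fin 2} : (curveL₁ c).IsNode (v, r) ↔
    (v = 0 ∧ r = OnePoint.some (c ^ 2)) ∨ (v = 1 ∧ r = OnePoint.infty) := twoLines_isNode_iff

theorem curveU₁_isNode_iff {c : ℂ} {hc : c ∈ TA} {r : P1} {v : Fin 3} :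
    (curveU₁ c hc).IsNode (v, r) ↔ (v = 0 ∧ (r = OnePoint.some c ∨ r = OnePoint.some (-c))) ∨
      (v ≠ 0 ∧ r = OnePoint.infty) := threeLines_isNode_iff

theorem curveU₁_adj {c : ℂ} {hc : c ∈ TA} {v w : Fin 3}
    (h : (curveU₁ c hc).graph.Adj v w) : v ≠ w ∧ (v = 0 ∨ w = 0) :=
  SimpleGraph.starGraph_adj.1 h

theorem preAdmissible₁ (c : ℂ) (hc : c ∈ TA) :
    (CurveMap.mk comp₁ map₁ : CurveMap (curveU₁ c hc) (curveL₁ c)).IsPreAdmissible 2 where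
  nonconst v := by
    change Fin 3 at v
    change 1 ≤ (map₁ v).degree
    fin_cases v <;> simp [map₁, sqRat_degree, idRat_degree]
  degree_eq u := by
    change Fin 2 at u
    change ∑ v ∈ Finset.univ.filter (fun v : Fin 3 => comp₁ v = u), (map₁ v).degree = 2
    rw [Finset.sum_filter, Fin.sum_univ_three]
    fin_cases u <;> simp [map₁, comp₁, sqRat_degree, idRat_degree]
  adj v w h := by
    change Fin 3 at v w
    obtain ⟨h1, h2⟩ := curveU₁_adj h
    change comp₁ v ≠ comp₁ w
    revert h1 h2
    fin_cases v <;> fin_cases w <;> simp [comp₁]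
  node v w h := by
    change Fin 3 at v w
    obtain ⟨h1, h2⟩ := curveU₁_adj h
    change (map₁ v).apply (if v = 0 then if w = 1 then OnePoint.some c else OnePoint.some (-c)
      else OnePoint.infty) = if comp₁ v = 0 then OnePoint.some (c ^ 2) else OnePoint.infty
    revert h1 h2
    fin_cases v <;> fin_cases w <;> simp [comp₁, map₁]
  isNode_of_isNode := by
    rintro ⟨v, t⟩ h
    change Fin 3 at v
    replace h := curveL₁_isNode_iff.1 h
    refine curveU₁_isNode_iff.2 ?_
    change (comp₁ v = 0 ∧ (map₁ v).apply t = OnePoint.some (c ^ 2)) ∨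
      (comp₁ v = 1 ∧ (map₁ v).apply t = OnePoint.infty) at h
    fin_cases v
    · have h' : sq t = OnePoint.some (c ^ 2) := by simpa [comp₁, map₁] using h
      rw [← sq_some, sq_eq_sq_iff] at h'
      simpa using h'
    · simpa [comp₁, map₁] using h
    · simpa [comp₁, map₁] using h
  localDegree_eq v w h := by
    change Fin 3 at v w
    obtain ⟨h1, h2⟩ := curveU₁_adj h
    change (map₁ v).localDegree (if v = 0 then if w = 1 then OnePoint.some c else OnePoint.some (-c)
      else OnePoint.infty) = (map₁ w).localDegree (if w = 0 then if v = 1 then OnePoint.some c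
      else OnePoint.some (-c) else OnePoint.infty)
    have e1 : sqRat.localDegree (OnePoint.some c) = 1 := sqRat_localDegree_one (by simpa using hc.1)
    have e2 : sqRat.localDegree (OnePoint.some (-c)) = 1 :=
      sqRat_localDegree_one (by simpa using hc.1)
    revert h1 h2
    fin_cases v <;> fin_cases w <;> simp [map₁, e1, e2, idRat_localDegree]

/-- The diagrams of the first boundary stratum. -/
def diagram₁ (c : ℂ) (hc : c ∈ TA) : Diagram where
  U :=
    { toRationalCurve := curveU₁ c hc
      mark := upos₁
      mark_inj := upos₁_injective
      mark_smooth := fun a => by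
        obtain ⟨h0, h1, h2⟩ := hc
        have h3 : (1 : ℂ) ≠ -c := fun h => h2 (by rw [h, neg_neg])
        refine fun hn => absurd (curveU₁_isNode_iff.1 hn) ?_
        cases a <;> simp [h1.symm, h3] }
  L :=
    { toRationalCurve := curveL₁ c
      mark := lpos₁
      mark_inj := lpos₁_injective
      mark_smooth := fun b => by
        obtain ⟨h0, h1⟩ := sq_ne_of_mem_TA hc
        refine fun hn => absurd (curveL₁_isNode_iff.1 hn) ?_
        cases b <;> simp [h0.symm, h1.symm] }
  F := ⟨comp₁, map₁⟩
  stable := by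
    intro v
    change Fin 2 at v
    fin_cases v
    · exact three_le_encard (Or.inr ⟨B.inf, rfl⟩) (Or.inr ⟨B.y, rfl⟩) (Or.inr ⟨B.z, rfl⟩)
        (by simp) (by simp) (by simp)
    · exact three_le_encard (c := OnePoint.infty) (Or.inr ⟨B.zero, rfl⟩) (Or.inr ⟨B.one, rfl⟩)
        (Or.inl (curveL₁_isNode_iff.2 (Or.inr ⟨rfl, rfl⟩))) (by simp) (by simp) (by simp)
  preAdmissible := preAdmissible₁ c hc
  comm a := by
    change (comp₁ (upos₁ a).1, (map₁ (upos₁ a).1).apply (upos₁ a).2) = lpos₁ (dyn a)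
    cases a <;> simp [comp₁, map₁, upos₁, lpos₁, dyn]
  branch := by
    rintro ⟨v, t⟩ - hd
    change Fin 3 at v
    change 2 ≤ (map₁ v).localDegree t at hd
    change (comp₁ v, (map₁ v).apply t) = lpos₁ B.inf ∨ (comp₁ v, (map₁ v).apply t) = lpos₁ B.z
    fin_cases v
    · change 2 ≤ sqRat.localDegree t at hd
      have : t = OnePoint.some 0 ∨ t = OnePoint.infty := by
        by_contra hcon
        rw [sqRat_localDegree_one hcon] at hd
        omega
      rcases this with rfl | rfl <;> simp [comp₁, map₁, lpos₁]
    · change 2 ≤ idRat.localDegree t at hd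
      rw [idRat_localDegree] at hd
      omega
    · change 2 ≤ idRat.localDegree t at hd
      rw [idRat_localDegree] at hd
      omega
  branch_inf := sqRat_localDegree_two (Or.inr rfl)
  branch_z := by
    refine ⟨((0 : Fin 3), OnePoint.some 0), ?_, sqRat_localDegree_two (Or.inl rfl)⟩
    change (comp₁ 0, (map₁ 0).apply (OnePoint.some 0)) = lpos₁ B.z
    simp [comp₁, map₁, lpos₁]

/-- The components and positions of the marked points of the upper curve over the second boundary
stratum. -/
def upos₂ (c : ℂ) : A → Fin 2 × P1
  | A.inf => (0, OnePoint.some 1)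
  | A.x => (0, OnePoint.some c)
  | A.zero => (1, OnePoint.infty)
  | A.one => (1, OnePoint.some 1)

/-- The components and positions of the marked points of the lower curve in the second boundary
stratum. -/
def lpos₂ (c : ℂ) : B → Fin 2 × P1
  | B.z => (0, OnePoint.some 0)
  | B.one => (0, OnePoint.some 1)
  | B.zero => (0, OnePoint.some (c ^ 2))
  | B.inf => (1, OnePoint.infty)
  | B.y => (1, OnePoint.some 1)

/-- The components and positions of all preimages of the marked points over the second boundary
stratum. -/
def fpos₂ (c : ℂ) : Fib → Fin 2 × P1
  | Fib.crit => (0, OnePoint.some 0)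
  | Fib.inf => (0, OnePoint.some 1)
  | Fib.inf' => (0, OnePoint.some (-1))
  | Fib.x => (0, OnePoint.some c)
  | Fib.x' => (0, OnePoint.some (-c))
  | Fib.zero => (1, OnePoint.infty)
  | Fib.one => (1, OnePoint.some 1)
  | Fib.one' => (1, OnePoint.some (-1))

theorem upos₂_injective {c : ℂ} (hc : c ∈ TA) : Function.Injective (upos₂ c) := by
  obtain ⟨h0, h1, h2⟩ := hc
  have h1' := h1.symm
  intro a a' h
  cases a <;> cases a' <;> first | rfl | (exfalso; revert h; simp [upos₂, h1, h1'])

theorem lpos₂_injective {c : ℂ} (hc : c ∈ TA) : Function.Injective (lpos₂ c) := by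
  obtain ⟨h1, h2⟩ := sq_ne_of_mem_TA hc
  have h1' := h1.symm
  have h2' := h2.symm
  have h0 := hc.1
  intro a a' h
  cases a <;> cases a' <;> first | rfl | (exfalso; revert h; simp [lpos₂, h0, h2, h1', h2'])

theorem fpos₂_injective {c : ℂ} (hc : c ∈ TA) : Function.Injective (fpos₂ c) := by
  have h3 := ne_neg_of_mem_TA hc
  obtain ⟨h0, h1, h2⟩ := hc
  have h4 : (1 : ℂ) ≠ -1 := by norm_num
  have h5 : -c ≠ 1 := fun h => h2 (by linear_combination -h)
  intro a a' h
  cases a <;> cases a' <;> first | rfl | (exfalso; revert h; simp [fpos₂, h0, h1, h2, h3, h4, h5,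
    h0.symm, h1.symm, h2.symm, h3.symm, h4.symm, h5.symm])

/-- The upper curve and the lower curve of the second boundary stratum. -/
def curve₂ : RationalCurve := twoLines OnePoint.infty (OnePoint.some 0)

theorem curve₂_isNode_iff {r : P1} {v : Fin 2} : curve₂.IsNode (v, r) ↔
    (v = 0 ∧ r = OnePoint.infty) ∨ (v = 1 ∧ r = OnePoint.some 0) := twoLines_isNode_iff

theorem preAdmissible₂ :
    (CurveMap.mk id (fun _ => sqRat) : CurveMap curve₂ curve₂).IsPreAdmissible 2 where
  nonconst v := by simp [sqRat_degree]
  degree_eq u := by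
    change Fin 2 at u
    change ∑ v ∈ Finset.univ.filter (fun v : Fin 2 => v = u), sqRat.degree = 2
    rw [Finset.sum_filter, Fin.sum_univ_two]
    fin_cases u <;> simp [sqRat_degree]
  adj v w h := h
  node v w h := by
    change Fin 2 at v w
    change sqRat.apply (if v = 0 then OnePoint.infty else OnePoint.some 0) =
      if v = 0 then OnePoint.infty else OnePoint.some 0
    fin_cases v <;> simp
  isNode_of_isNode := by
    rintro ⟨v, t⟩ h
    change Fin 2 at v
    replace h := curve₂_isNode_iff.1 h
    refine curve₂_isNode_iff.2 ?_
    change (v = 0 ∧ sqRat.apply t = OnePoint.infty) ∨ (v = 1 ∧ sqRat.apply t = OnePoint.some 0) at h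
    rwa [sqRat_apply, sq_eq_infty_iff, sq_eq_zero_iff] at h
  localDegree_eq v w h := by
    change Fin 2 at v w
    change sqRat.localDegree (if v = 0 then OnePoint.infty else OnePoint.some 0) =
      sqRat.localDegree (if w = 0 then OnePoint.infty else OnePoint.some 0)
    rw [sqRat_localDegree_two, sqRat_localDegree_two]
    · split_ifs <;> simp
    · split_ifs <;> simp

/-- The diagrams of the second boundary stratum. -/
def diagram₂ (c : ℂ) (hc : c ∈ TA) : Diagram where
  U :=
    { toRationalCurve := curve₂
      mark := upos₂ c
      mark_inj := upos₂_injective hc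
      mark_smooth := fun a => by
        refine fun hn => absurd (curve₂_isNode_iff.1 hn) ?_
        cases a <;> simp }
  L :=
    { toRationalCurve := curve₂
      mark := lpos₂ c
      mark_inj := lpos₂_injective hc
      mark_smooth := fun b => by
        refine fun hn => absurd (curve₂_isNode_iff.1 hn) ?_
        cases b <;> simp }
  F := ⟨id, fun _ => sqRat⟩
  stable := by
    intro v
    change Fin 2 at v
    fin_cases v
    · exact three_le_encard (c := OnePoint.infty) (Or.inr ⟨B.one, rfl⟩) (Or.inr ⟨B.z, rfl⟩)
        (Or.inl (curve₂_isNode_iff.2 (Or.inl ⟨rfl, rfl⟩))) (by simp) (by simp) (by simp)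
    · exact three_le_encard (c := OnePoint.some 0) (Or.inr ⟨B.inf, rfl⟩) (Or.inr ⟨B.y, rfl⟩)
        (Or.inl (curve₂_isNode_iff.2 (Or.inr ⟨rfl, rfl⟩))) (by simp) (by simp) (by simp)
  preAdmissible := preAdmissible₂
  comm a := by
    change ((upos₂ c a).1, sqRat.apply (upos₂ c a).2) = lpos₂ c (dyn a)
    cases a <;> simp [upos₂, lpos₂, dyn]
  branch := by
    rintro ⟨v, t⟩ hn hd
    change Fin 2 at v
    change 2 ≤ sqRat.localDegree t at hd
    change (v, sqRat.apply t) = lpos₂ c B.inf ∨ (v, sqRat.apply t) = lpos₂ c B.z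
    replace hn := fun h => hn (curve₂_isNode_iff.2 h)
    change ¬ ((v = 0 ∧ t = OnePoint.infty) ∨ (v = 1 ∧ t = OnePoint.some 0)) at hn
    have : t = OnePoint.some 0 ∨ t = OnePoint.infty := by
      by_contra hcon
      rw [sqRat_localDegree_one hcon] at hd
      omega
    fin_cases v <;> rcases this with rfl | rfl <;> simp [lpos₂] at hn ⊢
  branch_inf := sqRat_localDegree_two (Or.inr rfl)
  branch_z := by
    refine ⟨((0 : Fin 2), OnePoint.some 0), ?_, sqRat_localDegree_two (Or.inl rfl)⟩
    change ((0 : Fin 2), sqRat.apply (OnePoint.some 0)) = lpos₂ c B.z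
    simp [lpos₂]

/-! ### Cross ratios on the standard families -/

theorem exists_polyCrossRatio {T : Set ℂ} {p : Fin 4 → ℂ → P1} (hp : ∀ k, IsPolyOn T (p k))
    (h01 : ∀ c ∈ T, p 0 c ≠ p 1 c) (h02 : ∀ c ∈ T, p 0 c ≠ p 2 c)
    (h12 : ∀ c ∈ T, p 1 c ≠ p 2 c) : ∃ t : ℂ → P1, IsPolyOn T t ∧ ∀ c ∈ T, ∃ g : Mob,
      g • p 0 c = OnePoint.some 0 ∧ g • p 1 c = OnePoint.some 1 ∧ g • p 2 c = OnePoint.infty ∧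
      g • p 3 c = t c := by
  classical
  choose g hg using fun (c : ℂ) (hc : c ∈ T) =>
    exists_mob_zero_one_infty (h01 c hc) (h02 c hc) (h12 c hc)
  have key : ∀ c ∈ T, ∃ k : Mob, k • p 0 c = OnePoint.some 0 ∧ k • p 1 c = OnePoint.some 1 ∧
      k • p 2 c = OnePoint.infty ∧
      k • p 3 c = if h : c ∈ T then g c h • p 3 c else OnePoint.infty := by
    intro c hc
    refine ⟨g c hc, (hg c hc).1, (hg c hc).2.1, (hg c hc).2.2, ?_⟩
    rw [dif_pos hc]
  exact ⟨_, (hp 0).crossRatio (hp 1) (hp 2) (hp 3) key, key⟩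

/-- Coordinates of a family of curves with fixed combinatorial type, in which the special points have
polynomial coordinates; `code` records which special points coincide. -/
theorem exists_polyCoord {T : Set ℂ} {n k : ℕ} {Λ : Type} (code : Fin n → Λ → Fin k)
    (pos : Fin k → ℂ → P1) (hpos : ∀ i, IsPolyOn T (pos i))
    (hinj : ∀ c ∈ T, ∀ i j, pos i c = pos j c → i = j)
    (hcode : ∀ i j l : Λ, i ≠ j → i ≠ l → j ≠ l → ∃ v, code v i ≠ code v j ∧
      code v i ≠ code v l ∧ code v j ≠ code v l) :
    ∃ t : (Fin 4 ↪ Λ) → ℂ → P1, (∀ e, IsPolyOn T (t e)) ∧ ∀ e, ∀ c ∈ T, ∃ (v : Fin n) (g : Mob),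
      g • pos (code v (e 0)) c = OnePoint.some 0 ∧ g • pos (code v (e 1)) c = OnePoint.some 1 ∧
      g • pos (code v (e 2)) c = OnePoint.infty ∧ g • pos (code v (e 3)) c = t e c := by
  have key : ∀ e : Fin 4 ↪ Λ, ∃ t : ℂ → P1, IsPolyOn T t ∧ ∀ c ∈ T, ∃ (v : Fin n) (g : Mob),
      g • pos (code v (e 0)) c = OnePoint.some 0 ∧ g • pos (code v (e 1)) c = OnePoint.some 1 ∧
      g • pos (code v (e 2)) c = OnePoint.infty ∧ g • pos (code v (e 3)) c = t c := by
    intro e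
    obtain ⟨v, h01, h02, h12⟩ := hcode (e 0) (e 1) (e 2) (e.injective.ne (by decide))
      (e.injective.ne (by decide)) (e.injective.ne (by decide))
    obtain ⟨t, ht, h⟩ := exists_polyCrossRatio (T := T) (p := fun i => pos (code v (e i)))
      (fun i => hpos _) (fun c hc he => h01 (hinj c hc _ _ he))
      (fun c hc he => h02 (hinj c hc _ _ he)) (fun c hc he => h12 (hinj c hc _ _ he))
    exact ⟨t, ht, fun c hc => ⟨v, h c hc⟩⟩
  choose t ht using key
  exact ⟨t, fun e => (ht e).1, fun e => (ht e).2⟩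

/-! ### Projections on the standard curves -/

theorem twoLines_proj (s t r : P1) (v w : Fin 2) :
    (twoLines s t).proj v (w, r) = if w = v then r else if v = 0 then s else t := by
  split_ifs with h1 h2
  · subst h1
    exact (twoLines s t).proj_self w r
  · subst h2
    exact (twoLines s t).proj_of_adj (v := (0 : Fin 2)) (p := ((w : Fin 2), r)) (Ne.symm h1)
  · exact ((twoLines s t).proj_of_adj (v := (v : Fin 2)) (p := ((w : Fin 2), r)) (Ne.symm h1)).trans
      (if_neg h2)

theorem threeLines_proj (s t r : P1) (h : s ≠ t) (v w : Fin 3) :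
    (threeLines s t h).proj v (w, r) =
      if w = v then r else if v = 0 then if w = 1 then s else t else OnePoint.infty := by
  by_cases h1 : w = v
  · subst h1
    rw [if_pos rfl]
    exact (threeLines s t h).proj_self w r
  rw [if_neg h1]
  by_cases h2 : v = 0
  · subst h2
    exact (threeLines s t h).proj_of_adj (v := (0 : Fin 3)) (p := ((w : Fin 3), r))
      (SimpleGraph.starGraph_adj.2 ⟨Ne.symm h1, Or.inl rfl⟩)
  · rw [if_neg h2]
    refine ((threeLines s t h).proj_of_leaf (v := (v : Fin 3)) (w := (0 : Fin 3))
      (p := ((w : Fin 3), r)) h1 fun x hx => ?_).trans (if_neg h2)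
    exact (SimpleGraph.starGraph_adj.1 hx).2.resolve_left h2

/-- The positions of special points on the upper curves over the boundary strata. -/
def pos6 : Fin 6 → ℂ → P1 := ![fun _ => OnePoint.infty, fun _ => OnePoint.some 0,
  fun _ => OnePoint.some 1, fun _ => OnePoint.some (-1), fun c => OnePoint.some c,
  fun c => OnePoint.some (-c)]

/-- The positions of special points on the lower curves of the boundary strata. -/
def pos4 : Fin 4 → ℂ → P1 := ![fun _ => OnePoint.infty, fun _ => OnePoint.some 0,
  fun _ => OnePoint.some 1, fun c => OnePoint.some (c ^ 2)]

theorem pos6_isPolyOn (T : Set ℂ) (i : Fin 6) : IsPolyOn T (pos6 i) := by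
  fin_cases i
  · exact IsPolyOn.const T _
  · exact IsPolyOn.const T _
  · exact IsPolyOn.const T _
  · exact IsPolyOn.const T _
  · simpa [pos6] using IsPolyOn.some_eval T Polynomial.X
  · simpa [pos6] using IsPolyOn.some_eval T (-Polynomial.X)

theorem pos4_isPolyOn (T : Set ℂ) (i : Fin 4) : IsPolyOn T (pos4 i) := by
  fin_cases i
  · exact IsPolyOn.const T _
  · exact IsPolyOn.const T _
  · exact IsPolyOn.const T _
  · have := IsPolyOn.some_eval T (Polynomial.X ^ 2)
    simp only [Polynomial.eval_pow, Polynomial.eval_X] at this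
    exact this

theorem pos6_injective : ∀ c ∈ TA, ∀ i j, pos6 i c = pos6 j c → i = j := by
  intro c hc i j
  have h3 := ne_neg_of_mem_TA hc
  obtain ⟨h0, h1, h2⟩ := hc
  have h4 : (1 : ℂ) ≠ -1 := by norm_num
  have h5 : -c ≠ 1 := fun h => h2 (by rw [← h, neg_neg])
  fin_cases i <;> fin_cases j <;> 
    simp [pos6, h0, h1, h2, h3, h4, h5, h0.symm, h1.symm, h2.symm, h3.symm, h4.symm, h5.symm]

theorem pos4_injective : ∀ c ∈ TA, ∀ i j, pos4 i c = pos4 j c → i = j := by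
  intro c hc i j
  obtain ⟨h1, h2⟩ := sq_ne_of_mem_TA hc
  have h0 := hc.1
  fin_cases i <;> fin_cases j <;> simp [pos4, h0, h2, h1.symm, h2.symm]

/-- The projections of the preimages of the marked points to the components of the upper curve over
the first boundary stratum. -/
def codeU₁ : Fin 3 → Fib → Fin 6
  | 0, Fib.zero => 0
  | 0, Fib.one => 2
  | 0, Fib.one' => 3
  | 0, Fib.crit => 1
  | 0, Fib.inf => 4
  | 0, Fib.x => 4
  | 0, Fib.inf' => 5
  | 0, Fib.x' => 5
  | 1, Fib.inf => 2
  | 1, Fib.x => 1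
  | 2, Fib.inf' => 2
  | 2, Fib.x' => 1
  | _, _ => 0

/-- The projections of the marked points to the components of the lower curve in the first boundary
stratum. -/
def codeL₁ : Fin 2 → B → Fin 4
  | 0, B.inf => 0
  | 0, B.y => 2
  | 0, B.z => 1
  | 0, _ => 3
  | 1, B.zero => 1
  | 1, B.one => 2
  | 1, _ => 0

/-- The projections of the preimages of the marked points to the components of the upper curve over
the second boundary stratum. -/
def codeU₂ : Fin 2 → Fib → Fin 6
  | 0, Fib.crit => 1
  | 0, Fib.inf => 2
  | 0, Fib.inf' => 3
  | 0, Fib.x => 4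
  | 0, Fib.x' => 5
  | 0, _ => 0
  | 1, Fib.zero => 0
  | 1, Fib.one => 2
  | 1, Fib.one' => 3
  | 1, _ => 1

/-- The projections of the marked points to the components of the lower curve in the second boundary
stratum. -/
def codeL₂ : Fin 2 → B → Fin 4
  | 0, B.z => 1
  | 0, B.one => 2
  | 0, B.zero => 3
  | 0, _ => 0
  | 1, B.inf => 0
  | 1, B.y => 2
  | 1, _ => 1

theorem proj_fpos₁ (c : ℂ) (hc : c ∈ TA) (v : Fin 3) (l : Fib) :
    (curveU₁ c hc).proj v (fpos₁ l) = pos6 (codeU₁ v l) c := by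
  refine (threeLines_proj _ _ (fpos₁ l).2 _ v (fpos₁ l).1).trans ?_
  fin_cases v <;> cases l <;> simp [fpos₁, codeU₁, pos6]

theorem proj_lpos₁ (c : ℂ) (v : Fin 2) (b : B) :
    (curveL₁ c).proj v (lpos₁ b) = pos4 (codeL₁ v b) c := by
  refine (twoLines_proj _ _ (lpos₁ b).2 v (lpos₁ b).1).trans ?_
  fin_cases v <;> cases b <;> simp [lpos₁, codeL₁, pos4]

theorem proj_fpos₂ (c : ℂ) (v : Fin 2) (l : Fib) :
    curve₂.proj v (fpos₂ c l) = pos6 (codeU₂ v l) c := by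
  refine (twoLines_proj _ _ (fpos₂ c l).2 v (fpos₂ c l).1).trans ?_
  fin_cases v <;> cases l <;> simp [fpos₂, codeU₂, pos6]

theorem proj_lpos₂ (c : ℂ) (v : Fin 2) (b : B) :
    curve₂.proj v (lpos₂ c b) = pos4 (codeL₂ v b) c := by
  refine (twoLines_proj _ _ (lpos₂ c b).2 v (lpos₂ c b).1).trans ?_
  fin_cases v <;> cases b <;> simp [lpos₂, codeL₂, pos4]

/-- That every triple of labels is separated on some component is a finite check on the codes; the
coordinates are then cross ratios of points that are polynomial in c. -/
theorem exists_coord₁ : ∃ t : CoordIdx → ℂ → P1, (∀ i, IsPolyOn TA (t i)) ∧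
    ∀ c (hc : c ∈ TA), (diagram₁ c hc).IsCoord fun i => t i c := by
  obtain ⟨tL, hL, hL'⟩ := exists_polyCoord codeL₁ pos4 (pos4_isPolyOn TA) pos4_injective (by decide)
  obtain ⟨tU, hU, hU'⟩ := exists_polyCoord codeU₁ pos6 (pos6_isPolyOn TA) pos6_injective (by decide)
  refine ⟨Sum.elim tL tU, ?_, fun c hc => ⟨fpos₁, ⟨fpos₁_injective, ?_, ?_⟩, ?_, ?_⟩⟩
  · rintro (e | e)
    · exact hL e
    · exact hU e
  · intro a
    cases a <;> rfl
  · intro l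
    change (comp₁ (fpos₁ l).1, (map₁ (fpos₁ l).1).apply (fpos₁ l).2) = lpos₁ (fibMap l)
    cases l <;> simp [comp₁, map₁, fpos₁, lpos₁, fibMap]
  · intro e
    refine (RationalCurve.isCrossRatio_iff _).2 ?_
    obtain ⟨v, g, h⟩ := hL' e c hc
    refine ⟨v, g, ?_⟩
    simp only [← proj_lpos₁] at h
    exact h
  · intro e
    refine (RationalCurve.isCrossRatio_iff _).2 ?_
    obtain ⟨v, g, h⟩ := hU' e c hc
    refine ⟨v, g, ?_⟩
    simp only [← proj_fpos₁ c hc] at h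
    exact h

theorem exists_coord₂ : ∃ t : CoordIdx → ℂ → P1, (∀ i, IsPolyOn TA (t i)) ∧
    ∀ c (hc : c ∈ TA), (diagram₂ c hc).IsCoord fun i => t i c := by
  obtain ⟨tL, hL, hL'⟩ := exists_polyCoord codeL₂ pos4 (pos4_isPolyOn TA) pos4_injective (by decide)
  obtain ⟨tU, hU, hU'⟩ := exists_polyCoord codeU₂ pos6 (pos6_isPolyOn TA) pos6_injective (by decide)
  refine ⟨Sum.elim tL tU, ?_, fun c hc => ⟨fpos₂ c, ⟨fpos₂_injective hc, ?_, ?_⟩, ?_, ?_⟩⟩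
  · rintro (e | e)
    · exact hL e
    · exact hU e
  · intro a
    cases a <;> rfl
  · intro l
    change ((fpos₂ c l).1, sqRat.apply (fpos₂ c l).2) = lpos₂ c (fibMap l)
    cases l <;> simp [fpos₂, lpos₂, fibMap]
  · intro e
    refine (RationalCurve.isCrossRatio_iff _).2 ?_
    obtain ⟨v, g, h⟩ := hL' e c hc
    refine ⟨v, g, ?_⟩
    simp only [← proj_lpos₂] at h
    exact h
  · intro e
    refine (RationalCurve.isCrossRatio_iff _).2 ?_
    obtain ⟨v, g, h⟩ := hU' e c hc
    refine ⟨v, g, ?_⟩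
    simp only [← proj_fpos₂] at h
    exact h

theorem vp_eval (x : ℂ) : (3 * Polynomial.X ^ 2 - 3 * Polynomial.X + 1 : ℂ[X]).eval x = vp x := by
  simp [vp]

theorem vq_eval (x : ℂ) : (1 - Polynomial.X - Polynomial.X ^ 2 : ℂ[X]).eval x = vq x := by
  simp [vq]

theorem vr_eval (x : ℂ) : (-Polynomial.X ^ 2 + 3 * Polynomial.X - 1 : ℂ[X]).eval x = vr x := by
  simp [vr]

theorem fpos_isPolyOn (T : Set ℂ) (l : Fib) :
    IsPolyOn T fun x => fpos (vp x) (vq x) (vr x) l := by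
  have neg : ∀ a : ℂ[X], ∀ x, -(a.eval x) = (-a).eval x := by simp
  simp only [← vp_eval, ← vq_eval, ← vr_eval]
  cases l <;> simp only [fpos, neg] <;> first | exact IsPolyOn.const T _ | exact IsPolyOn.some_eval T _

theorem lpos_isPolyOn (T : Set ℂ) (b : B) :
    IsPolyOn T fun x => lpos (vp x) (vq x) (vr x) b := by
  have pow : ∀ a : ℂ[X], ∀ x, (a.eval x) ^ 2 = (a ^ 2).eval x := by simp
  simp only [← vp_eval, ← vq_eval, ← vr_eval]
  cases b <;> simp only [lpos, pow] <;> first | exact IsPolyOn.const T _ | exact IsPolyOn.some_eval T _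

theorem vDiagram_isFibreLabelling (p q r : ℂ) (h : Generic p q r) :
    (vDiagram p q r h).IsFibreLabelling
      (fun l => ((0 : Fin 1), (vH p q r h)⁻¹ • fpos p q r l)) := by
  refine ⟨fun l l' he => h.fpos_injective (smul_left_cancel _ (congrArg Prod.snd he)), ?_, ?_⟩
  · intro a
    change ((0 : Fin 1), (vH p q r h)⁻¹ • fpos p q r (fibOfA a)) = _
    rw [fpos_fibOfA]
    rfl
  · intro l
    refine Prod.ext rfl ?_
    change (vRat p q r h).apply ((vH p q r h)⁻¹ • fpos p q r l) = vG p q r h • lpos p q r (fibMap l)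
    rw [(vRat_sqForm p q r h).apply_eq, smul_inv_smul, sq_fpos]

theorem exists_coordV : ∃ t : CoordIdx → ℂ → P1, (∀ i, IsPolyOn TV (t i)) ∧
    ∀ x (hx : x ∈ TV), (vDiagram _ _ _ (generic_of_mem_TV hx)).IsCoord fun i => t i x := by
  have hLL : ∀ e : Fin 4 ↪ B, ∃ t : ℂ → P1, IsPolyOn TV t ∧ ∀ x ∈ TV, ∃ g : Mob,
      g • lpos (vp x) (vq x) (vr x) (e 0) = OnePoint.some 0 ∧
      g • lpos (vp x) (vq x) (vr x) (e 1) = OnePoint.some 1 ∧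
      g • lpos (vp x) (vq x) (vr x) (e 2) = OnePoint.infty ∧
      g • lpos (vp x) (vq x) (vr x) (e 3) = t x := by
    intro e
    have hne : ∀ {i j : Fin 4}, i ≠ j → ∀ x ∈ TV,
        lpos (vp x) (vq x) (vr x) (e i) ≠ lpos (vp x) (vq x) (vr x) (e j) := fun hij x hx he =>
      hij (e.injective ((generic_of_mem_TV hx).lpos_injective he))
    exact exists_polyCrossRatio (p := fun i x => lpos (vp x) (vq x) (vr x) (e i))
      (fun i => lpos_isPolyOn _ _) (hne (by decide)) (hne (by decide)) (hne (by decide))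
  have hUU : ∀ e : Fin 4 ↪ Fib, ∃ t : ℂ → P1, IsPolyOn TV t ∧ ∀ x ∈ TV, ∃ g : Mob,
      g • fpos (vp x) (vq x) (vr x) (e 0) = OnePoint.some 0 ∧
      g • fpos (vp x) (vq x) (vr x) (e 1) = OnePoint.some 1 ∧
      g • fpos (vp x) (vq x) (vr x) (e 2) = OnePoint.infty ∧
      g • fpos (vp x) (vq x) (vr x) (e 3) = t x := by
    intro e
    have hne : ∀ {i j : Fin 4}, i ≠ j → ∀ x ∈ TV,
        fpos (vp x) (vq x) (vr x) (e i) ≠ fpos (vp x) (vq x) (vr x) (e j) := fun hij x hx he =>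
      hij (e.injective ((generic_of_mem_TV hx).fpos_injective he))
    exact exists_polyCrossRatio (p := fun i x => fpos (vp x) (vq x) (vr x) (e i))
      (fun i => fpos_isPolyOn _ _) (hne (by decide)) (hne (by decide)) (hne (by decide))
  choose tL hL hL' using hLL
  choose tU hU hU' using hUU
  refine ⟨Sum.elim tL tU, ?_, fun x hx => ⟨_, vDiagram_isFibreLabelling _ _ _ _, ?_, ?_⟩⟩
  · rintro (e | e)
    · exact hL e
    · exact hU e
  · intro e
    refine (RationalCurve.isCrossRatio_iff _).2 ?_
    obtain ⟨g, h0, h1, h2, h3⟩ := hL' e x hx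
    have hp : ∀ b, line.proj (0 : Fin 1) ((0 : Fin 1), vG _ _ _ (generic_of_mem_TV hx) •
        lpos (vp x) (vq x) (vr x) b) = vG _ _ _ (generic_of_mem_TV hx) •
        lpos (vp x) (vq x) (vr x) b := fun b => line.proj_self _ _
    refine ⟨(0 : Fin 1), g * (vG _ _ _ (generic_of_mem_TV hx))⁻¹, ?_, ?_, ?_, ?_⟩
    · exact (congrArg _ (hp _)).trans (by rw [mul_smul, inv_smul_smul, h0])
    · exact (congrArg _ (hp _)).trans (by rw [mul_smul, inv_smul_smul, h1])
    · exact (congrArg _ (hp _)).trans (by rw [mul_smul, inv_smul_smul, h2])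
    · exact (congrArg _ (hp _)).trans (by rw [mul_smul, inv_smul_smul, h3]; rfl)
  · intro e
    refine (RationalCurve.isCrossRatio_iff _).2 ?_
    obtain ⟨g, h0, h1, h2, h3⟩ := hU' e x hx
    have hp : ∀ l, line.proj (0 : Fin 1) ((0 : Fin 1), (vH _ _ _ (generic_of_mem_TV hx))⁻¹ •
        fpos (vp x) (vq x) (vr x) l) = (vH _ _ _ (generic_of_mem_TV hx))⁻¹ •
        fpos (vp x) (vq x) (vr x) l := fun b => line.proj_self _ _
    refine ⟨(0 : Fin 1), g * vH _ _ _ (generic_of_mem_TV hx), ?_, ?_, ?_, ?_⟩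
    · exact (congrArg _ (hp _)).trans (by rw [mul_smul, smul_inv_smul, h0])
    · exact (congrArg _ (hp _)).trans (by rw [mul_smul, smul_inv_smul, h1])
    · exact (congrArg _ (hp _)).trans (by rw [mul_smul, smul_inv_smul, h2])
    · exact (congrArg _ (hp _)).trans (by rw [mul_smul, smul_inv_smul, h3]; rfl)

namespace MarkedCurve

variable {Λ : Type} {C : MarkedCurve Λ}

/-! ### Stable curves with two components -/

/-- A mark on another component projects to a node, whereas marks are smooth points. -/
theorem eq_of_mark_eq {i j : Λ} (h : C.proj (C.mark i).1 (C.mark i) = C.proj (C.mark i).1 (C.mark j)) :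
    i = j := by
  rw [C.proj_of_eq rfl] at h
  by_cases hj : (C.mark j).1 = (C.mark i).1
  · rw [C.proj_of_eq hj] at h
    exact C.mark_inj (Prod.ext hj.symm h)
  · have := C.isNode_proj hj
    rw [← h] at this
    exact absurd this (C.mark_smooth i)

theorem exists_three_of_encard {α β : Type*} {f : α → β} (h : 3 ≤ (Set.range f).encard) :
    ∃ a b c, f a ≠ f b ∧ f a ≠ f c ∧ f b ≠ f c := by
  obtain ⟨t, ht, h3⟩ := Set.exists_subset_encard_eq h
  obtain ⟨x, y, z, hxy, hxz, hyz, rfl⟩ := Set.encard_eq_three.1 h3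
  obtain ⟨a, rfl⟩ := ht (by simp : x ∈ _)
  obtain ⟨b, rfl⟩ := ht (by simp : y ∈ _)
  obtain ⟨c, rfl⟩ := ht (by simp : z ∈ _)
  exact ⟨a, b, c, hxy, hxz, hyz⟩

theorem IsStable.exists_three (hC : C.IsStable) (v : Fin C.n) : ∃ a b c,
    C.proj v (C.mark a) ≠ C.proj v (C.mark b) ∧ C.proj v (C.mark a) ≠ C.proj v (C.mark c) ∧
    C.proj v (C.mark b) ≠ C.proj v (C.mark c) :=
  exists_three_of_encard (hC.three_le_encard_proj v)

/-- Behind a node lie at least two marks: the neighbouring component separates three marks, and at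
most one of these projects there to the node leading back. -/
theorem IsStable.exists_ne_of_ne (hC : C.IsStable) {v : Fin C.n} {l : Λ} (h : (C.mark l).1 ≠ v) :
    ∃ l', l' ≠ l ∧ C.proj v (C.mark l') = C.proj v (C.mark l) := by
  have hadj := Tree.step_adj C.isTree h
  set u := Tree.step C.isTree v (C.mark l).1 with hu
  have key : ∀ l', C.proj u (C.mark l') ≠ C.node u v → C.proj v (C.mark l') = C.node v u := by
    intro l' hl'
    rcases C.proj_eq_or_proj_eq hadj.ne OnePoint.infty OnePoint.infty (C.mark l') with h1 | h1
    · rw [h1]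
      exact C.proj_of_adj (p := (u, OnePoint.infty)) hadj
    · exact absurd (h1.trans (C.proj_of_adj (p := (v, OnePoint.infty)) hadj.symm)) hl'
  have hl : C.proj v (C.mark l) = C.node v u := C.proj_of_ne h
  have key2 : ∃ a b, C.proj u (C.mark a) ≠ C.proj u (C.mark b) ∧
      C.proj u (C.mark a) ≠ C.node u v ∧ C.proj u (C.mark b) ≠ C.node u v := by
    obtain ⟨a, b, c, hab, hac, hbc⟩ := hC.exists_three u
    by_cases h1 : C.proj u (C.mark a) = C.node u v
    · exact ⟨b, c, hbc, h1 ▸ hab.symm, h1 ▸ hac.symm⟩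
    · by_cases h2 : C.proj u (C.mark b) = C.node u v
      · exact ⟨a, c, hac, h1, h2 ▸ hbc.symm⟩
      · exact ⟨a, b, hab, h1, h2⟩
  obtain ⟨a, b, hab, ha, hb⟩ := key2
  by_cases hal : a = l
  · subst hal
    exact ⟨b, fun e => hab (by rw [e]), (key b hb).trans hl.symm⟩
  · exact ⟨a, hal, (key a ha).trans hl.symm⟩

theorem IsStable.mark_mem (hC : C.IsStable) {v : Fin C.n} {l : Λ}
    (h : ∀ l', l' ≠ l → C.proj v (C.mark l') ≠ C.proj v (C.mark l)) : (C.mark l).1 = v := by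
  by_contra hcon
  obtain ⟨l', h1, h2⟩ := hC.exists_ne_of_ne hcon
  exact h l' h1 h2

/-- A mark that shares its projection with no other lies on `v`. If all marks lie on `v`, any other
component sees them at a single point, against stability. -/
theorem IsStable.eq_of_injective (hC : C.IsStable) {v : Fin C.n}
    (h : Function.Injective fun l => C.proj v (C.mark l)) (w : Fin C.n) : w = v := by
  have hm : ∀ l, (C.mark l).1 = v := fun l => hC.mark_mem fun l' h1 h2 => h1 (h h2)
  by_contra hw
  obtain ⟨a, b, c, hab, -, -⟩ := hC.exists_three w
  have : ∀ l, C.proj w (C.mark l) = C.proj w (v, OnePoint.infty) := by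
    intro l
    have := C.proj_const (v := w) (u := v) (Ne.symm hw) (C.mark l).2 OnePoint.infty
    rwa [← hm l] at this ⊢
  exact hab ((this a).trans (this b).symm)

/-- The curve `C` has exactly two components `v` and `u`, and the component `u` carries exactly the
points marked `i` and `j`. -/
structure Split (C : MarkedCurve Λ) (v u : Fin C.n) (i j : Λ) : Prop where
  ne : u ≠ v
  cover : ∀ w, w = v ∨ w = u
  mem : ∀ l, l = i ∨ l = j → (C.mark l).1 = u
  not_mem : ∀ l, ¬ (l = i ∨ l = j) → (C.mark l).1 = v

/-- All marks other than i, j lie on `v`. Another component can see only i, j and the node towards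
`v`, and stability makes these three different; by `component_unique` there is only one such
component. -/
theorem IsStable.exists_split (hC : C.IsStable) {v : Fin C.n} {i j : Λ} (hij : i ≠ j)
    (h : C.proj v (C.mark i) = C.proj v (C.mark j))
    (hinj : ∀ a b, C.proj v (C.mark a) = C.proj v (C.mark b) → a = b ∨
      ((a = i ∨ a = j) ∧ (b = i ∨ b = j))) : ∃ u, C.Split v u i j := by
  have hmem : ∀ l, ¬ (l = i ∨ l = j) → (C.mark l).1 = v := by
    intro l hl
    refine hC.mark_mem fun l' h1 h2 => ?_
    rcases hinj l' l h2 with h3 | h3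
    · exact h1 h3
    · exact hl h3.2
  have hi : (C.mark i).1 ≠ v := by
    rintro rfl
    exact hij (eq_of_mark_eq h)
  have key : ∀ u, u ≠ v → C.proj u (C.mark i) ≠ C.proj u (C.mark j) ∧
      C.proj u (C.mark i) ≠ C.proj u (v, OnePoint.infty) ∧
      C.proj u (C.mark j) ≠ C.proj u (v, OnePoint.infty) := by
    intro u hu
    have hr : ∀ l, C.proj u (C.mark l) = C.proj u (C.mark i) ∨
        C.proj u (C.mark l) = C.proj u (C.mark j) ∨
        C.proj u (C.mark l) = C.proj u (v, OnePoint.infty) := by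
      intro l
      by_cases hl : l = i ∨ l = j
      · rcases hl with rfl | rfl
        · exact Or.inl rfl
        · exact Or.inr (Or.inl rfl)
      · have := C.proj_const (v := u) (u := v) (Ne.symm hu) (C.mark l).2 OnePoint.infty
        rw [← hmem l hl] at this ⊢
        exact Or.inr (Or.inr this)
    obtain ⟨a, b, c, hab, hac, hbc⟩ := hC.exists_three u
    have ha := hr a
    have hb := hr b
    have hc := hr c
    refine ⟨fun e => ?_, fun e => ?_, fun e => ?_⟩ <;> rw [e] at ha hb hc <;> grind
  refine ⟨(C.mark i).1, hi, fun w => ?_, ?_, hmem⟩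
  · by_cases hw : w = v
    · exact Or.inl hw
    · obtain ⟨h1, h2, h3⟩ := key w hw
      obtain ⟨h1', h2', h3'⟩ := key _ hi
      exact Or.inr (C.component_unique h1 h2 h3 h1' h2' h3')
  · rintro l (rfl | rfl)
    · rfl
    · obtain ⟨h1, h2, h3⟩ := key _ hi
      refine hC.mark_mem fun l' hl' e => ?_
      by_cases hl : l' = i
      · subst hl
        exact h1 e
      · have := C.proj_const (v := (C.mark i).1) (u := v) (Ne.symm hi) (C.mark l').2 OnePoint.infty
        have hv := hmem l' (by tauto)
        apply h3
        rw [← e, ← this, ← hv]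

namespace Split

variable {v u : Fin C.n} {i j : Λ}

theorem swap (h : C.Split v u i j) : C.Split v u j i :=
  ⟨h.ne, h.cover, fun l hl => h.mem l hl.symm, fun l hl => h.not_mem l fun h' => hl h'.symm⟩

theorem adj (h : C.Split v u i j) : C.graph.Adj v u := by
  have h1 := Tree.step_adj C.isTree h.ne
  rcases h.cover (Tree.step C.isTree v u) with h2 | h2
  · exact absurd h2 h1.ne'
  · rwa [h2] at h1

theorem eq_of_isNode (h : C.Split v u i j) {t : P1} (ht : C.IsNode (v, t)) : t = C.node v u := by
  obtain ⟨w, h1, h2⟩ := ht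
  rcases h.cover w with rfl | rfl
  · exact absurd rfl h1.ne
  · exact h2

theorem eq_of_isNode' (h : C.Split v u i j) {t : P1} (ht : C.IsNode (u, t)) : t = C.node u v := by
  obtain ⟨w, h1, h2⟩ := ht
  rcases h.cover w with rfl | rfl
  · exact h2
  · exact absurd rfl h1.ne

theorem proj_mem (h : C.Split v u i j) {l : Λ} (hl : l = i ∨ l = j) :
    C.proj v (C.mark l) = C.node v u := by
  have := C.proj_of_adj (v := v) (p := C.mark l)
  rw [h.mem l hl] at this
  exact this h.adj

theorem proj_not_mem (h : C.Split v u i j) {l : Λ} (hl : ¬ (l = i ∨ l = j)) :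
    C.proj u (C.mark l) = C.node u v := by
  have := C.proj_of_adj (v := u) (p := C.mark l)
  rw [h.not_mem l hl] at this
  exact this h.adj.symm

theorem proj_eq (h : C.Split v u i j) {l l' : Λ} (he : C.proj v (C.mark l) = C.proj v (C.mark l')) :
    l = l' ∨ ((l = i ∨ l = j) ∧ (l' = i ∨ l' = j)) := by
  by_cases h1 : l = i ∨ l = j
  · by_cases h2 : l' = i ∨ l' = j
    · exact Or.inr ⟨h1, h2⟩
    · have := h.not_mem l' h2
      subst this
      exact Or.inl (eq_of_mark_eq he.symm).symm
  · have := h.not_mem l h1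
    subst this
    exact Or.inl (eq_of_mark_eq he)

theorem proj_eq' (h : C.Split v u i j) {l l' : Λ}
    (he : C.proj u (C.mark l) = C.proj u (C.mark l')) :
    l = l' ∨ (¬ (l = i ∨ l = j) ∧ ¬ (l' = i ∨ l' = j)) := by
  by_cases h1 : l = i ∨ l = j
  · have := h.mem l h1
    subst this
    exact Or.inl (eq_of_mark_eq he)
  · by_cases h2 : l' = i ∨ l' = j
    · have := h.mem l' h2
      subst this
      exact Or.inl (eq_of_mark_eq he.symm).symm
    · exact Or.inr ⟨h1, h2⟩

theorem n_eq (h : C.Split v u i j) : C.n = 2 := by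
  have : (Finset.univ : Finset (Fin C.n)) = {v, u} := by
    ext w
    simpa using h.cover w
  have h2 := congrArg Finset.card this
  rwa [Finset.card_univ, Fintype.card_fin, Finset.card_pair h.ne.symm] at h2

end Split

/-- Of the five labels only one lies outside the four separated ones, so it can coincide with at
most one other label. -/
theorem IsStable.injective_or_split {C : MarkedCurve B} (hC : C.IsStable) {v : Fin C.n}
    {e : Fin 4 ↪ B} (he : Function.Injective fun k => C.proj v (C.mark (e k))) :
    (Function.Injective fun b => C.proj v (C.mark b)) ∨
      ∃ u i j, i ≠ j ∧ C.Split v u i j := by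
  classical
  by_cases h : Function.Injective fun b => C.proj v (C.mark b)
  · exact Or.inl h
  right
  simp only [Function.Injective, not_forall] at h
  obtain ⟨i, j, hij, hne⟩ := h
  have hcard : (Finset.univ.map e).card = 4 := by simp
  have hinj : ∀ a ∈ Finset.univ.map e, ∀ b ∈ Finset.univ.map e,
      C.proj v (C.mark a) = C.proj v (C.mark b) → a = b := by
    intro a ha b hb hab
    obtain ⟨k, -, rfl⟩ := Finset.mem_map.1 ha
    obtain ⟨k', -, rfl⟩ := Finset.mem_map.1 hb
    rw [he hab]
  have hout : ∀ a b, a ∉ Finset.univ.map e → b ∉ Finset.univ.map e → a = b := by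
    intro a b ha hb
    by_contra hab
    have h1 : (insert a (insert b (Finset.univ.map e))).card = 6 := by
      rw [Finset.card_insert_of_notMem (by simp [hab]; simpa using ha),
        Finset.card_insert_of_notMem hb, hcard]
    have h2 := Finset.card_le_univ (insert a (insert b (Finset.univ.map e)))
    rw [h1] at h2
    exact absurd h2 (by decide)
  have main : ∀ i j, i ≠ j → C.proj v (C.mark i) = C.proj v (C.mark j) →
      i ∉ Finset.univ.map e → ∃ u i j, i ≠ j ∧ C.Split v u i j := by
    intro i j hne hij hi
    obtain ⟨u, hu⟩ := hC.exists_split hne hij (by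
      intro a b hab
      by_cases hai : a = i
      · subst hai
        by_cases hbe : b ∈ Finset.univ.map e
        · have hj : j ∈ Finset.univ.map e := by
            by_contra hj
            exact hne (hout _ _ hi hj)
          exact Or.inr ⟨Or.inl rfl, Or.inr (hinj b hbe j hj (hab.symm.trans hij))⟩
        · exact Or.inl (hout _ _ hi hbe)
      · have hae : a ∈ Finset.univ.map e := by
          by_contra hae
          exact hai (hout _ _ hae hi)
        by_cases hbe : b ∈ Finset.univ.map e
        · exact Or.inl (hinj a hae b hbe hab)
        · have hbi : b = i := hout _ _ hbe hi
          subst hbi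
          have hj : j ∈ Finset.univ.map e := by
            by_contra hj
            exact hne (hout _ _ hi hj)
          exact Or.inr ⟨Or.inr (hinj a hae j hj (hab.trans hij)), Or.inl rfl⟩)
    exact ⟨u, i, j, hne, hu⟩
  by_cases hi : i ∈ Finset.univ.map e
  · by_cases hj : j ∈ Finset.univ.map e
    · exact absurd (hinj i hi j hj hij) hne
    · exact main j i (Ne.symm hne) hij.symm hj
  · exact main i j hne hij hi

end MarkedCurve

@[simp] theorem iota_zero : iota A.zero = B.zero := rfl

@[simp] theorem iota_one : iota A.one = B.one := rfl

@[simp] theorem iota_inf : iota A.inf = B.inf := rfl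

@[simp] theorem iota_x : iota A.x = B.y := rfl

namespace Diagram

variable {D : Diagram}

/-! ### Diagrams with matching upper and lower curves -/

/-- The component `w` of the upper curve and the component `v` of the lower curve agree up to the
Möbius transformation `g`, with respect to the marked points identified by `iota`, and the marked
points have at least three different projections. -/
structure Match (D : Diagram) (w : Fin D.U.n) (v : Fin D.L.n) (g : Mob) : Prop where
  smul_proj : ∀ a, g • D.U.proj w (D.U.mark a) = D.L.proj v (D.L.mark (iota a))
  exists_three : ∃ a b c,
    D.L.proj v (D.L.mark (iota a)) ≠ D.L.proj v (D.L.mark (iota b)) ∧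
    D.L.proj v (D.L.mark (iota a)) ≠ D.L.proj v (D.L.mark (iota c)) ∧
    D.L.proj v (D.L.mark (iota b)) ≠ D.L.proj v (D.L.mark (iota c))

theorem Match.proj_eq_iff {w : Fin D.U.n} {v : Fin D.L.n} {g : Mob} (h : D.Match w v g) {a b : A} :
    D.L.proj v (D.L.mark (iota a)) = D.L.proj v (D.L.mark (iota b)) ↔
      D.U.proj w (D.U.mark a) = D.U.proj w (D.U.mark b) := by
  rw [← h.smul_proj, ← h.smul_proj, smul_left_cancel_iff]

/-- Any component of the common stabilization comes from a component of each curve, and both see the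
marks as it does. -/
theorem exists_match_of_isStabilization {S : MarkedCurve A} (hU : D.U.IsStabilization S)
    (hL : (D.L.restrict iota).IsStabilization S) : ∃ w v g, D.Match w v g := by
  obtain ⟨s⟩ := S.isTree.1.nonempty
  obtain ⟨w, g, hg⟩ := hU.exists_proj s
  obtain ⟨v, k, hk⟩ := hL.exists_proj s
  refine ⟨w, v, k⁻¹ * g, fun a => ?_, ?_⟩
  · rw [mul_smul, ← hg, hk, inv_smul_smul]
    rfl
  · obtain ⟨a, b, c, hab, hac, hbc⟩ := hU.1.exists_three s
    rw [hk, hk, Ne, smul_left_cancel_iff] at hab hac hbc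
    exact ⟨a, b, c, hab, hac, hbc⟩

/-- The cross ratio of the points marked `0, 1, ∞, y` on the lower curve. -/
def idxL : Fin 4 ↪ B := ⟨![B.zero, B.one, B.inf, B.y], by decide⟩

/-- The cross ratio of the points marked `0, 1, ∞, x` on the upper curve. -/
def idxU : Fin 4 ↪ Fib := ⟨![Fib.zero, Fib.one, Fib.inf, Fib.x], by decide⟩

/-- Equality of two cross ratios gives the same data as a common stabilization, on the components
where they are computed. Finiteness and local closedness can thus share one classification. -/
theorem IsCoord.exists_match {t : CoordIdx → P1} (ht : D.IsCoord t)
    (h : t (Sum.inr idxU) = t (Sum.inl idxL)) : ∃ w v g, D.Match w v g := by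
  obtain ⟨q, ⟨-, hq, -⟩, hL, hU⟩ := ht
  obtain ⟨v, k, k0, k1, k2, k3⟩ := D.L.isCrossRatio_iff.1 (hL idxL)
  obtain ⟨w, g, g0, g1, g2, g3⟩ := D.U.isCrossRatio_iff.1 (hU idxU)
  refine ⟨w, v, k⁻¹ * g, fun a => ?_, A.zero, A.one, A.inf, ?_, ?_, ?_⟩
  · rw [mul_smul, inv_smul_eq_iff, ← hq]
    cases a
    · exact g0.trans k0.symm
    · exact g1.trans k1.symm
    · exact g2.trans k2.symm
    · exact (g3.trans h).trans k3.symm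
  · exact RationalCurve.ne_of_smul k0 k1 (by simp)
  · exact RationalCurve.ne_of_smul k0 k2 (by simp)
  · exact RationalCurve.ne_of_smul k1 k2 (by simp)

/-! ### Double covers in normal form -/

/-- If the point marked `∞` and all critical values lie on a component, the positions of the marked
points can be described by three numbers. -/
theorem exists_normalForm {v : Fin D.L.n} (hinf : (D.L.mark B.inf).1 = v)
    (hnode : ∀ t, D.L.IsNode (v, t) → t = D.L.proj v (D.L.mark B.z))
    (hne : ∀ b, b ≠ B.inf → D.L.proj v (D.L.mark b) ≠ D.L.proj v (D.L.mark B.inf)) :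
    ∃ (w : Fin D.U.n) (G H : Mob) (p q r : ℂ), D.deg w = 2 ∧ D.F.comp w = v ∧
      SqForm (D.F.map w) G H ∧ (∀ a, H • D.U.proj w (D.U.mark a) = upos p q r a) ∧
      ∀ b, D.L.proj v (D.L.mark b) = G • lpos p q r b := by
  subst hinf
  set v := (D.L.mark B.inf).1 with hv
  set w := (D.U.mark A.zero).1 with hw
  have hcomp : D.F.comp w = v := D.comp_mark A.zero
  have hdeg : D.deg w = 2 := D.deg_mark_zero
  have hcrit : ∀ c, (D.F.map w).localDegree c = 2 →
      (D.F.map w).apply c = D.L.proj v (D.L.mark B.inf) ∨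
      (D.F.map w).apply c = D.L.proj v (D.L.mark B.z) := by
    intro c hc
    rcases D.crit_value hc with h | h | h
    · rw [hcomp] at h
      exact Or.inr (hnode _ h)
    · left
      rw [D.L.proj_of_eq rfl, ← h]
    · right
      rw [hcomp] at h
      rw [← h, D.L.proj_self]
  -- Critical values on `v` can only be ∞ or the projection of z, as a node on `v` must lie in the
  -- direction of z. The cover has two different critical values, so both occur.
  have hz : ∃ c, (D.F.map w).localDegree c = 2 ∧
      (D.F.map w).apply c = D.L.proj v (D.L.mark B.z) := by
    obtain ⟨c₁, c₂, -, h1, h2, h12, -⟩ := RatMap.exists_crit hdeg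
    rcases hcrit c₁ h1 with h | h
    · rcases hcrit c₂ h2 with h' | h'
      · exact absurd (h.trans h'.symm) h12
      · exact ⟨c₂, h2, h'⟩
    · exact ⟨c₁, h1, h⟩
  obtain ⟨c, hc, hcz⟩ := hz
  have h0 : (D.F.map w).apply (D.U.mark A.zero).2 = D.L.proj v (D.L.mark B.inf) := by
    rw [D.L.proj_of_eq rfl]
    exact D.apply_mark A.zero
  obtain ⟨G, H, hF, hH1, hH2⟩ := RatMap.exists_sqForm_infty_zero hdeg D.branch_inf hc (by
    intro e
    apply hne B.z (by simp)
    rw [← hcz, ← h0, e])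
  have hmap : ∀ a, G • sq (H • D.U.proj w (D.U.mark a)) = D.L.proj v (D.L.mark (dyn a)) := by
    intro a
    rw [← hF.apply_eq, D.apply_proj hdeg, hcomp, D.comm]
  have hG : D.L.proj v (D.L.mark B.inf) = G • OnePoint.infty := by
    rw [← h0, hF.apply_eq, hH1, sq_infty]
  have hfin : ∀ a, a ≠ A.zero → ∃ s : ℂ, H • D.U.proj w (D.U.mark a) = OnePoint.some s := by
    intro a ha
    cases he : H • D.U.proj w (D.U.mark a) using OnePoint.rec with
    | infty =>
      have := hmap a
      rw [he, sq_infty, ← hG] at this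
      exact absurd this.symm (hne (dyn a) (by cases a <;> simp_all [dyn]))
    | coe s => exact ⟨s, rfl⟩
  obtain ⟨p, hp⟩ := hfin A.one (by simp)
  obtain ⟨q, hq⟩ := hfin A.inf (by simp)
  obtain ⟨r, hr⟩ := hfin A.x (by simp)
  have hup : ∀ a, H • D.U.proj w (D.U.mark a) = upos p q r a := by
    intro a
    cases a
    · rw [D.U.proj_of_eq rfl]
      exact hH1
    · exact hp
    · exact hq
    · exact hr
  refine ⟨w, G, H, p, q, r, hdeg, hcomp, hF, hup, fun b => ?_⟩
  have key : ∀ a, D.L.proj v (D.L.mark (dyn a)) = G • lpos p q r (dyn a) := fun a => by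
    rw [← hmap, hup, sq_upos]
  cases b
  · exact key A.x
  · exact key A.inf
  · exact key A.zero
  · exact key A.one
  · rw [← hcz, hF.apply_eq, hH2]
    simp [lpos]

/-- The cross ratios of (∞, p, q, r) and of (r², q², ∞, p²) agree; after clearing denominators and
dividing by q − r this is the conic. -/
theorem conic_of_smul {p q r : ℂ} {g : Mob} (h : ∀ a, g • upos p q r a = lpos p q r (iota a))
    (hq : q ^ 2 ≠ r ^ 2) : p ^ 2 + p * q + p * r - q * r - q ^ 2 - r ^ 2 = 0 := by
  obtain ⟨k, k0, k1, k2⟩ := exists_mob_zero_one_infty (p₀ := lpos p q r (iota A.zero))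
    (p₁ := lpos p q r (iota A.one)) (p₂ := lpos p q r (iota A.inf))
    (by simpa [lpos] using hq.symm) (by simp [lpos]) (by simp [lpos])
  have h1 := isHomCoord_crossRatio (isHomCoord_some (r ^ 2)) (isHomCoord_some (q ^ 2))
    isHomCoord_infty (isHomCoord_some (p ^ 2)) k0 k1 k2
  rw [← h, ← mul_smul] at k0 k1 k2
  have h2 := isHomCoord_crossRatio isHomCoord_infty (isHomCoord_some p) (isHomCoord_some q)
    (isHomCoord_some r) k0 k1 k2
  have h3 : k • (OnePoint.some (p ^ 2) : P1) = (k * g) • (OnePoint.some r : P1) := by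
    rw [mul_smul]
    exact congrArg _ (h A.x).symm
  have h4 := (h1.eq_iff h2).1 h3
  have h5 : q - r ≠ 0 := sub_ne_zero.2 (ne_of_sq_ne hq).1
  refine (mul_eq_zero.1 ?_).resolve_left h5
  linear_combination -h4

theorem Match.eq_of_injective {w w' : Fin D.U.n} {v v' : Fin D.L.n} {g : Mob} (h : D.Match w v g)
    (hv : Function.Injective fun a => D.L.proj v' (D.L.mark (iota a)))
    (hw : Function.Injective fun a => D.U.proj w' (D.U.mark a)) : v = v' ∧ w = w' := by
  obtain ⟨a, b, c, hab, hac, hbc⟩ := h.exists_three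
  have hab' : a ≠ b := fun e => hab (by rw [e])
  have hac' : a ≠ c := fun e => hac (by rw [e])
  have hbc' : b ≠ c := fun e => hbc (by rw [e])
  refine ⟨D.L.component_unique hab hac hbc (hv.ne hab') (hv.ne hac') (hv.ne hbc'), ?_⟩
  rw [Ne, h.proj_eq_iff] at hab hac hbc
  exact D.U.component_unique hab hac hbc (hw.ne hab') (hw.ne hac') (hw.ne hbc')

theorem Match.conic {w w' : Fin D.U.n} {v v' : Fin D.L.n} {g G H : Mob} {p q r : ℂ}
    (h : D.Match w v g)
    (hv : Function.Injective fun a => D.L.proj v' (D.L.mark (iota a)))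
    (hU : ∀ a, H • D.U.proj w' (D.U.mark a) = upos p q r a)
    (hL : ∀ b, D.L.proj v' (D.L.mark b) = G • lpos p q r b) :
    p ^ 2 + p * q + p * r - q * r - q ^ 2 - r ^ 2 = 0 ∧
      p ^ 2 ≠ q ^ 2 ∧ p ^ 2 ≠ r ^ 2 ∧ q ^ 2 ≠ r ^ 2 := by
  have hl : Function.Injective fun a => lpos p q r (iota a) := fun a b hab => hv (by
    simp only [hL]
    exact congrArg _ hab)
  have hpq : p ^ 2 ≠ q ^ 2 := fun e =>
    absurd (hl (a₁ := A.one) (a₂ := A.x) (by simp [lpos, e])) (by simp)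
  have hpr : p ^ 2 ≠ r ^ 2 := fun e =>
    absurd (hl (a₁ := A.zero) (a₂ := A.x) (by simp [lpos, e])) (by simp)
  have hqr : q ^ 2 ≠ r ^ 2 := fun e =>
    absurd (hl (a₁ := A.zero) (a₂ := A.one) (by simp [lpos, e])) (by simp)
  refine ⟨?_, hpq, hpr, hqr⟩
  have hw : Function.Injective fun a => D.U.proj w' (D.U.mark a) := by
    intro a b hab
    have e : upos p q r a = upos p q r b := by
      rw [← hU, ← hU]
      exact congrArg _ hab
    have n1 := (ne_of_sq_ne hpq).1
    have n2 := (ne_of_sq_ne hpr).1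
    have n3 := (ne_of_sq_ne hqr).1
    have n1' := n1.symm
    have n2' := n2.symm
    have n3' := n3.symm
    cases a <;> cases b <;> simp_all [upos]
  obtain ⟨rfl, rfl⟩ := h.eq_of_injective hv hw
  refine conic_of_smul (g := G⁻¹ * g * H⁻¹) (fun a => ?_) hqr
  rw [mul_smul, mul_smul, ← hU, inv_smul_smul, h.smul_proj, hL, inv_smul_smul]

/-! ### The strata with two components -/

/-- For each of the four other partitions {i, j} | rest with z in the rest, two labels of `A` on the
same side under ι always end on different sides under f. -/
theorem decide_pair : ∀ (i j : B) (a a' : A), i ≠ j → i ≠ B.z → j ≠ B.z → a ≠ a' →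
    ((iota a = i ∨ iota a = j) ↔ (iota a' = i ∨ iota a' = j)) →
    ((dyn a = i ∨ dyn a = j) ↔ (dyn a' = i ∨ dyn a' = j)) →
    (i = B.zero ∧ j = B.one) ∨ (i = B.one ∧ j = B.zero) ∨ (i = B.inf ∧ j = B.y) ∨
      (i = B.y ∧ j = B.inf) := by
  intro i j a a'
  cases i <;> cases j <;> cases a <;> cases a' <;> simp [dyn]

theorem exists_pair : ∀ (i j : B), i ≠ j → i ≠ B.z → j ≠ B.z →
    (∃ a a', a ≠ a' ∧ (iota a = i ∨ iota a = j) ∧ (iota a' = i ∨ iota a' = j)) ∧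
    (∃ a a', a ≠ a' ∧ ¬ (iota a = i ∨ iota a = j) ∧ ¬ (iota a' = i ∨ iota a' = j)) ∧
    ∃ a a', a ≠ a' ∧ ¬ (dyn a = i ∨ dyn a = j) ∧ ¬ (dyn a' = i ∨ dyn a' = j) := by
  decide

theorem dyn_injective : Function.Injective dyn := by decide

variable {v u : Fin D.L.n} {i j : B}

/-- On a component over a leaf, all other components project to points over the node. -/
theorem proj_of_leaf {w : Fin D.U.n} {s : P1}
    (hs : ∀ t, D.L.IsNode (D.F.comp w, t) → t = s) {p : D.U.Pt} (hp : p.1 ≠ w) :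
    (D.F.map w).apply (D.U.proj w p) = s :=
  hs _ (D.isNode_iff.1 (D.U.isNode_proj hp))

theorem apply_injective_of_deg_one {w : Fin D.U.n} (hw : D.deg w = 1) {p q : P1}
    (h : (D.F.map w).apply p = (D.F.map w).apply q) : p = q := by
  obtain ⟨G, hG⟩ := D.exists_apply_eq_smul hw
  rwa [hG, hG, smul_left_cancel_iff] at h

/-- Some two labels coincide on both matched components. Pushing the coincidence forward by the
cover shows that their images under f lie on the same side of the partition, and `decide_pair`
applies. -/
theorem Match.split_cases {w : Fin D.U.n} {v' : Fin D.L.n} {g : Mob} (h : D.Match w v' g)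
    (hs : D.L.Split v u i j) (hij : i ≠ j) (hi : i ≠ B.z) (hj : j ≠ B.z) :
    (i = B.zero ∧ j = B.one) ∨ (i = B.one ∧ j = B.zero) ∨ (i = B.inf ∧ j = B.y) ∨
      (i = B.y ∧ j = B.inf) := by
  obtain ⟨e1, e2, e3⟩ := exists_pair i j hij hi hj
  have hcoin : ∀ a a', a ≠ a' →
      D.L.proj v' (D.L.mark (iota a)) = D.L.proj v' (D.L.mark (iota a')) →
      ((iota a = i ∨ iota a = j) ↔ (iota a' = i ∨ iota a' = j)) := by
    intro a a' hne he
    have hne' : iota a ≠ iota a' := fun e => hne (iota.injective e)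
    rcases hs.cover v' with rfl | rfl
    · rcases hs.proj_eq he with h1 | h1
      · exact absurd h1 hne'
      · exact iff_of_true h1.1 h1.2
    · rcases hs.proj_eq' he with h1 | h1
      · exact absurd h1 hne'
      · exact iff_of_false h1.1 h1.2
  have main : ∃ a a', a ≠ a' ∧ ((iota a = i ∨ iota a = j) ↔ (iota a' = i ∨ iota a' = j)) ∧
      ((dyn a = i ∨ dyn a = j) ↔ (dyn a' = i ∨ dyn a' = j)) := by
    by_cases hd : D.deg w = 2
    · have hc : ∃ a a', a ≠ a' ∧
          D.L.proj v' (D.L.mark (iota a)) = D.L.proj v' (D.L.mark (iota a')) := by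
        rcases hs.cover v' with rfl | rfl
        · obtain ⟨a, a', hne, h1, h2⟩ := e1
          exact ⟨a, a', hne, (hs.proj_mem h1).trans (hs.proj_mem h2).symm⟩
        · obtain ⟨a, a', hne, h1, h2⟩ := e2
          exact ⟨a, a', hne, (hs.proj_not_mem h1).trans (hs.proj_not_mem h2).symm⟩
      obtain ⟨a, a', hne, he⟩ := hc
      refine ⟨a, a', hne, hcoin a a' hne he, ?_⟩
      have h1 := congrArg (D.F.map w).apply (h.proj_eq_iff.1 he)
      rw [D.apply_proj hd, D.apply_proj hd, D.comm, D.comm] at h1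
      have hne' : dyn a ≠ dyn a' := fun e => hne (dyn_injective e)
      rcases hs.cover (D.F.comp w) with h2 | h2 <;> rw [h2] at h1
      · rcases hs.proj_eq h1 with h1 | h1
        · exact absurd h1 hne'
        · exact iff_of_true h1.1 h1.2
      · rcases hs.proj_eq' h1 with h1 | h1
        · exact absurd h1 hne'
        · exact iff_of_false h1.1 h1.2
    -- A component of degree one cannot lie over `v`, which carries z, so it lies over `u`. Two
    -- labels sent by f to `v` are then both seen at the only point over the node.
    · have hd1 := (D.deg_eq_one_or_two w).resolve_right hd
      have hwu : D.F.comp w = u := by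
        refine (hs.cover _).resolve_left fun hwv => hd (D.deg_eq_two_of_mem (Or.inr ?_))
        rw [hwv, hs.not_mem B.z (by rintro (e | e) <;> simp_all)]
      obtain ⟨a, a', hne, h1, h2⟩ := e3
      refine ⟨a, a', hne, hcoin a a' hne (h.proj_eq_iff.2 ?_), iff_of_false h1 h2⟩
      have key : ∀ a, ¬ (dyn a = i ∨ dyn a = j) →
          (D.F.map w).apply (D.U.proj w (D.U.mark a)) = D.L.node u v := by
        intro a ha
        refine proj_of_leaf (fun t ht => hs.eq_of_isNode' (hwu ▸ ht)) ?_
        rintro rfl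
        have := D.comp_mark a
        rw [hwu, hs.not_mem _ ha] at this
        exact hs.ne this
      exact apply_injective_of_deg_one hd1 ((key a h1).trans (key a' h2).symm)
  obtain ⟨a, a', hne, h1, h2⟩ := main
  exact decide_pair i j a a' hij hi hj hne h1 h2

/-- In the first boundary stratum, the points marked `∞` and `x` lie on one component. -/
theorem Match.comp_eq {w : Fin D.U.n} {v' : Fin D.L.n} {g : Mob} (h : D.Match w v' g)
    (hs : D.L.Split v u B.zero B.one) : (D.U.mark A.inf).1 = (D.U.mark A.x).1 := by
  have hinf : D.F.comp (D.U.mark A.inf).1 = u := (D.comp_mark _).trans (hs.mem _ (Or.inr rfl))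
  have hx : D.F.comp (D.U.mark A.x).1 = u := (D.comp_mark _).trans (hs.mem _ (Or.inl rfl))
  have hvz : (D.L.mark B.z).1 = v := hs.not_mem _ (by simp)
  rcases hs.cover (D.F.comp w) with hw | hw
  · have hd : D.deg w = 2 := D.deg_eq_two_of_mem (Or.inr (hw.trans hvz.symm))
    have hadj : ∀ c, D.F.comp c = u → D.U.graph.Adj w c := by
      intro c hc
      have hcw : w ≠ c := by
        rintro rfl
        exact hs.ne (hc.symm.trans hw)
      have h1 := Tree.step_adj D.U.isTree hcw
      have h2 := D.preAdmissible.adj _ _ h1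
      rw [hc] at h2
      have h3 : D.F.comp (Tree.step D.U.isTree c w) = D.F.comp w := by
        rw [hw]
        exact (hs.cover _).resolve_right fun e => h2.ne e.symm
      rw [D.eq_of_comp_eq hd h3] at h1
      exact h1.symm
    -- Both marks are seen from `w` through nodes; if these nodes are equal, the two components
    -- behind them are equal.
    have hproj : D.U.proj w (D.U.mark A.inf) = D.U.proj w (D.U.mark A.x) := by
      rw [← h.proj_eq_iff]
      rcases hs.cover v' with rfl | rfl
      -- On `v` the points 0 and 1 below coincide, hence so do 0 and 1 above on `w`, and then also
      -- their images ∞ and y, which `v` separates.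
      · exfalso
        have h1 : D.U.proj w (D.U.mark A.zero) = D.U.proj w (D.U.mark A.one) := by
          rw [← h.proj_eq_iff]
          exact (hs.proj_mem (Or.inl rfl)).trans (hs.proj_mem (Or.inr rfl)).symm
        have h2 := congrArg (D.F.map w).apply h1
        rw [D.apply_proj hd, D.apply_proj hd, D.comm, D.comm, hw] at h2
        have := hs.proj_eq h2
        revert this
        decide
      · exact (hs.proj_not_mem (by decide)).trans (hs.proj_not_mem (by decide)).symm
    have a1 := hadj _ hinf
    have a2 := hadj _ hx
    rw [D.U.proj_of_adj a1, D.U.proj_of_adj a2] at hproj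
    exact D.U.node_inj _ _ _ a1 a2 hproj
  · by_cases hd : D.deg w = 2
    · rw [D.eq_of_comp_eq hd (hinf.trans hw.symm), D.eq_of_comp_eq hd (hx.trans hw.symm)]
    have hd1 := (D.deg_eq_one_or_two w).resolve_right hd
    have hnw : ∀ a, (D.U.mark a).1 ≠ w →
        (D.F.map w).apply (D.U.proj w (D.U.mark a)) = D.L.node u v := fun a ha =>
      proj_of_leaf (fun t ht => hs.eq_of_isNode' (hw ▸ ht)) ha
    have hv' : ∀ a, ¬ (dyn a = B.zero ∨ dyn a = B.one) → (D.U.mark a).1 ≠ w := by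
      rintro a ha rfl
      exact hs.ne (hw.symm.trans ((D.comp_mark a).trans (hs.not_mem _ ha)))
    have n0 := hnw A.zero (hv' _ (by decide))
    have n1 := hnw A.one (hv' _ (by decide))
    obtain ⟨a, b, c, hab, hac, hbc⟩ := h.exists_three
    rw [Ne, h.proj_eq_iff] at hab hac hbc
    replace hab := mt (apply_injective_of_deg_one hd1) hab
    replace hac := mt (apply_injective_of_deg_one hd1) hac
    replace hbc := mt (apply_injective_of_deg_one hd1) hbc
    -- The marks 0 and 1 are already seen at the point over the node. If a third mark were too, only
    -- two different projections would remain on `w`.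
    have m1 : (D.U.mark A.inf).1 = w := by
      by_contra hcon
      have n2 := hnw _ hcon
      cases a <;> cases b <;> cases c <;> simp_all
    have m2 : (D.U.mark A.x).1 = w := by
      by_contra hcon
      have n2 := hnw _ hcon
      cases a <;> cases b <;> cases c <;> simp_all
    rw [m1, m2]

end Diagram

theorem scale_smul_upos {c : ℂ} (hc : c ≠ 0) (p q r : ℂ) (a : A) :
    scale c hc • upos p q r a = upos (c * p) (c * q) (c * r) a := by
  cases a <;> simp [upos]

theorem scale_smul_lpos {c : ℂ} (hc : c ≠ 0) (p q r : ℂ) (b : B) :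
    scale (c ^ 2) (pow_ne_zero 2 hc) • lpos p q r b = lpos (c * p) (c * q) (c * r) b := by
  cases b <;> simp [lpos, mul_pow]

/-! ### The diagonal -/

/-- The diagrams on the diagonal of the open stratum. -/
def diagramV (x : ℂ) (hx : x ∈ TV) : Diagram := vDiagram _ _ _ (generic_of_mem_TV hx)

/-- The conic passes through (1 : 1 : 1), and the ratio x = (p − q)/(r − q) indexes the lines
through this point. It is also the coordinate of the mark x above once the marks 0, 1, ∞ are
normalized. -/
theorem conic_param {p q r : ℂ} (h : p ^ 2 + p * q + p * r - q * r - q ^ 2 - r ^ 2 = 0)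
    (hqr : q ≠ r) : ∃ x μ : ℂ, μ ≠ 0 ∧ 2 * x ≠ 1 ∧ p - q = x * (r - q) ∧
      p = μ * vp x ∧ q = μ * vq x ∧ r = μ * vr x := by
  have h1 : r - q ≠ 0 := sub_ne_zero.2 hqr.symm
  -- The line 2p = q + r is the tangent at (1 : 1 : 1), so it meets the conic only where q = r. This
  -- excludes x = 1/2.
  have h2 : 2 * p - q - r ≠ 0 := by
    intro h2
    apply h1
    have : (r - q) ^ 2 = 0 := by linear_combination (-4) * h + (2 * p + 3 * q + 3 * r) * h2
    exact pow_eq_zero_iff (two_ne_zero) |>.1 this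
  have key : ∀ x μ : ℂ, μ ≠ 0 → 2 * x ≠ 1 → p - q = x * (r - q) → q = μ * vq x → r = μ * vr x →
      ∃ x μ : ℂ, μ ≠ 0 ∧ 2 * x ≠ 1 ∧ p - q = x * (r - q) ∧
        p = μ * vp x ∧ q = μ * vq x ∧ r = μ * vr x := by
    intro x μ hμ hx e1 e2 e3
    refine ⟨x, μ, hμ, hx, e1, ?_, e2, e3⟩
    unfold vq at e2
    unfold vr at e3
    unfold vp
    linear_combination e1 + (1 - x) * e2 + x * e3
  refine key ((p - q) / (r - q)) ((r - q) ^ 2 / (2 * (2 * p - q - r))) ?_ ?_ ?_ ?_ ?_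
  · exact div_ne_zero (pow_ne_zero 2 h1) (mul_ne_zero two_ne_zero h2)
  · intro e
    apply h2
    field_simp at e
    linear_combination e
  · field_simp
  · unfold vq
    field_simp
    linear_combination h
  · unfold vr
    field_simp
    linear_combination h

/-- The coordinates of the marked points of the upper curve on the diagonal. -/
def normU (x : ℂ) : A → P1
  | A.zero => OnePoint.some 0
  | A.one => OnePoint.some 1
  | A.inf => OnePoint.infty
  | A.x => OnePoint.some x

theorem vH_smul_norm {x : ℂ} (hx : x ∈ TV) (a : A) :
    vH _ _ _ (generic_of_mem_TV hx) • normU x a = upos (vp x) (vq x) (vr x) a := by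
  have h0 := hx.1
  unfold vH
  cases a
  · rw [upos, normU, ((isHomCoord_some 0).mob _).eq_iff isHomCoord_infty]
    ring
  · rw [upos, normU, ((isHomCoord_some 1).mob _).eq_iff (isHomCoord_some _)]
    ring
  · rw [upos, normU, (isHomCoord_infty.mob _).eq_iff (isHomCoord_some _)]
    ring
  · rw [upos, normU, ((isHomCoord_some x).mob _).eq_iff (isHomCoord_some _)]
    unfold vp vq vr
    ring

theorem vG_smul_lpos {x : ℂ} (hx : x ∈ TV) (a : A) :
    vG _ _ _ (generic_of_mem_TV hx) • lpos (vp x) (vq x) (vr x) (iota a) = normU x a := by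
  unfold vG
  cases a
  · rw [iota_zero, lpos, normU, ((isHomCoord_some _).mob _).eq_iff (isHomCoord_some _)]
    ring
  · rw [iota_one, lpos, normU, ((isHomCoord_some _).mob _).eq_iff (isHomCoord_some _)]
    ring
  · rw [iota_inf, lpos, normU, (isHomCoord_infty.mob _).eq_iff isHomCoord_infty]
    ring
  · rw [iota_x, lpos, normU, ((isHomCoord_some _).mob _).eq_iff (isHomCoord_some _)]
    unfold vp vq vr
    ring

theorem diagramV_mark_U {x : ℂ} (hx : x ∈ TV) (a : A) :
    (diagramV x hx).U.mark a = ((0 : Fin 1), normU x a) := by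
  refine Prod.ext rfl ?_
  change (vH _ _ _ (generic_of_mem_TV hx))⁻¹ • upos _ _ _ a = _
  rw [inv_smul_eq_iff, vH_smul_norm hx]

theorem diagramV_mark_L {x : ℂ} (hx : x ∈ TV) (a : A) :
    (diagramV x hx).L.mark (iota a) = ((0 : Fin 1), normU x a) :=
  Prod.ext rfl (vG_smul_lpos hx a)

theorem diagramV_mem {x : ℂ} (hx : x ∈ TV) : AM.mk (diagramV x hx) ∈ V := by
  refine ⟨_, rfl, rfl, rfl, x, ⟨?_, ?_, ?_, ?_⟩, ?_, ?_, ?_, ?_⟩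
  · rw [diagramV_mark_U]; rfl
  · rw [diagramV_mark_U]; rfl
  · rw [diagramV_mark_U]; rfl
  · rw [diagramV_mark_U]; rfl
  · exact congrArg Prod.snd (diagramV_mark_L hx A.zero)
  · exact congrArg Prod.snd (diagramV_mark_L hx A.one)
  · exact congrArg Prod.snd (diagramV_mark_L hx A.inf)
  · exact congrArg Prod.snd (diagramV_mark_L hx A.x)

/-- The isomorphism from the projective line to an irreducible rational curve. -/
def lineIso {C : RationalCurve} (w : Fin C.n) (hw : ∀ w', w' = w) (g : Mob) :
    RationalCurve.Iso line C where
  comp := ⟨fun _ => w, fun _ => (0 : Fin 1), fun _ => Subsingleton.elim (α := Fin 1) _ _,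
    fun w' => (hw w').symm⟩
  mob _ := g
  adj_iff _ _ := ⟨fun h => absurd rfl h.ne, fun h => absurd h id⟩
  node_eq _ _ h := absurd h id

namespace Diagram

variable {D : Diagram}

theorem equivalent_vDiagram {w : Fin D.U.n} {v : Fin D.L.n} {G H : Mob} {p q r : ℂ}
    (h : Generic p q r) (hw : ∀ w', w' = w) (hv : ∀ v', v' = v) (hF : SqForm (D.F.map w) G H)
    (hU : ∀ a, H • D.U.proj w (D.U.mark a) = upos p q r a)
    (hL : ∀ b, D.L.proj v (D.L.mark b) = G • lpos p q r b) :
    (vDiagram p q r h).Equivalent D := by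
  refine ⟨lineIso w hw (H⁻¹ * vH p q r h), lineIso v hv (G * (vG p q r h)⁻¹), fun a => ?_,
    fun b => ?_, fun s => ?_⟩
  · refine Prod.ext (hw _).symm ?_
    change (H⁻¹ * vH p q r h) • (vH p q r h)⁻¹ • upos p q r a = _
    rw [mul_smul, smul_inv_smul, ← hU, inv_smul_smul, D.U.proj_of_eq (hw _)]
  · refine Prod.ext (hv _).symm ?_
    change (G * (vG p q r h)⁻¹) • vG p q r h • lpos p q r b = _
    rw [mul_smul, inv_smul_smul, ← hL, D.L.proj_of_eq (hv _)]
  · refine Prod.ext (hv _) ?_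
    change (D.F.map w).apply ((H⁻¹ * vH p q r h) • s.2) =
      (G * (vG p q r h)⁻¹) • (vRat p q r h).apply s.2
    rw [hF.apply_eq, (vRat_sqForm p q r h).apply_eq, mul_smul, smul_inv_smul, mul_smul,
      inv_smul_smul]

/-- The irreducible case: the normal form satisfies the conic, its parametrization gives x, and
rescaling by μ⁻¹ removes the common factor. None of p, q, r vanishes because z sits at 0. -/
theorem Match.exists_diagramV {w : Fin D.U.n} {v v' : Fin D.L.n} {g : Mob} (h : D.Match w v' g)
    (hv : Function.Injective fun b => D.L.proj v (D.L.mark b)) :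
    ∃ x, ∃ hx : x ∈ TV, (diagramV x hx).Equivalent D := by
  have hone := D.stable.eq_of_injective hv
  obtain ⟨w₀, G, H, p, q, r, hd, hc, hF, hU, hL⟩ := D.exists_normalForm (v := v) (hone _)
    (fun t ht => by
      obtain ⟨s, hs, -⟩ := ht
      exact absurd (hone s).symm hs.ne)
    (fun b hb e => hb (hv e))
  have hw₀ : ∀ w', w' = w₀ := fun w' => D.eq_of_comp_eq hd ((hone _).trans (hone _).symm)
  obtain ⟨hcon, hpq, hpr, hqr⟩ := h.conic (fun a b hab => iota.injective (hv hab)) hU hL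
  have hl : Function.Injective (lpos p q r) := fun a b hab => hv (by
    simp only [hL]
    exact congrArg _ hab)
  have hp : p ≠ 0 := by
    rintro rfl
    exact absurd (hl (a₁ := B.y) (a₂ := B.z) (by simp [lpos])) (by simp)
  have hq : q ≠ 0 := by
    rintro rfl
    exact absurd (hl (a₁ := B.one) (a₂ := B.z) (by simp [lpos])) (by simp)
  have hr : r ≠ 0 := by
    rintro rfl
    exact absurd (hl (a₁ := B.zero) (a₂ := B.z) (by simp [lpos])) (by simp)
  obtain ⟨x, μ, hμ, h2x, hx, ep, eq, er⟩ := conic_param hcon (ne_of_sq_ne hqr).1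
  have hTV : x ∈ TV := by
    refine ⟨?_, ?_, h2x, ?_, ?_, ?_⟩
    · rintro rfl
      rw [zero_mul, sub_eq_zero] at hx
      exact (ne_of_sq_ne hpq).1 hx
    · rintro rfl
      rw [one_mul, sub_left_inj] at hx
      exact (ne_of_sq_ne hpr).1 hx
    · intro e
      exact hp (by rw [ep, e, mul_zero])
    · intro e
      exact hq (by rw [eq, e, mul_zero])
    · intro e
      exact hr (by rw [er, e, mul_zero])
  have hinv : μ⁻¹ ≠ 0 := inv_ne_zero hμ
  have ep' : μ⁻¹ * p = vp x := by rw [ep, inv_mul_cancel_left₀ hμ]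
  have eq' : μ⁻¹ * q = vq x := by rw [eq, inv_mul_cancel_left₀ hμ]
  have er' : μ⁻¹ * r = vr x := by rw [er, inv_mul_cancel_left₀ hμ]
  refine ⟨x, hTV, equivalent_vDiagram (generic_of_mem_TV hTV) hw₀ hone (hF.rescale μ⁻¹ hinv)
    (fun a => ?_) (fun b => ?_)⟩
  · rw [mul_smul, hU, scale_smul_upos, ep', eq', er']
  · rw [hL, mul_smul, ← ep', ← eq', ← er', ← scale_smul_lpos hinv, inv_smul_smul]

/-! ### The exceptional diagrams -/

/-- The positions of the points marked by `B` in the exceptional diagram with two covering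
components. -/
def halfPos : B → P1
  | B.zero => OnePoint.some 0
  | B.one => OnePoint.some 1
  | B.inf => OnePoint.infty
  | B.y => OnePoint.some (1 / 2)
  | B.z => OnePoint.infty

/-- The positions of the points marked by `B` in the exceptional diagrams. -/
def excPos : Set (B → P1) :=
  -- The first three sets are the points of the conic with p, q or r equal to 0, scaled so that r =
  -- 1, r = 1 and q = 1 respectively; `halfPos` comes from z falling on ∞.
  (fun s => lpos 0 s 1) '' {s | s ^ 2 + s + 1 = 0} ∪
  (fun s => lpos s 0 1) '' {s | s ^ 2 + s - 1 = 0} ∪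
  (fun s => lpos s 1 0) '' {s | s ^ 2 + s - 1 = 0} ∪ {halfPos}

theorem finite_quadratic (a : ℂ) : {s : ℂ | s ^ 2 + s + a = 0}.Finite := by
  have h : (Polynomial.X ^ 2 + Polynomial.X + Polynomial.C a : ℂ[X]) ≠ 0 := by
    intro h
    have := congrArg (fun P : ℂ[X] => P.coeff 2) h
    simp [Polynomial.coeff_X] at this
  refine (Polynomial.finite_setOfPred_isRoot h).subset fun s hs => ?_
  simpa [Polynomial.IsRoot] using hs

theorem excPos_finite : excPos.Finite := by
  have h := finite_quadratic (-1)
  simp only [← sub_eq_add_neg] at h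
  exact ((((finite_quadratic 1).image _).union (h.image _)).union (h.image _)).union
    (Set.finite_singleton _)

variable {v u : Fin D.L.n}

/-- Seen from `v`, the branch value z, placed at 0, coincides with the mark i, so one of p, q, r
vanishes and the conic becomes a quadratic equation for the ratio of the other two. -/
theorem Match.exists_excPos_of_ne {w : Fin D.U.n} {v' : Fin D.L.n} {g : Mob} (h : D.Match w v' g)
    {i : B} (hs : D.L.Split v u B.z i) (hz : i ≠ B.z) (hi : i ≠ B.inf) :
    ∃ l ∈ excPos, ∃ G : Mob, ∀ b, D.L.proj v (D.L.mark b) = G • l b := by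
  have hinf : ¬ (B.inf = B.z ∨ B.inf = i) := by
    rintro (e | e)
    · cases e
    · exact hi e.symm
  obtain ⟨w₀, G, H, p, q, r, hd, hc, hF, hU, hL⟩ := D.exists_normalForm (v := v)
    (hs.not_mem _ hinf)
    (fun t ht => (hs.eq_of_isNode ht).trans (hs.proj_mem (Or.inl rfl)).symm)
    (fun b hb e => (hs.proj_eq e).elim hb fun h' => hinf h'.2)
  have hinj : Function.Injective fun a => D.L.proj v (D.L.mark (iota a)) := by
    intro a b hab
    rcases hs.proj_eq hab with h1 | ⟨h1, h2⟩
    · exact iota.injective h1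
    · have hz' : ∀ a, iota a ≠ B.z := by decide
      exact iota.injective ((h1.resolve_left (hz' a)).trans (h2.resolve_left (hz' b)).symm)
  obtain ⟨hcon, hpq, hpr, hqr⟩ := h.conic hinj hU hL
  have hzi : lpos p q r B.z = lpos p q r i := by
    have h1 := (hs.proj_mem (Or.inl rfl)).trans (hs.proj_mem (Or.inr rfl)).symm
    rw [hL, hL] at h1
    exact smul_left_cancel _ h1
  have key : ∀ c (hc : c ≠ 0), lpos (c * p) (c * q) (c * r) ∈ excPos →
      ∃ l ∈ excPos, ∃ G : Mob, ∀ b, D.L.proj v (D.L.mark b) = G • l b := fun c hc hmem =>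
    ⟨_, hmem, G * (scale (c ^ 2) (pow_ne_zero 2 hc))⁻¹, fun b => by
      rw [hL, mul_smul, ← scale_smul_lpos hc, inv_smul_smul]⟩
  cases i
  · have hr : r = 0 := by simpa [lpos] using hzi.symm
    subst hr
    have hq : q ≠ 0 := by
      rintro rfl
      exact hqr rfl
    refine key q⁻¹ (inv_ne_zero hq) (Or.inl (Or.inr ⟨q⁻¹ * p, ?_, ?_⟩))
    · simp only [Set.mem_ofPred_eq]
      field_simp
      linear_combination hcon
    · simp only [mul_zero, inv_mul_cancel₀ hq]
  · have hq : q = 0 := by simpa [lpos] using hzi.symm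
    subst hq
    have hr : r ≠ 0 := by
      rintro rfl
      exact hqr rfl
    refine key r⁻¹ (inv_ne_zero hr) (Or.inl (Or.inl (Or.inr ⟨r⁻¹ * p, ?_, ?_⟩)))
    · simp only [Set.mem_ofPred_eq]
      field_simp
      linear_combination hcon
    · simp only [mul_zero, inv_mul_cancel₀ hr]
  · exact absurd rfl hi
  · have hp : p = 0 := by simpa [lpos] using hzi.symm
    subst hp
    have hr : r ≠ 0 := by
      rintro rfl
      exact hpr rfl
    refine key r⁻¹ (inv_ne_zero hr) (Or.inl (Or.inl (Or.inl ⟨r⁻¹ * q, ?_, ?_⟩)))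
    · simp only [Set.mem_ofPred_eq]
      field_simp
      linear_combination -hcon
    · simp only [mul_zero, inv_mul_cancel₀ hr]
  · exact absurd rfl hz

/-- Both branch values lie behind the node, so no critical value other than the node is available on
`v`, and the matched component has degree one. The match then induces a Möbius map that carries each
f-position to the corresponding ι-position. -/
theorem Match.exists_excPos_inf {w : Fin D.U.n} {v' : Fin D.L.n} {g : Mob} (h : D.Match w v' g)
    (hs : D.L.Split v u B.z B.inf) :
    ∃ l ∈ excPos, ∃ G : Mob, ∀ b, D.L.proj v (D.L.mark b) = G • l b := by
  have hinj : Function.Injective fun a => D.L.proj v (D.L.mark (iota a)) := by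
    intro a b hab
    rcases hs.proj_eq hab with h1 | ⟨h1, h2⟩
    · exact iota.injective h1
    · have hz' : ∀ a, iota a ≠ B.z := by decide
      exact iota.injective ((h1.resolve_left (hz' a)).trans (h2.resolve_left (hz' b)).symm)
  have hv : v' = v := by
    obtain ⟨a, b, c, hab, hac, hbc⟩ := h.exists_three
    have hab' : a ≠ b := fun e => hab (by rw [e])
    have hac' : a ≠ c := fun e => hac (by rw [e])
    have hbc' : b ≠ c := fun e => hbc (by rw [e])
    exact D.L.component_unique hab hac hbc (hinj.ne hab') (hinj.ne hac') (hinj.ne hbc')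
  subst hv
  have hinjU : Function.Injective fun a => D.U.proj w (D.U.mark a) := fun a b hab =>
    hinj (h.proj_eq_iff.2 hab)
  -- If `w` lay over `u`, the images y, 1, 0 of the marks 1, ∞, x would all be seen at the node, too
  -- many for a double cover that separates these marks on `w`.
  have hwv : D.F.comp w = v' := by
    refine (hs.cover _).resolve_right fun hwu => ?_
    have hd : D.deg w = 2 := D.deg_eq_two_of_mem (Or.inl (by rw [hwu, hs.mem _ (Or.inr rfl)]))
    have key : ∀ a, ¬ (dyn a = B.z ∨ dyn a = B.inf) →
        (D.F.map w).apply (D.U.proj w (D.U.mark a)) = D.L.node u v' := fun a ha => by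
      rw [D.apply_proj hd, D.comm, hwu, hs.proj_not_mem ha]
    have k1 := key A.one (by decide)
    have k2 := key A.inf (by decide)
    have k3 := key A.x (by decide)
    rcases RatMap.fibre_le_two hd (k1.trans k2.symm) (k1.trans k3.symm) with e | e | e
    · exact absurd (hinjU e) (by simp)
    · exact absurd (hinjU e) (by simp)
    · exact absurd (hinjU e) (by simp)
  -- In degree two both critical values would be the one node of `v'`, but they differ.
  have hd1 : D.deg w = 1 := by
    refine (D.deg_eq_one_or_two w).resolve_right fun hd => ?_
    have key : ∀ c, (D.F.map w).localDegree c = 2 → (D.F.map w).apply c = D.L.node v' u := by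
      intro c hc
      rcases D.crit_value hc with h1 | h1 | h1
      · rw [hwv] at h1
        exact hs.eq_of_isNode h1
      · exact absurd (hwv.symm.trans ((congrArg Prod.fst h1).trans (hs.mem _ (Or.inr rfl)))) hs.ne.symm
      · exact absurd (hwv.symm.trans ((congrArg Prod.fst h1).trans (hs.mem _ (Or.inl rfl)))) hs.ne.symm
    obtain ⟨c₁, c₂, -, h1, h2, h12, -⟩ := RatMap.exists_crit hd
    exact h12 ((key c₁ h1).trans (key c₂ h2).symm)
  have hnode : ∀ a, (D.U.mark a).1 ≠ w →
      (D.F.map w).apply (D.U.proj w (D.U.mark a)) = D.L.node v' u := fun a ha =>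
    proj_of_leaf (fun t ht => hs.eq_of_isNode (hwv ▸ ht)) ha
  have h0 : (D.U.mark A.zero).1 ≠ w := by
    rintro rfl
    exact hs.ne (((D.comp_mark A.zero).trans (hs.mem _ (Or.inr rfl))).symm.trans hwv)
  have hmap : ∀ a, (D.F.map w).apply (D.U.proj w (D.U.mark a)) = D.L.proj v' (D.L.mark (dyn a)) := by
    intro a
    by_cases ha : a = A.zero
    · subst ha
      rw [hnode _ h0]
      exact (hs.proj_mem (Or.inr rfl)).symm
    · have hmem : (D.U.mark a).1 = w := by
        by_contra hcon
        exact ha (hinjU (apply_injective_of_deg_one hd1 ((hnode a hcon).trans (hnode _ h0).symm)))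
      have hc : (D.L.mark (dyn a)).1 = v' := by rw [← D.comp_mark, hmem, hwv]
      rw [D.U.proj_of_eq hmem, D.L.proj_of_eq hc, ← D.apply_mark, hmem]
  obtain ⟨M, hM⟩ := D.exists_apply_eq_smul hd1
  have hk : ∀ a, (g * M⁻¹) • D.L.proj v' (D.L.mark (dyn a)) = D.L.proj v' (D.L.mark (iota a)) := by
    intro a
    rw [← hmap, hM, mul_smul, inv_smul_smul, h.smul_proj]
  have hne : ∀ a b : A, a ≠ b →
      D.L.proj v' (D.L.mark (iota a)) ≠ D.L.proj v' (D.L.mark (iota b)) := fun a b hab => hinj.ne hab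
  obtain ⟨K, K0, K1, K2⟩ := exists_mob_zero_one_infty (hne A.zero A.one (by simp))
    (hne A.zero A.inf (by simp)) (hne A.one A.inf (by simp))
  have hY : ∃ Y : ℂ, K • D.L.proj v' (D.L.mark B.y) = OnePoint.some Y := by
    cases he : K • D.L.proj v' (D.L.mark B.y) using OnePoint.rec with
    | infty => exact absurd (smul_left_cancel _ (he.trans K2.symm)) (hne A.x A.inf (by simp))
    | coe s => exact ⟨s, rfl⟩
  obtain ⟨Y, hY⟩ := hY
  have hg : ∀ a, (K * (g * M⁻¹) * K⁻¹) • K • D.L.proj v' (D.L.mark (dyn a)) =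
      K • D.L.proj v' (D.L.mark (iota a)) := by
    intro a
    rw [mul_smul, mul_smul, inv_smul_smul, hk]
  have g0 := hg A.zero
  have g1 := hg A.one
  have g2 := hg A.inf
  have g3 := hg A.x
  simp only [dyn, iota_zero, iota_one, iota_inf, iota_x] at g0 g1 g2 g3 K0 K1 K2
  rw [K0, K2] at g0
  rw [K1, hY] at g1
  rw [K1, K2] at g2
  rw [K0, hY] at g3
  -- The Möbius map acts by ∞ ↦ 0, Y ↦ 1, 1 ↦ ∞, 0 ↦ Y. It is therefore t ↦ Y/(1 − t), and Y ↦ 1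
  -- forces Y = 1/2.
  have hcr := isHomCoord_crossRatio isHomCoord_infty (isHomCoord_some Y) (isHomCoord_some 1)
    (isHomCoord_some 0) g0 g1 g2
  rw [g3] at hcr
  have h4 := ((isHomCoord_some Y).eq_iff hcr).1 rfl
  have hY2 : Y = 1 / 2 := by linear_combination h4 / 2
  refine ⟨halfPos, Or.inr rfl, K⁻¹, fun b => ?_⟩
  rw [eq_inv_smul_iff]
  cases b
  · exact K0
  · exact K1
  · exact K2
  · rw [hY, hY2]
    rfl
  · rw [hs.proj_mem (Or.inl rfl), ← hs.proj_mem (Or.inr rfl)]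
    exact K2

theorem Match.exists_excPos {w : Fin D.U.n} {v' : Fin D.L.n} {g : Mob} (h : D.Match w v' g)
    {i : B} (hs : D.L.Split v u B.z i) (hz : i ≠ B.z) :
    ∃ l ∈ excPos, ∃ G : Mob, ∀ b, D.L.proj v (D.L.mark b) = G • l b := by
  by_cases hi : i = B.inf
  · subst hi
    exact h.exists_excPos_inf hs
  · exact h.exists_excPos_of_ne hs hz hi

theorem mem_A₁ {w : Fin D.U.n} {v' : Fin D.L.n} {g : Mob} (h : D.Match w v' g)
    (hs : D.L.Split v u B.zero B.one) : AM.mk D ∈ A₁ := by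
  have h1 : (D.L.mark B.inf).1 = v := hs.not_mem _ (by decide)
  have h2 : (D.L.mark B.y).1 = v := hs.not_mem _ (by decide)
  have h3 : (D.L.mark B.z).1 = v := hs.not_mem _ (by decide)
  have h4 : (D.L.mark B.zero).1 = u := hs.mem _ (by decide)
  have h5 : (D.L.mark B.one).1 = u := hs.mem _ (by decide)
  exact ⟨D, rfl, hs.n_eq, h1.trans h2.symm, h1.trans h3.symm, h4.trans h5.symm,
    by rw [h1, h4]; exact hs.ne.symm, h.comp_eq hs⟩

theorem mem_A₂ (hs : D.L.Split v u B.inf B.y) : AM.mk D ∈ A₂ := by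
  have h1 : (D.L.mark B.zero).1 = v := hs.not_mem _ (by decide)
  have h2 : (D.L.mark B.one).1 = v := hs.not_mem _ (by decide)
  have h3 : (D.L.mark B.z).1 = v := hs.not_mem _ (by decide)
  have h4 : (D.L.mark B.inf).1 = u := hs.mem _ (by decide)
  have h5 : (D.L.mark B.y).1 = u := hs.mem _ (by decide)
  exact ⟨D, rfl, hs.n_eq, h1.trans h2.symm, h1.trans h3.symm, h5.trans h4.symm,
    by rw [h1, h5]; exact hs.ne.symm⟩

/-- Classification of matching diagrams outside of `V ∪ A₁ ∪ A₂`. -/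
theorem Match.exists_split {w : Fin D.U.n} {v' : Fin D.L.n} {g : Mob} (h : D.Match w v' g)
    (hD : AM.mk D ∉ V ∪ A₁ ∪ A₂) {e : Fin 4 ↪ B}
    (he : Function.Injective fun k => D.L.proj v (D.L.mark (e k))) :
    ∃ u i, i ≠ B.z ∧ D.L.Split v u B.z i := by
  rcases D.stable.injective_or_split he with hv | ⟨u, i, j, hij, hs⟩
  · exfalso
    obtain ⟨x, hx, hE⟩ := h.exists_diagramV hv
    refine hD (Or.inl (Or.inl ?_))
    rw [← show AM.mk (diagramV x hx) = AM.mk D from Quotient.sound hE]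
    exact diagramV_mem hx
  · by_cases hi : i = B.z
    · subst hi
      exact ⟨u, j, hij.symm, hs⟩
    by_cases hj : j = B.z
    · subst hj
      exact ⟨u, i, hij, hs.swap⟩
    exfalso
    rcases h.split_cases hs hij hi hj with ⟨rfl, rfl⟩ | ⟨rfl, rfl⟩ | ⟨rfl, rfl⟩ | ⟨rfl, rfl⟩
    · exact hD (Or.inl (Or.inr (mem_A₁ h hs)))
    · exact hD (Or.inl (Or.inr (mem_A₁ h hs.swap)))
    · exact hD (Or.inr (mem_A₂ hs))
    · exact hD (Or.inr (mem_A₂ hs.swap))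

end Diagram

/-! ### Finiteness from finite fibres and finitely many labels -/

theorem RatMap.finite_fibre {F : RatMap} (hF : F.degree = 1 ∨ F.degree = 2) (s : P1) :
    {t | F.apply t = s}.Finite := by
  classical
  by_contra hinf
  obtain ⟨p, hp, -⟩ := (Set.Infinite.exists_notMem_finset hinf ∅)
  obtain ⟨q, hq, hq'⟩ := (Set.Infinite.exists_notMem_finset hinf {p})
  obtain ⟨r, hr, hr'⟩ := (Set.Infinite.exists_notMem_finset hinf {p, q})
  have hpq : F.apply p = F.apply q := hp.trans hq.symm
  have hpr : F.apply p = F.apply r := hp.trans hr.symm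
  simp only [Finset.mem_insert, Finset.mem_singleton, not_or] at hq' hr'
  rcases hF with hF | hF
  · obtain ⟨⟨G, hG⟩, -⟩ := F.exists_eq_mob hF
    rw [hG, hG, smul_left_cancel_iff] at hpq
    exact hq' hpq.symm
  · rcases RatMap.fibre_le_two hF hpq hpr with h | h | h
    · exact hq' h.symm
    · exact hr'.1 h.symm
    · exact hr'.2 h.symm

/-- A set is finite if its elements can be told apart by finitely many labels. -/
theorem finite_of_labels {α β : Type*} {X : Set α} {Y : Set β} (hY : Y.Finite) (R : α → β → Prop)
    (h1 : ∀ a ∈ X, ∃ b ∈ Y, R a b) (h2 : ∀ a ∈ X, ∀ a' ∈ X, ∀ b, R a b → R a' b → a = a') :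
    X.Finite := by
  rcases isEmpty_or_nonempty β with hβ | hβ
  · exact Set.Finite.subset Set.finite_empty fun a ha => (hβ.false (h1 a ha).choose).elim
  choose! f hf using h1
  exact Set.Finite.of_finite_image (hY.subset (Set.image_subset_iff.2 fun a ha => (hf a ha).1))
    fun a ha a' ha' he => h2 a ha a' ha' (f a) (hf a ha).2 (he ▸ (hf a' ha').2)

namespace Diagram

/-! ### Diagrams of the same combinatorial type -/

/-- The diagrams `D` and `E` have the same combinatorial type and isomorphic lower curves. -/
structure SameType (D E : Diagram) (eU : Fin D.U.n ≃ Fin E.U.n) (eL : Fin D.L.n ≃ Fin E.L.n) :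
    Prop where
  adjU : ∀ w w', E.U.graph.Adj (eU w) (eU w') ↔ D.U.graph.Adj w w'
  nodeL : ∀ v v' b, (E.L.graph.Adj (eL v) (eL v') ∧
    E.L.proj (eL v) (E.L.mark b) = E.L.node (eL v) (eL v')) ↔
    (D.L.graph.Adj v v' ∧ D.L.proj v (D.L.mark b) = D.L.node v v')
  markU : ∀ a, (E.U.mark a).1 = eU (D.U.mark a).1
  markL : ∀ b, (E.L.mark b).1 = eL (D.L.mark b).1
  comp : ∀ w, E.F.comp (eU w) = eL (D.F.comp w)
  deg : ∀ w, E.deg (eU w) = 2 ↔ D.deg w = 2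
  crit : ∀ w b, (∃ c, (D.F.map w).localDegree c = 2 ∧
      (D.F.map w).apply c = D.L.proj (D.F.comp w) (D.L.mark b)) →
    ∃ c, (E.F.map (eU w)).localDegree c = 2 ∧
      (E.F.map (eU w)).apply c = E.L.proj (E.F.comp (eU w)) (E.L.mark b)
  pos : ∀ v, ∃ g : Mob, ∀ b, E.L.proj (eL v) (E.L.mark b) = g • D.L.proj v (D.L.mark b)

/-- The lower curve and the cover of `D` are identified with those of `E`. -/
structure Lift (D E : Diagram) (eU : Fin D.U.n ≃ Fin E.U.n) (eL : Fin D.L.n ≃ Fin E.L.n)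
    (g : Fin D.L.n → Mob) (h : Fin D.U.n → Mob) : Prop where
  adjU : ∀ w w', E.U.graph.Adj (eU w) (eU w') ↔ D.U.graph.Adj w w'
  adjL : ∀ v v', E.L.graph.Adj (eL v) (eL v') ↔ D.L.graph.Adj v v'
  nodeL : ∀ v v', D.L.graph.Adj v v' → E.L.node (eL v) (eL v') = g v • D.L.node v v'
  markU : ∀ a, (E.U.mark a).1 = eU (D.U.mark a).1
  markL : ∀ b, E.L.mark b = (eL (D.L.mark b).1, g (D.L.mark b).1 • (D.L.mark b).2)
  comp : ∀ w, E.F.comp (eU w) = eL (D.F.comp w)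
  map : ∀ w t, (E.F.map (eU w)).apply (h w • t) = g (D.F.comp w) • (D.F.map w).apply t

variable {D D' E : Diagram}

theorem exists_crit_label {w : Fin D.U.n} {c : P1} (hc : (D.F.map w).localDegree c = 2) :
    ∃ b, (D.F.map w).apply c = D.L.proj (D.F.comp w) (D.L.mark b) := by
  rcases D.crit_value hc with h | h | h
  · obtain ⟨v', h1, h2⟩ := h
    obtain ⟨b, hb⟩ := D.stable.exists_mark h1
    exact ⟨b, h2.trans hb.symm⟩
  · exact ⟨B.inf, by rw [← h, D.L.proj_self]⟩
  · exact ⟨B.z, by rw [← h, D.L.proj_self]⟩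

/-- Equal positions give Möbius maps between the lower components. Every critical value is the
projection of some mark (`exists_crit_label`), so these maps respect critical values and lift to
components of degree two; in degree one the lift is a composition. -/
theorem SameType.exists_lift {eU : Fin D.U.n ≃ Fin E.U.n} {eL : Fin D.L.n ≃ Fin E.L.n}
    (hs : D.SameType E eU eL) : ∃ g h, D.Lift E eU eL g h := by
  choose g hg using hs.pos
  have hlift : ∀ w, ∃ h : Mob, ∀ t,
      (E.F.map (eU w)).apply (h • t) = g (D.F.comp w) • (D.F.map w).apply t := by
    intro w
    by_cases hd : D.deg w = 2
    · have hd' := (hs.deg w).2 hd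
      obtain ⟨p', hp'⟩ := RatMap.exists_apply_eq hd' (g (D.F.comp w) • (D.F.map w).apply OnePoint.infty)
      obtain ⟨h, hh, -⟩ := RatMap.exists_lift (g := g (D.F.comp w)) hd hd' (fun c hc => by
        obtain ⟨b, hb⟩ := exists_crit_label hc
        obtain ⟨c', hc', he⟩ := hs.crit w b ⟨c, hc, hb⟩
        refine ⟨c', hc', ?_⟩
        rw [he, hs.comp, hg, hb]) hp'
      exact ⟨h, hh⟩
    · obtain ⟨M, hM⟩ := D.exists_apply_eq_smul ((D.deg_eq_one_or_two w).resolve_right hd)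
      obtain ⟨M', hM'⟩ := E.exists_apply_eq_smul
        ((E.deg_eq_one_or_two (eU w)).resolve_right (mt (hs.deg w).1 hd))
      refine ⟨M'⁻¹ * g (D.F.comp w) * M, fun t => ?_⟩
      rw [hM, hM', mul_smul, mul_smul, smul_inv_smul]
  choose h hh using hlift
  refine ⟨g, h, hs.adjU, fun v v' => ⟨fun ha => ?_, fun ha => ?_⟩, fun v v' ha => ?_, hs.markU,
    fun b => Prod.ext (hs.markL b) ?_, hs.comp, hh⟩
  · obtain ⟨b, hb⟩ := E.stable.exists_mark ha
    exact ((hs.nodeL v v' b).1 ⟨ha, hb⟩).1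
  · obtain ⟨b, hb⟩ := D.stable.exists_mark ha
    exact ((hs.nodeL v v' b).2 ⟨ha, hb⟩).1
  · obtain ⟨b, hb⟩ := D.stable.exists_mark ha
    rw [← ((hs.nodeL v v' b).2 ⟨ha, hb⟩).2, hg, hb]
  · have := hg (D.L.mark b).1 b
    rwa [D.L.proj_of_eq rfl, E.L.proj_of_eq (hs.markL b)] at this

/-- The maps `h` are chosen on each upper component separately; what is missing for an isomorphism
is that they respect marks and nodes. -/
theorem Lift.equivalent {eU : Fin D.U.n ≃ Fin E.U.n} {eL : Fin D.L.n ≃ Fin E.L.n}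
    {g : Fin D.L.n → Mob} {h : Fin D.U.n → Mob} (hl : D.Lift E eU eL g h)
    (hm : ∀ a, h (D.U.mark a).1 • (D.U.mark a).2 = (E.U.mark a).2)
    (hn : ∀ w w', D.U.graph.Adj w w' → E.U.node (eU w) (eU w') = h w • D.U.node w w') :
    D.Equivalent E :=
  ⟨⟨eU, h, hl.adjU, hn⟩, ⟨eL, g, hl.adjL, hl.nodeL⟩,
    fun a => Prod.ext (hl.markU a).symm (hm a), fun b => (hl.markL b).symm,
    fun p => Prod.ext (hl.comp p.1) (hl.map p.1 p.2)⟩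

/-- Two lifts with the same images of the marked points and nodes are isomorphic. -/
theorem Lift.equivalent_of_eq {eU : Fin D.U.n ≃ Fin E.U.n} {eL : Fin D.L.n ≃ Fin E.L.n}
    {g : Fin D.L.n → Mob} {h : Fin D.U.n → Mob} (hl : D.Lift E eU eL g h)
    {eU' : Fin D'.U.n ≃ Fin E.U.n} {eL' : Fin D'.L.n ≃ Fin E.L.n}
    {g' : Fin D'.L.n → Mob} {h' : Fin D'.U.n → Mob} (hl' : D'.Lift E eU' eL' g' h')
    (σ : A → P1) (τ : Fin E.U.n → Fin E.U.n → P1)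
    (hm : ∀ a, h (D.U.mark a).1 • (D.U.mark a).2 = σ a)
    (hm' : ∀ a, h' (D'.U.mark a).1 • (D'.U.mark a).2 = σ a)
    (hn : ∀ w w', D.U.graph.Adj w w' → h w • D.U.node w w' = τ (eU w) (eU w'))
    (hn' : ∀ w w', D'.U.graph.Adj w w' → h' w • D'.U.node w w' = τ (eU' w) (eU' w')) :
    D.Equivalent D' := by
  have hinv : ∀ w, eU' (eU'.symm (eU w)) = eU w := fun w => eU'.apply_symm_apply _
  have hinvL : ∀ v, eL' (eL'.symm (eL v)) = eL v := fun v => eL'.apply_symm_apply _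
  have hl'' : D.Lift D' (eU.trans eU'.symm) (eL.trans eL'.symm)
      (fun v => (g' (eL'.symm (eL v)))⁻¹ * g v) (fun w => (h' (eU'.symm (eU w)))⁻¹ * h w) := by
    have hcomp : ∀ w, D'.F.comp (eU'.symm (eU w)) = eL'.symm (eL (D.F.comp w)) := fun w => by
      rw [eq_comm, Equiv.symm_apply_eq, ← hl'.comp, hinv, hl.comp]
    refine ⟨fun w w' => ?_, fun v v' => ?_, fun v v' ha => ?_, fun a => ?_, fun b => ?_, hcomp,
      fun w t => ?_⟩
    · rw [← hl.adjU, ← hl'.adjU, Equiv.trans_apply, Equiv.trans_apply, hinv, hinv]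
    · rw [← hl.adjL, ← hl'.adjL, Equiv.trans_apply, Equiv.trans_apply, hinvL, hinvL]
    · have ha' : D'.L.graph.Adj (eL'.symm (eL v)) (eL'.symm (eL v')) := by
        rw [← hl'.adjL, hinvL, hinvL, hl.adjL]
        exact ha
      have := hl'.nodeL _ _ ha'
      rw [hinvL, hinvL, hl.nodeL _ _ ha] at this
      rw [mul_smul, eq_inv_smul_iff]
      exact this.symm
    · rw [Equiv.trans_apply, eq_comm, Equiv.symm_apply_eq, ← hl.markU, hl'.markU]
    · have h1 := hl.markL b
      rw [hl'.markL b] at h1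
      obtain ⟨h2, h3⟩ := Prod.ext_iff.1 h1
      simp only at h2 h3
      have h4 : (D'.L.mark b).1 = eL'.symm (eL (D.L.mark b).1) := by rw [← h2, Equiv.symm_apply_apply]
      refine Prod.ext h4 ?_
      simp only
      rw [mul_smul, eq_inv_smul_iff, ← h3, ← h4]
    · simp only [Equiv.trans_apply]
      have h1 := hl'.map (eU'.symm (eU w)) (((h' (eU'.symm (eU w)))⁻¹ * h w) • t)
      rw [hinv, mul_smul, smul_inv_smul, hl.map, hcomp] at h1
      rw [mul_smul, mul_smul, eq_inv_smul_iff]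
      exact h1.symm
  refine hl''.equivalent (fun a => ?_) fun w w' ha => ?_
  · have h4 : (D'.U.mark a).1 = eU'.symm (eU (D.U.mark a).1) := hl''.markU a
    rw [mul_smul, inv_smul_eq_iff, ← h4, hm, hm']
  · have ha' := (hl''.adjU w w').2 ha
    have := hn' _ _ ha'
    simp only [Equiv.trans_apply, hinv] at this ⊢
    rw [mul_smul, eq_inv_smul_iff, this, hn _ _ ha]

/-- A lift carries the marks and nodes of `D` into fibres of the cover of `E` over given points.
These fibres are finite, and by `Lift.equivalent_of_eq` the images determine the class. -/
theorem finite_sameType (E : Diagram) :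
    {α | ∃ D, AM.mk D = α ∧ ∃ eU eL, D.SameType E eU eL}.Finite := by
  classical
  have hdeg : ∀ w, (E.F.map w).degree = 1 ∨ (E.F.map w).degree = 2 := fun w =>
    E.deg_eq_one_or_two w
  let Y : Set ((A → P1) × (Fin E.U.n → Fin E.U.n → P1)) :=
    (Set.univ.pi fun a => {t | (E.F.map (E.U.mark a).1).apply t = (E.L.mark (dyn a)).2}) ×ˢ
    -- The value ∞ is added as the default at pairs of components that are not adjacent.
    (Set.univ.pi fun x => Set.univ.pi fun x' => insert OnePoint.infty
      {t | (E.F.map x).apply t = E.L.node (E.F.comp x) (E.F.comp x')})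
  have hY : Y.Finite := (Set.Finite.pi fun a => RatMap.finite_fibre (hdeg _) _).prod
    (Set.Finite.pi fun x => Set.Finite.pi fun x' => (RatMap.finite_fibre (hdeg _) _).insert _)
  refine finite_of_labels hY (fun α σ => ∃ D, AM.mk D = α ∧ ∃ eU eL g h, D.Lift E eU eL g h ∧
    (∀ a, h (D.U.mark a).1 • (D.U.mark a).2 = σ.1 a) ∧
    ∀ w w', D.U.graph.Adj w w' → h w • D.U.node w w' = σ.2 (eU w) (eU w')) ?_ ?_
  · rintro α ⟨D, rfl, eU, eL, hs⟩
    obtain ⟨g, h, hl⟩ := hs.exists_lift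
    refine ⟨(fun a => h (D.U.mark a).1 • (D.U.mark a).2, fun x x' =>
      if D.U.graph.Adj (eU.symm x) (eU.symm x') then
        h (eU.symm x) • D.U.node (eU.symm x) (eU.symm x') else OnePoint.infty), ⟨?_, ?_⟩,
      D, rfl, eU, eL, g, h, hl, fun a => rfl, fun w w' ha => ?_⟩
    · intro a _
      change (E.F.map (E.U.mark a).1).apply (h (D.U.mark a).1 • (D.U.mark a).2) = _
      rw [hl.markU, hl.map, D.apply_mark, hl.markL, D.comp_mark]
    · intro x _ x' _
      simp only
      split_ifs with ha
      · right
        have h1 := hl.map (eU.symm x) (D.U.node (eU.symm x) (eU.symm x'))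
        have h2 := hl.comp (eU.symm x)
        have h3 := hl.comp (eU.symm x')
        rw [Equiv.apply_symm_apply] at h1 h2 h3
        change (E.F.map x).apply _ = _
        rw [h1, D.preAdmissible.node _ _ ha, h2, h3, hl.nodeL _ _ (D.preAdmissible.adj _ _ ha)]
      · exact Or.inl rfl
    · simp only [Equiv.symm_apply_apply, if_pos ha]
  · rintro _ - _ - σ ⟨D, rfl, eU, eL, g, h, hl, hm, hn⟩ ⟨D', rfl, eU', eL', g', h', hl', hm', hn'⟩
    exact Quotient.sound (hl.equivalent_of_eq hl' σ.1 σ.2 hm hm' hn hn')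

/-! ### Finiteness of the exceptional set -/

/-- The finite set of possible positions of the marked points, seen from one component of the lower
curve of an exceptional diagram. -/
def finPos : Set (B → P1) :=
  excPos ∪ Set.univ.pi fun _ => {OnePoint.some 0, OnePoint.some 1, OnePoint.infty}

theorem finPos_finite : finPos.Finite :=
  excPos_finite.union (Set.Finite.pi fun _ => Set.toFinite _)

theorem proj_mem_or_injective {v : Fin D.L.n} {g : Mob} {i j k l : B}
    (h0 : g • D.L.proj v (D.L.mark i) = OnePoint.some 0)
    (h1 : g • D.L.proj v (D.L.mark j) = OnePoint.some 1)
    (h2 : g • D.L.proj v (D.L.mark k) = OnePoint.infty) :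
    g • D.L.proj v (D.L.mark l) ∈ ({OnePoint.some 0, OnePoint.some 1, OnePoint.infty} : Set P1) ∨
      ∃ e : Fin 4 ↪ B, Function.Injective fun n => D.L.proj v (D.L.mark (e n)) := by
  by_cases h : g • D.L.proj v (D.L.mark l) ∈
    ({OnePoint.some 0, OnePoint.some 1, OnePoint.infty} : Set P1)
  · exact Or.inl h
  right
  simp only [Set.mem_insert_iff, Set.mem_singleton_iff, not_or] at h
  have hinj : Function.Injective fun n => D.L.proj v (D.L.mark (![i, j, k, l] n)) := by
    intro m n hmn
    have hmn' : g • D.L.proj v (D.L.mark (![i, j, k, l] m)) =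
      g • D.L.proj v (D.L.mark (![i, j, k, l] n)) := congrArg _ hmn
    obtain ⟨n0, n1, n2⟩ := h
    fin_cases m <;> fin_cases n <;> simp_all
  exact ⟨⟨![i, j, k, l], fun m n hmn => hinj (by simp only [hmn])⟩, hinj⟩

/-- If `v` separates four marks, the lower curve splits off z with one more mark and `exists_excPos`
applies. Otherwise three separated marks are moved to 0, 1, ∞ and every other mark falls on one of
them. -/
theorem Match.exists_finPos {w : Fin D.U.n} {v' : Fin D.L.n} {g : Mob} (h : D.Match w v' g)
    (hD : AM.mk D ∉ V ∪ A₁ ∪ A₂) (v : Fin D.L.n) :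
    ∃ l ∈ finPos, ∃ G : Mob, ∀ b, D.L.proj v (D.L.mark b) = G • l b := by
  by_cases he : ∃ e : Fin 4 ↪ B, Function.Injective fun k => D.L.proj v (D.L.mark (e k))
  · obtain ⟨e, he⟩ := he
    obtain ⟨u, i, hi, hs⟩ := h.exists_split hD he
    obtain ⟨l, hl, G, hG⟩ := h.exists_excPos hs hi
    exact ⟨l, Or.inl hl, G, hG⟩
  · obtain ⟨a, b, c, hab, hac, hbc⟩ := D.stable.exists_three v
    obtain ⟨k, k0, k1, k2⟩ := exists_mob_zero_one_infty hab hac hbc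
    refine ⟨fun b => k • D.L.proj v (D.L.mark b), Or.inr fun b _ => ?_, k⁻¹, fun b => ?_⟩
    · exact (proj_mem_or_injective k0 k1 k2).resolve_right he
    · rw [inv_smul_smul]

/-- A component is determined by a triple of labels that it separates, and there are 5³ triples. -/
theorem L_n_le (D : Diagram) : D.L.n ≤ 125 := by
  choose a b c hab hac hbc using D.stable.exists_three
  have hinj : Function.Injective fun v => (a v, b v, c v) := by
    intro v v' he
    simp only [Prod.mk.injEq] at he
    obtain ⟨e1, e2, e3⟩ := he
    refine D.L.component_unique (hab v) (hac v) (hbc v) ?_ ?_ ?_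
    · rw [e1, e2]; exact hab v'
    · rw [e1, e3]; exact hac v'
    · rw [e2, e3]; exact hbc v'
  have := Fintype.card_le_of_injective _ hinj
  have hB : Fintype.card B = 5 := rfl
  simpa [hB] using this

/-- The degrees over each lower component add up to two, so at most two components lie over it. -/
theorem U_n_le (D : Diagram) : D.U.n ≤ 250 := by
  have h1 : ∑ w, D.deg w = D.L.n * 2 := by
    rw [← Finset.sum_fiberwise (s := Finset.univ) (g := D.F.comp)]
    have : ∀ u, ∑ w with D.F.comp w = u, D.deg w = 2 := D.preAdmissible.degree_eq
    simp [this]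
  have h2 : D.U.n ≤ ∑ w, D.deg w := by
    have := Finset.card_nsmul_le_sum Finset.univ D.deg 1 fun w _ => D.one_le_deg w
    simpa using this
  have := D.L_n_le
  omega

/-- The combinatorial type of a diagram. -/
def code (D : Diagram) : (Fin 251 → Prop) × (Fin 251 → Prop) × (Fin 251 → Fin 251 → Prop) ×
    (Fin 251 → Fin 251 → B → Prop) × (A → Fin 251 → Prop) × (B → Fin 251 → Prop) ×
    (Fin 251 → Fin 251 → Prop) × (Fin 251 → Prop) × (Fin 251 → B → Prop) ×
    (Fin 251 → finPos → Prop) :=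
  -- The bound 250 makes `Fin 251` large enough for the component indices and also for the numbers
  -- of components themselves.
  (fun i => D.U.n = i, fun i => D.L.n = i,
    fun i j => ∃ hi hj, D.U.graph.Adj ⟨i, hi⟩ ⟨j, hj⟩,
    fun i j b => ∃ hi hj, D.L.graph.Adj ⟨i, hi⟩ ⟨j, hj⟩ ∧
      D.L.proj ⟨i, hi⟩ (D.L.mark b) = D.L.node ⟨i, hi⟩ ⟨j, hj⟩,
    fun a i => (D.U.mark a).1.val = i, fun b i => (D.L.mark b).1.val = i,
    fun i j => ∃ hi, (D.F.comp ⟨i, hi⟩).val = j, fun i => ∃ hi, D.deg ⟨i, hi⟩ = 2,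
    fun i b => ∃ hi c, (D.F.map ⟨i, hi⟩).localDegree c = 2 ∧
      (D.F.map ⟨i, hi⟩).apply c = D.L.proj (D.F.comp ⟨i, hi⟩) (D.L.mark b),
    fun i l => ∃ hi, ∃ G : Mob, ∀ b, D.L.proj ⟨i, hi⟩ (D.L.mark b) = G • l.1 b)

/-- The last entry of the code lets both diagrams be compared with the same element of `finPos` on
each lower component, which yields the Möbius maps required in `SameType`. -/
theorem sameType_of_code_eq (hc : D.code = E.code)
    (hD : ∀ v, ∃ l ∈ finPos, ∃ G : Mob, ∀ b, D.L.proj v (D.L.mark b) = G • l b) :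
    ∃ eU eL, D.SameType E eU eL := by
  simp only [code, Prod.mk.injEq, funext_iff, eq_iff_iff] at hc
  obtain ⟨c1, c2, c3, c4, c5, c6, c7, c8, c9, c10⟩ := hc
  have bU : ∀ i : Fin D.U.n, i.val < 251 := fun i => by have := D.U_n_le; omega
  have bL : ∀ i : Fin D.L.n, i.val < 251 := fun i => by have := D.L_n_le; omega
  have hU : D.U.n = E.U.n := ((c1 ⟨D.U.n, by have := D.U_n_le; omega⟩).1 rfl).symm
  have hL : D.L.n = E.L.n := ((c2 ⟨D.L.n, by have := D.L_n_le; omega⟩).1 rfl).symm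
  refine ⟨finCongr hU, finCongr hL, ?_, ?_, ?_, ?_, ?_, ?_, ?_, ?_⟩
  · intro w w'
    have := c3 ⟨w, bU w⟩ ⟨w', bU w'⟩
    constructor
    · intro ha
      obtain ⟨_, _, h⟩ := this.2 ⟨hU ▸ w.2, hU ▸ w'.2, ha⟩
      exact h
    · intro ha
      obtain ⟨_, _, h⟩ := this.1 ⟨w.2, w'.2, ha⟩
      exact h
  · intro v v' b
    have := c4 ⟨v, bL v⟩ ⟨v', bL v'⟩ b
    constructor
    · intro ha
      obtain ⟨_, _, h⟩ := this.2 ⟨hL ▸ v.2, hL ▸ v'.2, ha⟩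
      exact h
    · intro ha
      obtain ⟨_, _, h⟩ := this.1 ⟨v.2, v'.2, ha⟩
      exact h
  · intro a
    exact Fin.ext ((c5 a ⟨(D.U.mark a).1, bU _⟩).1 rfl)
  · intro b
    exact Fin.ext ((c6 b ⟨(D.L.mark b).1, bL _⟩).1 rfl)
  · intro w
    obtain ⟨_, h⟩ := (c7 ⟨w, bU w⟩ ⟨D.F.comp w, bL _⟩).1 ⟨w.2, rfl⟩
    exact Fin.ext h
  · intro w
    have := c8 ⟨w, bU w⟩
    constructor
    · intro ha
      obtain ⟨_, h⟩ := this.2 ⟨hU ▸ w.2, ha⟩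
      exact h
    · intro ha
      obtain ⟨_, h⟩ := this.1 ⟨w.2, ha⟩
      exact h
  · rintro w b ⟨c, h1, h2⟩
    obtain ⟨_, c', h⟩ := (c9 ⟨w, bU w⟩ b).1 ⟨w.2, c, h1, h2⟩
    exact ⟨c', h⟩
  · intro v
    obtain ⟨l, hl, G, hG⟩ := hD v
    obtain ⟨_, G', hG'⟩ := (c10 ⟨v, bL v⟩ ⟨l, hl⟩).1 ⟨v.2, G, hG⟩
    refine ⟨G' * G⁻¹, fun b => ?_⟩
    rw [hG, mul_smul, inv_smul_smul]
    exact hG' b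

/-- Since `finPos` is finite there are finitely many codes, and all exceptional diagrams with one
code have the type of a single diagram. -/
theorem finite_exceptional : (AV \ (V ∪ A₁ ∪ A₂)).Finite := by
  have hfin : Finite finPos := finPos_finite.to_subtype
  have hsub : AV \ (V ∪ A₁ ∪ A₂) ⊆ ⋃ c, {α | ∃ D : Diagram, AM.mk D = α ∧ D.code = c ∧
      ∀ v, ∃ l ∈ finPos, ∃ G : Mob, ∀ b, D.L.proj v (D.L.mark b) = G • l b} := by
    rintro α ⟨⟨D, rfl, S, hU, hL⟩, hD⟩
    obtain ⟨w, v, g, h⟩ := exists_match_of_isStabilization hU hL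
    exact Set.mem_iUnion.2 ⟨D.code, D, rfl, rfl, h.exists_finPos hD⟩
  refine (Set.finite_iUnion fun c => ?_).subset hsub
  by_cases hE : ∃ E : Diagram, E.code = c
  · obtain ⟨E, rfl⟩ := hE
    refine (finite_sameType E).subset ?_
    rintro α ⟨D, rfl, hc, hD⟩
    exact ⟨D, rfl, sameType_of_code_eq hc hD⟩
  · refine Set.finite_empty.subset ?_
    rintro α ⟨D, rfl, hc, -⟩
    exact hE ⟨D, hc⟩

end Diagram

theorem RatMap.exists_sqForm_three {F : RatMap} (hF : F.degree = 2) {p q s : P1}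
    (hp : F.localDegree p = 2) (hq : F.localDegree q = 2) (hpq : p ≠ q) (hsp : s ≠ p)
    (hsq : s ≠ q) : ∃ G H, SqForm F G H ∧ H • p = OnePoint.infty ∧ H • q = OnePoint.some 0 ∧
      H • s = OnePoint.some 1 := by
  obtain ⟨G, H, h, h1, h2⟩ := RatMap.exists_sqForm_infty_zero hF hp hq hpq
  obtain ⟨c, hc⟩ : ∃ c : ℂ, H • s = OnePoint.some c := by
    cases he : H • s using OnePoint.rec with
    | infty => exact absurd (smul_left_cancel _ (he.trans h1.symm)) hsp
    | coe c => exact ⟨c, rfl⟩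
  have hc0 : c ≠ 0 := by
    rintro rfl
    exact hsq (smul_left_cancel _ (hc.trans h2.symm))
  refine ⟨_, _, h.rescale c⁻¹ (inv_ne_zero hc0), ?_, ?_, ?_⟩
  · rw [mul_smul, h1, scale_infty]
  · rw [mul_smul, h2, scale_some, mul_zero]
  · rw [mul_smul, hc, scale_some, inv_mul_cancel₀ hc0]

namespace Diagram

variable {D : Diagram} {v u : Fin D.L.n} {i j : B}

/-! ### Normal forms in the boundary strata -/

/-- The neighbour of `w'` in the direction of `w` lies over `v`, over which `w` is the only
component. -/
theorem adj_of_comp (hs : D.L.Split v u i j) {w w' : Fin D.U.n} (hd : D.deg w = 2)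
    (hw : D.F.comp w = v) (hw' : D.F.comp w' = u) : D.U.graph.Adj w w' := by
  have hne : w ≠ w' := by
    rintro rfl
    exact hs.ne (hw'.symm.trans hw)
  have h1 := Tree.step_adj D.U.isTree hne
  have h2 := D.preAdmissible.adj _ _ h1
  rw [hw'] at h2
  have h3 : D.F.comp (Tree.step D.U.isTree w' w) = D.F.comp w := by
    rw [hw]
    exact (hs.cover _).resolve_right fun e => h2.ne e.symm
  rw [D.eq_of_comp_eq hd h3] at h1
  exact h1.symm

theorem not_adj_of_comp_eq {w w' : Fin D.U.n} (h : D.F.comp w = D.F.comp w') :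
    ¬ D.U.graph.Adj w w' := fun ha => (D.preAdmissible.adj _ _ ha).ne h

theorem exists_split_of_n_eq_two (hn : D.L.n = 2)
    (hne : (D.L.mark i).1 ≠ v) (hij : (D.L.mark i).1 = (D.L.mark j).1)
    (h : ∀ l, ¬ (l = i ∨ l = j) → (D.L.mark l).1 = v) :
    D.L.Split v (D.L.mark i).1 i j := by
  refine ⟨hne, fun w => ?_, ?_, h⟩
  · have h1 := (D.L.mark i).1.2
    have h2 := v.2
    have h3 := w.2
    have h4 : (D.L.mark i).1.val ≠ v.val := fun e => hne (Fin.ext e)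
    rw [Fin.ext_iff, Fin.ext_iff]
    omega
  · rintro l (rfl | rfl)
    · rfl
    · exact hij.symm

/-- Over `v` lies one double cover with branch values ∞ and z, normalized by the mark 1. Over `u`
nothing can ramify, so two lines lie there, attached at points ±c; the number c is the only
parameter. The assumption on the marks decides which line carries both of them. -/
theorem exists_diagram₁ (hs : D.L.Split v u B.zero B.one)
    (hcomp : (D.U.mark A.inf).1 = (D.U.mark A.x).1) :
    ∃ c, ∃ hc : c ∈ TA, (diagram₁ c hc).Equivalent D := by
  have hvinf : (D.L.mark B.inf).1 = v := hs.not_mem _ (by decide)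
  have hvy : (D.L.mark B.y).1 = v := hs.not_mem _ (by decide)
  have hvz : (D.L.mark B.z).1 = v := hs.not_mem _ (by decide)
  have hu0 : (D.L.mark B.zero).1 = u := hs.mem _ (by decide)
  have hu1 : (D.L.mark B.one).1 = u := hs.mem _ (by decide)
  set w := (D.U.mark A.zero).1 with hw
  have hd : D.deg w = 2 := D.deg_mark_zero
  have hwv : D.F.comp w = v := (D.comp_mark _).trans hvinf
  have hw1 : (D.U.mark A.one).1 = w :=
    D.eq_of_comp_eq hd ((D.comp_mark _).trans (hvy.trans hwv.symm))
  obtain ⟨cz, hcz, hcz'⟩ := D.exists_crit_mark (Or.inr rfl) (hwv.trans hvz.symm)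
  have hF0 : (D.F.map w).apply (D.U.mark A.zero).2 = (D.L.mark B.inf).2 := D.apply_mark A.zero
  have hF1 : (D.F.map w).apply (D.U.mark A.one).2 = (D.L.mark B.y).2 := by
    rw [← hw1]
    exact D.apply_mark A.one
  have hne : ∀ b b', b ≠ b' → (D.L.mark b).1 = (D.L.mark b').1 →
      (D.L.mark b).2 ≠ (D.L.mark b').2 := fun b b' hb h1 h2 =>
    hb (D.L.mark_inj (Prod.ext h1 h2))
  obtain ⟨G, H, hF, H0, H1, H2⟩ := RatMap.exists_sqForm_three (s := (D.U.mark A.one).2)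
    hd D.branch_inf hcz
    (fun e => hne B.inf B.z (by simp) (hvinf.trans hvz.symm) (by rw [← hF0, ← hcz', e]))
    (fun e => hne B.y B.inf (by simp) (hvy.trans hvinf.symm) (by rw [← hF0, ← hF1, e]))
    (fun e => hne B.y B.z (by simp) (hvy.trans hvz.symm) (by rw [← hF1, ← hcz', e]))
  have Ginf : G • OnePoint.infty = (D.L.mark B.inf).2 := by rw [← hF0, hF.apply_eq, H0, sq_infty]
  have Gz : G • OnePoint.some 0 = (D.L.mark B.z).2 := by
    rw [← hcz', hF.apply_eq, H1, sq_some, zero_pow two_ne_zero]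
  have Gy : G • OnePoint.some 1 = (D.L.mark B.y).2 := by
    rw [← hF1, hF.apply_eq, H2, sq_some, one_pow]
  have hnode : ∀ b, (D.L.mark b).1 = v → D.L.node v u ≠ (D.L.mark b).2 := by
    rintro b rfl e
    exact D.L.mark_smooth b ⟨u, hs.adj, e.symm⟩
  obtain ⟨w₁, w₂, hw12, hd1, hd2, hfib, hm1⟩ : ∃ w₁ w₂, w₁ ≠ w₂ ∧ D.deg w₁ = 1 ∧ D.deg w₂ = 1 ∧
      (∀ w', D.F.comp w' = u ↔ w' = w₁ ∨ w' = w₂) ∧ (D.U.mark A.inf).1 = w₁ := by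
    rcases D.fibre_cases u with ⟨w', h2, h3⟩ | ⟨w₁, w₂, h1, h2, h3, h4⟩
    · exfalso
      have hwu := (h3 w').2 rfl
      -- A double cover of `u` would have both of its critical values at the single node.
      have key : ∀ c, (D.F.map w').localDegree c = 2 → (D.F.map w').apply c = D.L.node u v := by
        intro c hc
        rcases D.crit_value hc with h1 | h1 | h1
        · rw [hwu] at h1
          exact hs.eq_of_isNode' h1
        · exact absurd (hwu.symm.trans ((congrArg Prod.fst h1).trans hvinf)) hs.ne
        · exact absurd (hwu.symm.trans ((congrArg Prod.fst h1).trans hvz)) hs.ne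
      obtain ⟨c₁, c₂, -, k1, k2, h12, -⟩ := RatMap.exists_crit h2
      exact h12 ((key c₁ k1).trans (key c₂ k2).symm)
    · rcases (h4 (D.U.mark A.inf).1).1 ((D.comp_mark _).trans hu1) with e | e
      · exact ⟨w₁, w₂, h1, h2, h3, h4, e⟩
      · exact ⟨w₂, w₁, h1.symm, h3, h2, fun w' => (h4 w').trans or_comm, e⟩
  have hm2 : (D.U.mark A.x).1 = w₁ := hcomp.symm.trans hm1
  have hc1 : D.F.comp w₁ = u := (hfib _).2 (Or.inl rfl)
  have hc2 : D.F.comp w₂ = u := (hfib _).2 (Or.inr rfl)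
  have a1 := adj_of_comp hs hd hwv hc1
  have a2 := adj_of_comp hs hd hwv hc2
  obtain ⟨M₁, hM₁⟩ := D.exists_apply_eq_smul hd1
  obtain ⟨M₂, hM₂⟩ := D.exists_apply_eq_smul hd2
  have hn1 := D.preAdmissible.node _ _ a1
  have hn2 := D.preAdmissible.node _ _ a2
  have hn1' := D.preAdmissible.node _ _ a1.symm
  have hn2' := D.preAdmissible.node _ _ a2.symm
  rw [hwv, hc1] at hn1 hn1'
  rw [hwv, hc2] at hn2 hn2'
  rw [hM₁] at hn1'
  rw [hM₂] at hn2'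
  rw [hF.apply_eq] at hn1 hn2
  obtain ⟨c, hc⟩ : ∃ c : ℂ, H • D.U.node w w₁ = OnePoint.some c := by
    cases he : H • D.U.node w w₁ using OnePoint.rec with
    | infty =>
      rw [he, sq_infty, Ginf] at hn1
      exact absurd hn1.symm (hnode _ hvinf)
    | coe c => exact ⟨c, rfl⟩
  have hcT : c ∈ TA := by
    rw [hc, sq_some] at hn1
    refine ⟨?_, ?_, ?_⟩
    · rintro rfl
      rw [zero_pow two_ne_zero, Gz] at hn1
      exact hnode _ hvz hn1.symm
    · rintro rfl
      rw [one_pow, Gy] at hn1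
      exact hnode _ hvy hn1.symm
    · rintro rfl
      rw [neg_one_sq, Gy] at hn1
      exact hnode _ hvy hn1.symm
  have hc' : H • D.U.node w w₂ = OnePoint.some (-c) := by
    have h1 := smul_left_cancel _ (hn2.trans hn1.symm)
    rcases sq_eq_sq_iff.1 h1 with h1 | h1
    · exact absurd (D.U.node_inj _ _ _ a2 a1 (smul_left_cancel _ h1)) hw12.symm
    · rw [h1, hc, scale_some, neg_one_mul]
  obtain ⟨K, K0, K1, K2⟩ := exists_mob_three (p₀ := OnePoint.some (0 : ℂ)) (p₁ := OnePoint.some 1)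
    (p₂ := OnePoint.infty) (q₀ := (D.L.mark B.zero).2) (q₁ := (D.L.mark B.one).2)
    (q₂ := D.L.node u v) (by simp) (by simp) (by simp)
    (hne _ _ (by simp) (hu0.trans hu1.symm))
    (fun e => D.L.mark_smooth B.zero ⟨v, by rw [hu0]; exact hs.adj.symm, by rw [hu0]; exact e⟩)
    (fun e => D.L.mark_smooth B.one ⟨v, by rw [hu1]; exact hs.adj.symm, by rw [hu1]; exact e⟩)
  have hFinf : M₁ • (D.U.mark A.inf).2 = (D.L.mark B.one).2 := by
    rw [← hM₁, ← hm1]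
    exact D.apply_mark A.inf
  have hFx : M₁ • (D.U.mark A.x).2 = (D.L.mark B.zero).2 := by
    rw [← hM₁, ← hm2]
    exact D.apply_mark A.x
  have hw1' : w ≠ w₁ := a1.ne
  have hw2' : w ≠ w₂ := a2.ne
  have hbijU : Function.Bijective (![w, w₁, w₂] : Fin 3 → Fin D.U.n) := by
    refine ⟨fun i j hij => ?_, fun w' => ?_⟩
    · fin_cases i <;> fin_cases j <;> simp_all
    · rcases hs.cover (D.F.comp w') with h | h
      · exact ⟨0, (D.eq_of_comp_eq hd (h.trans hwv.symm)).symm⟩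
      · rcases (hfib _).1 h with h | h
        · exact ⟨1, h.symm⟩
        · exact ⟨2, h.symm⟩
  have hbijL : Function.Bijective (![v, u] : Fin 2 → Fin D.L.n) := by
    have := hs.ne
    have := hs.ne.symm
    refine ⟨fun i j hij => ?_, fun v' => ?_⟩
    · fin_cases i <;> fin_cases j <;> simp_all
    · rcases hs.cover v' with h | h
      · exact ⟨0, h.symm⟩
      · exact ⟨1, h.symm⟩
  have hUadj : ∀ i j : Fin 3, D.U.graph.Adj (![w, w₁, w₂] i) (![w, w₁, w₂] j) ↔
      i ≠ j ∧ (i = 0 ∨ j = 0) := by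
    have e12 : ¬ D.U.graph.Adj w₁ w₂ := not_adj_of_comp_eq (hc1.trans hc2.symm)
    have e21 : ¬ D.U.graph.Adj w₂ w₁ := not_adj_of_comp_eq (hc2.trans hc1.symm)
    intro i j
    fin_cases i <;> fin_cases j <;> simp [a1, a2, a1.symm, a2.symm, e12, e21]
  have hLadj : ∀ i j : Fin 2, D.L.graph.Adj (![v, u] i) (![v, u] j) ↔ i ≠ j := by
    intro i j
    fin_cases i <;> fin_cases j <;> simp [hs.adj, hs.adj.symm]
  refine ⟨c, hcT, Lift.equivalent (eU := Equiv.ofBijective _ hbijU) (eL := Equiv.ofBijective _ hbijL)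
    (g := ![G, K]) (h := ![H⁻¹, M₁⁻¹ * K, M₂⁻¹ * K]) ⟨?_, ?_, ?_, ?_, ?_, ?_, ?_⟩ ?_ ?_⟩
  · intro i j
    exact (hUadj i j).trans SimpleGraph.starGraph_adj.symm
  · intro i j
    exact hLadj i j
  · intro i j hij
    change Fin 2 at i j
    change i ≠ j at hij
    change D.L.node (![v, u] i) (![v, u] j) =
      (![G, K] : Fin 2 → Mob) i • (if i = 0 then OnePoint.some (c ^ 2) else OnePoint.infty)
    rw [hc, sq_some] at hn1
    fin_cases i <;> fin_cases j <;> simp_all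
  · intro a
    change _ = (![w, w₁, w₂] : Fin 3 → Fin D.U.n) (upos₁ a).1
    cases a <;> simp [upos₁, hw1, hm1, hm2, hw]
  · intro b
    change _ = ((![v, u] : Fin 2 → Fin D.L.n) (lpos₁ b).1, (![G, K] : Fin 2 → Mob) (lpos₁ b).1 •
      (lpos₁ b).2)
    cases b <;> refine Prod.ext ?_ ?_ <;> simp [lpos₁, *]
  · intro i
    change Fin 3 at i
    change D.F.comp (![w, w₁, w₂] i) = (![v, u] : Fin 2 → Fin D.L.n) (comp₁ i)
    fin_cases i <;> simp [comp₁, hwv, hc1, hc2]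
  · intro i t
    change Fin 3 at i
    change (D.F.map (![w, w₁, w₂] i)).apply
      ((![H⁻¹, M₁⁻¹ * K, M₂⁻¹ * K] : Fin 3 → Mob) i • t) =
      (![G, K] : Fin 2 → Mob) (comp₁ i) • (map₁ i).apply t
    fin_cases i
    · simp [comp₁, map₁, hF.apply_eq]
    · simp [comp₁, map₁, hM₁, mul_smul]
    · simp [comp₁, map₁, hM₂, mul_smul]
  · intro a
    change (![H⁻¹, M₁⁻¹ * K, M₂⁻¹ * K] : Fin 3 → Mob) (upos₁ a).1 • (upos₁ a).2 = _
    cases a <;> simp [upos₁, inv_smul_eq_iff, mul_smul, *]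
  · intro i j hij
    change Fin 3 at i j
    obtain ⟨h1, h2⟩ := curveU₁_adj (hc := hcT) hij
    change D.U.node (![w, w₁, w₂] i) (![w, w₁, w₂] j) =
      (![H⁻¹, M₁⁻¹ * K, M₂⁻¹ * K] : Fin 3 → Mob) i • (if i = 0 then if j = 1 then OnePoint.some c
        else OnePoint.some (-c) else OnePoint.infty)
    fin_cases i <;> fin_cases j <;> simp_all [eq_inv_smul_iff, mul_smul]

/-- Each lower component carries one of the branch values z and ∞, so both double covers ramify at
the node as well. Node, critical mark or critical point, and one further mark fix the coordinates;
the position c of the mark x remains free. -/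
theorem exists_diagram₂ (hs : D.L.Split v u B.inf B.y) :
    ∃ c, ∃ hc : c ∈ TA, (diagram₂ c hc).Equivalent D := by
  have hv0 : (D.L.mark B.zero).1 = v := hs.not_mem _ (by decide)
  have hv1 : (D.L.mark B.one).1 = v := hs.not_mem _ (by decide)
  have hvz : (D.L.mark B.z).1 = v := hs.not_mem _ (by decide)
  have huinf : (D.L.mark B.inf).1 = u := hs.mem _ (by decide)
  have huy : (D.L.mark B.y).1 = u := hs.mem _ (by decide)
  obtain ⟨w₁, hc1⟩ := D.exists_comp v
  have hd1 : D.deg w₁ = 2 := D.deg_eq_two_of_mem (Or.inr (hc1.trans hvz.symm))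
  set w₂ := (D.U.mark A.zero).1 with hw₂
  have hd2 : D.deg w₂ = 2 := D.deg_mark_zero
  have hc2 : D.F.comp w₂ = u := (D.comp_mark _).trans huinf
  have hm1 : (D.U.mark A.inf).1 = w₁ :=
    D.eq_of_comp_eq hd1 ((D.comp_mark _).trans (hv1.trans hc1.symm))
  have hmx : (D.U.mark A.x).1 = w₁ :=
    D.eq_of_comp_eq hd1 ((D.comp_mark _).trans (hv0.trans hc1.symm))
  have hmo : (D.U.mark A.one).1 = w₂ :=
    D.eq_of_comp_eq hd2 ((D.comp_mark _).trans (huy.trans hc2.symm))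
  have ha := adj_of_comp hs hd1 hc1 hc2
  have hcover : ∀ w, w = w₁ ∨ w = w₂ := fun w =>
    (hs.cover (D.F.comp w)).imp (fun h => D.eq_of_comp_eq hd1 (h.trans hc1.symm))
      (fun h => D.eq_of_comp_eq hd2 (h.trans hc2.symm))
  have hF0 : (D.F.map w₂).apply (D.U.mark A.zero).2 = (D.L.mark B.inf).2 := D.apply_mark A.zero
  have hFo : (D.F.map w₂).apply (D.U.mark A.one).2 = (D.L.mark B.y).2 := by
    rw [← hmo]
    exact D.apply_mark A.one
  have hFi : (D.F.map w₁).apply (D.U.mark A.inf).2 = (D.L.mark B.one).2 := by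
    rw [← hm1]
    exact D.apply_mark A.inf
  have hFx : (D.F.map w₁).apply (D.U.mark A.x).2 = (D.L.mark B.zero).2 := by
    rw [← hmx]
    exact D.apply_mark A.x
  have hne : ∀ b b', b ≠ b' → (D.L.mark b).1 = (D.L.mark b').1 →
      (D.L.mark b).2 ≠ (D.L.mark b').2 := fun b b' hb h1 h2 =>
    hb (D.L.mark_inj (Prod.ext h1 h2))
  have hnv : ∀ b, (D.L.mark b).1 = v → (D.L.mark b).2 ≠ D.L.node v u := by
    rintro b rfl e
    exact D.L.mark_smooth b ⟨u, hs.adj, e⟩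
  have hnu : ∀ b, (D.L.mark b).1 = u → (D.L.mark b).2 ≠ D.L.node u v := by
    rintro b rfl e
    exact D.L.mark_smooth b ⟨v, hs.adj.symm, e⟩
  have hn1 := D.preAdmissible.node _ _ ha
  have hn2 := D.preAdmissible.node _ _ ha.symm
  rw [hc1, hc2] at hn1 hn2
  -- A double cover has two critical points, and only the one over z and the node are possible.
  have hnode1 : (D.F.map w₁).localDegree (D.U.node w₁ w₂) = 2 := by
    obtain ⟨cz, hcz, hcz'⟩ := D.exists_crit_mark (Or.inr rfl) (hc1.trans hvz.symm)
    have key : ∀ c, (D.F.map w₁).localDegree c = 2 → c = cz ∨ c = D.U.node w₁ w₂ := by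
      intro c hc
      rcases D.crit_value hc with h1 | h1 | h1
      · obtain ⟨w, hw, e⟩ := (D.isNode_iff (p := (w₁, c))).2 h1
        rcases hcover w with rfl | rfl
        · exact absurd rfl hw.ne
        · exact Or.inr e
      · exact absurd (hc1.symm.trans ((congrArg Prod.fst h1).trans huinf)) hs.ne.symm
      · left
        refine RatMap.eq_of_apply_eq_crit hd1 hcz ?_
        rw [hcz']
        exact congrArg Prod.snd h1
    obtain ⟨c₁, c₂, h12, k1, k2, -, -⟩ := RatMap.exists_crit hd1
    rcases key c₁ k1 with e | e
    · rcases key c₂ k2 with e' | e'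
      · exact absurd (e.trans e'.symm) h12
      · rwa [← e']
    · rwa [← e]
  have hnode2 : (D.F.map w₂).localDegree (D.U.node w₂ w₁) = 2 :=
    (D.preAdmissible.localDegree_eq _ _ ha).symm.trans hnode1
  obtain ⟨cz, hcz, hcz'⟩ := D.exists_crit_mark (Or.inr rfl) (hc1.trans hvz.symm)
  obtain ⟨G₁, H₁, hF1, H10, H11, H12⟩ := RatMap.exists_sqForm_three (s := (D.U.mark A.inf).2)
    hd1 hnode1 hcz (fun e => hnv B.z hvz (by rw [← hcz', ← hn1, e]))
    (fun e => hnv B.one hv1 (by rw [← hFi, ← hn1, e]))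
    (fun e => hne B.one B.z (by simp) (hv1.trans hvz.symm) (by rw [← hFi, ← hcz', e]))
  obtain ⟨G₂, H₂, hF2, H20, H21, H22⟩ := RatMap.exists_sqForm_three (s := (D.U.mark A.one).2)
    hd2 D.branch_inf hnode2 (fun e => hnu B.inf huinf (by rw [← hF0, ← hn2, e]))
    (fun e => hne B.y B.inf (by simp) (huy.trans huinf.symm) (by rw [← hFo, ← hF0, e]))
    (fun e => hnu B.y huy (by rw [← hFo, ← hn2, e]))
  have G1n : G₁ • OnePoint.infty = D.L.node v u := by rw [← hn1, hF1.apply_eq, H10, sq_infty]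
  have G1z : G₁ • OnePoint.some 0 = (D.L.mark B.z).2 := by
    rw [← hcz', hF1.apply_eq, H11, sq_some, zero_pow two_ne_zero]
  have G11 : G₁ • OnePoint.some 1 = (D.L.mark B.one).2 := by
    rw [← hFi, hF1.apply_eq, H12, sq_some, one_pow]
  have G2i : G₂ • OnePoint.infty = (D.L.mark B.inf).2 := by
    rw [← hF0, hF2.apply_eq, H20, sq_infty]
  have G2n : G₂ • OnePoint.some 0 = D.L.node u v := by
    rw [← hn2, hF2.apply_eq, H21, sq_some, zero_pow two_ne_zero]
  have G2y : G₂ • OnePoint.some 1 = (D.L.mark B.y).2 := by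
    rw [← hFo, hF2.apply_eq, H22, sq_some, one_pow]
  obtain ⟨c, hc⟩ : ∃ c : ℂ, H₁ • (D.U.mark A.x).2 = OnePoint.some c := by
    cases he : H₁ • (D.U.mark A.x).2 using OnePoint.rec with
    | infty =>
      rw [hF1.apply_eq, he, sq_infty, G1n] at hFx
      exact absurd hFx.symm (hnv _ hv0)
    | coe c => exact ⟨c, rfl⟩
  have G1x : G₁ • OnePoint.some (c ^ 2) = (D.L.mark B.zero).2 := by
    rw [← hFx, hF1.apply_eq, hc, sq_some]
  have hcT : c ∈ TA := by
    refine ⟨?_, ?_, ?_⟩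
    · rintro rfl
      rw [zero_pow two_ne_zero, G1z] at G1x
      exact hne B.z B.zero (by simp) (hvz.trans hv0.symm) G1x
    · rintro rfl
      rw [one_pow, G11] at G1x
      exact hne B.one B.zero (by simp) (hv1.trans hv0.symm) G1x
    · rintro rfl
      rw [neg_one_sq, G11] at G1x
      exact hne B.one B.zero (by simp) (hv1.trans hv0.symm) G1x
  have hwne := ha.ne
  have hbijU : Function.Bijective (![w₁, w₂] : Fin 2 → Fin D.U.n) := by
    refine ⟨fun i j hij => ?_, fun w' => ?_⟩
    · fin_cases i <;> fin_cases j <;> simp_all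
    · rcases hcover w' with h | h
      · exact ⟨0, h.symm⟩
      · exact ⟨1, h.symm⟩
  have hbijL : Function.Bijective (![v, u] : Fin 2 → Fin D.L.n) := by
    have := hs.ne
    have := hs.ne.symm
    refine ⟨fun i j hij => ?_, fun v' => ?_⟩
    · fin_cases i <;> fin_cases j <;> simp_all
    · rcases hs.cover v' with h | h
      · exact ⟨0, h.symm⟩
      · exact ⟨1, h.symm⟩
  have hUadj : ∀ i j : Fin 2, D.U.graph.Adj (![w₁, w₂] i) (![w₁, w₂] j) ↔ i ≠ j := by
    intro i j
    fin_cases i <;> fin_cases j <;> simp [ha, ha.symm]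
  have hLadj : ∀ i j : Fin 2, D.L.graph.Adj (![v, u] i) (![v, u] j) ↔ i ≠ j := by
    intro i j
    fin_cases i <;> fin_cases j <;> simp [hs.adj, hs.adj.symm]
  refine ⟨c, hcT, Lift.equivalent (eU := Equiv.ofBijective _ hbijU) (eL := Equiv.ofBijective _ hbijL)
    (g := ![G₁, G₂]) (h := ![H₁⁻¹, H₂⁻¹]) ⟨?_, ?_, ?_, ?_, ?_, ?_, ?_⟩ ?_ ?_⟩
  · intro i j
    exact hUadj i j
  · intro i j
    exact hLadj i j
  · intro i j hij
    change Fin 2 at i j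
    change i ≠ j at hij
    change D.L.node (![v, u] i) (![v, u] j) =
      (![G₁, G₂] : Fin 2 → Mob) i • (if i = 0 then OnePoint.infty else OnePoint.some 0)
    fin_cases i <;> fin_cases j <;> simp_all
  · intro a
    change _ = (![w₁, w₂] : Fin 2 → Fin D.U.n) (upos₂ c a).1
    cases a <;> simp [upos₂, hm1, hmx, hmo, hw₂]
  · intro b
    change _ = ((![v, u] : Fin 2 → Fin D.L.n) (lpos₂ c b).1,
      (![G₁, G₂] : Fin 2 → Mob) (lpos₂ c b).1 • (lpos₂ c b).2)
    cases b <;> refine Prod.ext ?_ ?_ <;>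
      simp only [lpos₂, Matrix.cons_val_zero, Matrix.cons_val_one, *]
  · intro i
    change Fin 2 at i
    change D.F.comp (![w₁, w₂] i) = (![v, u] : Fin 2 → Fin D.L.n) i
    fin_cases i <;> simp [hc1, hc2]
  · intro i t
    change Fin 2 at i
    change (D.F.map (![w₁, w₂] i)).apply ((![H₁⁻¹, H₂⁻¹] : Fin 2 → Mob) i • t) =
      (![G₁, G₂] : Fin 2 → Mob) i • sqRat.apply t
    fin_cases i
    · simp [hF1.apply_eq]
    · simp [hF2.apply_eq]
  · intro a
    change (![H₁⁻¹, H₂⁻¹] : Fin 2 → Mob) (upos₂ c a).1 • (upos₂ c a).2 = _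
    cases a <;> simp [upos₂, inv_smul_eq_iff, *]
  · intro i j hij
    change Fin 2 at i j
    change i ≠ j at hij
    change D.U.node (![w₁, w₂] i) (![w₁, w₂] j) =
      (![H₁⁻¹, H₂⁻¹] : Fin 2 → Mob) i • (if i = 0 then OnePoint.infty else OnePoint.some 0)
    fin_cases i <;> fin_cases j <;> simp_all [eq_inv_smul_iff]

end Diagram

/-! ### The three families -/

theorem two_mem_TA : (2 : ℂ) ∈ TA := by
  refine ⟨?_, ?_, ?_⟩ <;> norm_num

theorem two_mem_TV : (2 : ℂ) ∈ TV := by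
  refine ⟨?_, ?_, ?_, ?_, ?_, ?_⟩ <;> norm_num [vp, vq, vr]

open Classical in
/-- The family of diagrams on the diagonal. -/
def familyV (x : ℂ) : Diagram := if h : x ∈ TV then diagramV x h else diagramV 2 two_mem_TV

open Classical in
/-- The family of diagrams in the first boundary stratum. -/
def family₁ (c : ℂ) : Diagram := if h : c ∈ TA then diagram₁ c h else diagram₁ 2 two_mem_TA

open Classical in
/-- The family of diagrams in the second boundary stratum. -/
def family₂ (c : ℂ) : Diagram := if h : c ∈ TA then diagram₂ c h else diagram₂ 2 two_mem_TA

theorem familyV_of_mem {x : ℂ} (hx : x ∈ TV) : familyV x = diagramV x hx := dif_pos hx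

theorem family₁_of_mem {c : ℂ} (hc : c ∈ TA) : family₁ c = diagram₁ c hc := dif_pos hc

theorem family₂_of_mem {c : ℂ} (hc : c ∈ TA) : family₂ c = diagram₂ c hc := dif_pos hc

theorem V_eq : V = (fun x => AM.mk (familyV x)) '' TV := by
  ext α
  constructor
  · rintro ⟨D, rfl, hU, hL, x, ⟨u0, u1, u2, u3⟩, l0, l1, l2, l3⟩
    have sU : ∀ w w' : Fin D.U.n, w = w' := fun w w' => Fin.ext (by omega)
    have sL : ∀ w w' : Fin D.L.n, w = w' := fun w w' => Fin.ext (by omega)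
    set w := (D.U.mark A.zero).1
    set v := (D.L.mark B.zero).1
    have hm : D.Match w v 1 := by
      refine ⟨fun a => ?_, A.zero, A.one, A.inf, ?_, ?_, ?_⟩
      · rw [one_smul, D.U.proj_of_eq (sU _ _), D.L.proj_of_eq (sL _ _)]
        cases a
        · exact u0.trans l0.symm
        · exact u1.trans l1.symm
        · exact u2.trans l2.symm
        · exact u3.trans l3.symm
      · rw [D.L.proj_of_eq (sL _ _), D.L.proj_of_eq (sL _ _), iota_zero, iota_one, l0, l1]
        simp
      · rw [D.L.proj_of_eq (sL _ _), D.L.proj_of_eq (sL _ _), iota_zero, iota_inf, l0, l2]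
        simp
      · rw [D.L.proj_of_eq (sL _ _), D.L.proj_of_eq (sL _ _), iota_one, iota_inf, l1, l2]
        simp
    have hinj : Function.Injective fun b => D.L.proj v (D.L.mark b) := by
      intro b b' he
      simp only [D.L.proj_of_eq (sL _ _)] at he
      exact D.L.mark_inj (Prod.ext (sL _ _) he)
    obtain ⟨x, hx, hE⟩ := hm.exists_diagramV hinj
    refine ⟨x, hx, ?_⟩
    simp only
    rw [familyV_of_mem hx]
    exact Quotient.sound hE
  · rintro ⟨x, hx, rfl⟩
    simp only
    rw [familyV_of_mem hx]
    exact diagramV_mem hx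

theorem A₁_eq : A₁ = (fun c => AM.mk (family₁ c)) '' TA := by
  ext α
  constructor
  · rintro ⟨D, rfl, hn, h1, h2, h3, h4, h5⟩
    obtain ⟨c, hc, hE⟩ := Diagram.exists_diagram₁ (Diagram.exists_split_of_n_eq_two
      (v := (D.L.mark B.inf).1) hn h4.symm h3 (by
        intro l hl
        cases l
        · exact absurd (Or.inl rfl) hl
        · exact absurd (Or.inr rfl) hl
        · rfl
        · exact h1.symm
        · exact h2.symm)) h5
    refine ⟨c, hc, ?_⟩
    simp only
    rw [family₁_of_mem hc]
    exact Quotient.sound hE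
  · rintro ⟨c, hc, rfl⟩
    simp only
    rw [family₁_of_mem hc]
    exact ⟨_, rfl, rfl, rfl, rfl, rfl, (by decide : (0 : Fin 2) ≠ 1), rfl⟩

theorem A₂_eq : A₂ = (fun c => AM.mk (family₂ c)) '' TA := by
  ext α
  constructor
  · rintro ⟨D, rfl, hn, h1, h2, h3, h4⟩
    obtain ⟨c, hc, hE⟩ := Diagram.exists_diagram₂ (Diagram.exists_split_of_n_eq_two
      (v := (D.L.mark B.zero).1) (i := B.inf) (j := B.y) hn (h3 ▸ h4.symm) h3.symm (by
        intro l hl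
        cases l
        · rfl
        · exact h1.symm
        · exact absurd (Or.inl rfl) hl
        · exact absurd (Or.inr rfl) hl
        · exact h2.symm))
    refine ⟨c, hc, ?_⟩
    simp only
    rw [family₂_of_mem hc]
    exact Quotient.sound hE
  · rintro ⟨c, hc, rfl⟩
    simp only
    rw [family₂_of_mem hc]
    exact ⟨_, rfl, rfl, rfl, rfl, rfl, (by decide : (0 : Fin 2) ≠ 1)⟩

/-! ### The families lie in the equalizer -/

theorem MarkedCurve.IsStable.isStabilization {Λ : Type} {C : MarkedCurve Λ} (hC : C.IsStable) :
    C.IsStabilization C := by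
  refine ⟨hC, id, fun p q h => h, fun l => rfl, fun v => Or.inr ⟨v, 1, fun t => ?_⟩,
    fun v => ⟨v, ⟨1, fun t => ?_⟩, ?_⟩⟩
  · rw [one_smul]; rfl
  · rw [one_smul]; rfl
  · rintro v' ⟨g, hg⟩
    exact congrArg Prod.fst (hg OnePoint.infty)

theorem mob_not_const (g : Mob) (q : P1) : ∃ t, q ≠ g • t := by
  by_contra! h
  have := (h OnePoint.infty).symm.trans (h (OnePoint.some 0))
  exact absurd (smul_left_cancel _ this) (by simp)

/-- With 0, 1, ∞ normalized and x = y, the upper curve and the lower curve without z are the same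
stable marked curve. -/
theorem diagramV_mem_AV {x : ℂ} (hx : x ∈ TV) : AM.mk (diagramV x hx) ∈ AV := by
  have hs : (diagramV x hx).U.IsStable := by
    intro v
    have hv : v = (0 : Fin 1) := Subsingleton.elim (α := Fin 1) _ _
    subst hv
    exact three_le_encard (Or.inr ⟨A.zero, diagramV_mark_U hx _⟩)
      (Or.inr ⟨A.one, diagramV_mark_U hx _⟩) (Or.inr ⟨A.inf, diagramV_mark_U hx _⟩)
      (by simp [normU]) (by simp [normU]) (by simp [normU])
  have hm : (diagramV x hx).U.mark = ((diagramV x hx).L.restrict iota).mark :=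
    funext fun a => (diagramV_mark_U hx a).trans (diagramV_mark_L hx a).symm
  have key : ∀ (m m' : A → line.Pt) (h1 h2 h1' h2'), m = m' →
      (⟨line, m, h1, h2⟩ : MarkedCurve A) = ⟨line, m', h1', h2'⟩ := by
    intro m m' _ _ _ _ e
    subst e
    rfl
  have he : (diagramV x hx).U = (diagramV x hx).L.restrict iota := key _ _ _ _ _ _ hm
  exact ⟨_, rfl, _, hs.isStabilization, he ▸ hs.isStabilization⟩

/-- Component 2 above carries no mark of `A` and is contracted. The double cover component becomes
the lower component with 0 and 1, and component 1 becomes the one with ∞ and y: the two lower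
components appear in exchanged roles. -/
theorem diagram₁_mem_AV {c : ℂ} (hc : c ∈ TA) : AM.mk (diagram₁ c hc) ∈ AV := by
  obtain ⟨h0, h1, h2⟩ := hc
  have hc : c ∈ TA := ⟨h0, h1, h2⟩
  obtain ⟨q0, q1⟩ := sq_ne_of_mem_TA hc
  have hs : ((diagram₁ c hc).L.restrict iota).IsStable := by
    intro v
    change Fin 2 at v
    fin_cases v
    · exact three_le_encard (c := OnePoint.some (c ^ 2)) (Or.inr ⟨A.inf, rfl⟩) (Or.inr ⟨A.x, rfl⟩)
        (Or.inl (curveL₁_isNode_iff.2 (Or.inl ⟨rfl, rfl⟩))) (by simp) (by simp)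
        (by simpa using q1.symm)
    · exact three_le_encard (c := OnePoint.infty) (Or.inr ⟨A.zero, rfl⟩) (Or.inr ⟨A.one, rfl⟩)
        (Or.inl (curveL₁_isNode_iff.2 (Or.inr ⟨rfl, rfl⟩))) (by simp) (by simp) (by simp)
  obtain ⟨g, g0, g1, g2⟩ := exists_mob_three (p₀ := OnePoint.infty) (p₁ := OnePoint.some 1)
    (p₂ := OnePoint.some c) (q₀ := OnePoint.some 0) (q₁ := OnePoint.some (1 : ℂ))
    (q₂ := OnePoint.infty) (by simp) (by simp) (by simpa using h1.symm) (by simp) (by simp) (by simp)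
  obtain ⟨k, k0, k1, k2⟩ := exists_mob_three (p₀ := OnePoint.some (1 : ℂ)) (p₁ := OnePoint.some 0)
    (p₂ := OnePoint.infty) (q₀ := OnePoint.infty) (q₁ := OnePoint.some 1)
    (q₂ := OnePoint.some (c ^ 2)) (by simp) (by simp) (by simp) (by simp) (by simp)
    (by simpa using q1.symm)
  let κ : Fin 3 × P1 → Fin 2 × P1 := fun p =>
    ((![1, 0, 1] : Fin 3 → Fin 2) p.1,
      (![g • p.2, k • p.2, g • OnePoint.some (-c)] : Fin 3 → P1) p.1)
  have e0 : ∀ t, κ (0, t) = (1, g • t) := fun t => rfl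
  have e1 : ∀ t, κ (1, t) = (0, k • t) := fun t => rfl
  have e2 : ∀ t, κ (2, t) = (1, g • OnePoint.some (-c)) := fun t => rfl
  refine ⟨_, rfl, _, ⟨hs, κ, ?_, ?_, ?_, ?_⟩, hs.isStabilization⟩
  · rintro ⟨i, s⟩ ⟨j, t⟩ (h | ⟨ha, h1, h2⟩)
    · exact Or.inl (congrArg κ h)
    · change Fin 3 at i j
      obtain ⟨h3, h4⟩ := curveU₁_adj (hc := hc) ha
      change s = (if i = 0 then if j = 1 then OnePoint.some c else OnePoint.some (-c)
        else OnePoint.infty) at h1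
      change t = (if j = 0 then if i = 1 then OnePoint.some c else OnePoint.some (-c)
        else OnePoint.infty) at h2
      change κ (i, s) = κ (j, t) ∨ ((κ (i, s)).1 ≠ (κ (j, t)).1 ∧
        (κ (i, s)).2 = (if (κ (i, s)).1 = (0 : Fin 2) then OnePoint.some (c ^ 2)
          else OnePoint.infty) ∧
        (κ (j, t)).2 = (if (κ (j, t)).1 = (0 : Fin 2) then OnePoint.some (c ^ 2)
          else OnePoint.infty))
      fin_cases i <;> fin_cases j <;> simp_all [κ]
  · intro a
    change κ (upos₁ a) = lpos₁ (iota a)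
    cases a <;> simp [upos₁, lpos₁, κ, *]
  · intro i
    change Fin 3 at i
    fin_cases i
    · exact Or.inr ⟨(1 : Fin 2), g, e0⟩
    · exact Or.inr ⟨(0 : Fin 2), k, e1⟩
    · exact Or.inl ⟨_, e2⟩
  · intro i
    change Fin 2 at i
    have n2 : ∀ (m : Mob) (j : Fin 2), ¬ ∀ t, κ (2, t) = (j, m • t) := by
      intro m j h
      obtain ⟨t, ht⟩ := mob_not_const m (g • OnePoint.some (-c))
      exact ht (congrArg Prod.snd (h t))
    fin_cases i
    · refine ⟨(1 : Fin 3), ⟨k, e1⟩, ?_⟩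
      rintro j ⟨m, hm⟩
      change Fin 3 at j
      fin_cases j
      · exact absurd (congrArg Prod.fst (hm OnePoint.infty)) (by decide : (1 : Fin 2) ≠ 0)
      · rfl
      · exact absurd hm (n2 m _)
    · refine ⟨(0 : Fin 3), ⟨g, e0⟩, ?_⟩
      rintro j ⟨m, hm⟩
      change Fin 3 at j
      fin_cases j
      · rfl
      · exact absurd (congrArg Prod.fst (hm OnePoint.infty)) (by decide : (0 : Fin 2) ≠ 1)
      · exact absurd hm (n2 m _)

/-- Nothing is contracted, and again the isomorphism exchanges the components: the marks 0, 1 lie on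
component 1 above and on component 0 below. -/
theorem diagram₂_mem_AV {c : ℂ} (hc : c ∈ TA) : AM.mk (diagram₂ c hc) ∈ AV := by
  obtain ⟨h0, h1, h2⟩ := hc
  have hc : c ∈ TA := ⟨h0, h1, h2⟩
  obtain ⟨q0, q1⟩ := sq_ne_of_mem_TA hc
  have hs : ((diagram₂ c hc).L.restrict iota).IsStable := by
    intro v
    change Fin 2 at v
    fin_cases v
    · exact three_le_encard (c := OnePoint.infty) (Or.inr ⟨A.zero, rfl⟩) (Or.inr ⟨A.one, rfl⟩)
        (Or.inl (curve₂_isNode_iff.2 (Or.inl ⟨rfl, rfl⟩))) (by simpa using q1) (by simp) (by simp)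
    · exact three_le_encard (c := OnePoint.some 0) (Or.inr ⟨A.inf, rfl⟩) (Or.inr ⟨A.x, rfl⟩)
        (Or.inl (curve₂_isNode_iff.2 (Or.inr ⟨rfl, rfl⟩))) (by simp) (by simp) (by simp)
  obtain ⟨g, g0, g1, g2⟩ := exists_mob_three (p₀ := OnePoint.infty) (p₁ := OnePoint.some 1)
    (p₂ := OnePoint.some c) (q₀ := OnePoint.some (0 : ℂ)) (q₁ := OnePoint.infty)
    (q₂ := OnePoint.some 1) (by simp) (by simp) (by simpa using h1.symm) (by simp) (by simp) (by simp)
  obtain ⟨k, k0, k1, k2⟩ := exists_mob_three (p₀ := OnePoint.some (0 : ℂ)) (p₁ := OnePoint.some 1)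
    (p₂ := OnePoint.infty) (q₀ := OnePoint.infty) (q₁ := OnePoint.some 1)
    (q₂ := OnePoint.some (c ^ 2)) (by simp) (by simp) (by simp) (by simp) (by simp)
    (by simpa using q1.symm)
  let κ : Fin 2 × P1 → Fin 2 × P1 := fun p =>
    ((![1, 0] : Fin 2 → Fin 2) p.1, (![g • p.2, k • p.2] : Fin 2 → P1) p.1)
  have e0 : ∀ t, κ (0, t) = (1, g • t) := fun t => rfl
  have e1 : ∀ t, κ (1, t) = (0, k • t) := fun t => rfl
  refine ⟨_, rfl, _, ⟨hs, κ, ?_, ?_, ?_, ?_⟩, hs.isStabilization⟩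
  · rintro ⟨i, s⟩ ⟨j, t⟩ (h | ⟨ha, h1, h2⟩)
    · exact Or.inl (congrArg κ h)
    · change Fin 2 at i j
      change i ≠ j at ha
      change s = (if i = 0 then OnePoint.infty else OnePoint.some 0) at h1
      change t = (if j = 0 then OnePoint.infty else OnePoint.some 0) at h2
      change κ (i, s) = κ (j, t) ∨ ((κ (i, s)).1 ≠ (κ (j, t)).1 ∧
        (κ (i, s)).2 = (if (κ (i, s)).1 = (0 : Fin 2) then OnePoint.infty
          else OnePoint.some 0) ∧
        (κ (j, t)).2 = (if (κ (j, t)).1 = (0 : Fin 2) then OnePoint.infty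
          else OnePoint.some 0))
      fin_cases i <;> fin_cases j <;> simp_all [κ]
  · intro a
    change κ (upos₂ c a) = lpos₂ c (iota a)
    cases a <;> simp [upos₂, lpos₂, κ, *]
  · intro i
    change Fin 2 at i
    fin_cases i
    · exact Or.inr ⟨(1 : Fin 2), g, e0⟩
    · exact Or.inr ⟨(0 : Fin 2), k, e1⟩
  · intro i
    change Fin 2 at i
    fin_cases i
    · refine ⟨(1 : Fin 2), ⟨k, e1⟩, ?_⟩
      rintro j ⟨m, hm⟩
      change Fin 2 at j
      fin_cases j
      · exact absurd (congrArg Prod.fst (hm OnePoint.infty)) (by decide : (1 : Fin 2) ≠ 0)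
      · rfl
    · refine ⟨(0 : Fin 2), ⟨g, e0⟩, ?_⟩
      rintro j ⟨m, hm⟩
      change Fin 2 at j
      fin_cases j
      · rfl
      · exact absurd (congrArg Prod.fst (hm OnePoint.infty)) (by decide : (0 : Fin 2) ≠ 1)

theorem subset_AV : V ∪ A₁ ∪ A₂ ⊆ AV := by
  rw [V_eq, A₁_eq, A₂_eq]
  rintro α ((⟨c, hc, rfl⟩ | ⟨c, hc, rfl⟩) | ⟨c, hc, rfl⟩) <;> simp only
  · rw [familyV_of_mem hc]
    exact diagramV_mem_AV hc
  · rw [family₁_of_mem hc]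
    exact diagram₁_mem_AV hc
  · rw [family₂_of_mem hc]
    exact diagram₂_mem_AV hc

/-! ### Values of the cross ratios -/

theorem RationalCurve.IsCrossRatio.exists_mob {C : RationalCurve} {q : Fin 4 → C.Pt} {t : P1}
    (h : C.IsCrossRatio q t) (v : Fin C.n) (h01 : C.proj v (q 0) ≠ C.proj v (q 1))
    (h02 : C.proj v (q 0) ≠ C.proj v (q 2)) (h12 : C.proj v (q 1) ≠ C.proj v (q 2)) :
    ∃ g : Mob, g • C.proj v (q 0) = OnePoint.some 0 ∧ g • C.proj v (q 1) = OnePoint.some 1 ∧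
      g • C.proj v (q 2) = OnePoint.infty ∧ g • C.proj v (q 3) = t := by
  obtain ⟨g, g0, g1, g2⟩ := exists_mob_zero_one_infty h01 h02 h12
  exact ⟨g, g0, g1, g2, (C.isCrossRatio_iff.2 ⟨v, g, g0, g1, g2, rfl⟩).unique h⟩

namespace Diagram

/-- The cross ratio of the points marked `0, y, ∞, z` on the lower curve. -/
def idxOne : Fin 4 ↪ B := ⟨![B.zero, B.y, B.inf, B.z], by decide⟩

/-- The cross ratio of the points marked `0, 1, y, z` on the lower curve. -/
def idxTwo : Fin 4 ↪ B := ⟨![B.zero, B.one, B.y, B.z], by decide⟩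

variable {D : Diagram} {t : CoordIdx → P1}

theorem IsCoord.crossRatioL (h : D.IsCoord t) (e : Fin 4 ↪ B) :
    D.L.IsCrossRatio (fun k => D.L.mark (e k)) (t (Sum.inl e)) := by
  obtain ⟨q, -, hL, -⟩ := h
  exact hL e

theorem IsCoord.crossRatioU (h : D.IsCoord t) :
    D.U.IsCrossRatio (fun k => D.U.mark (![A.zero, A.one, A.inf, A.x] k)) (t (Sum.inr idxU)) := by
  obtain ⟨q, ⟨-, hq, -⟩, -, hU⟩ := h
  have : (fun k => D.U.mark (![A.zero, A.one, A.inf, A.x] k)) = fun k => q (idxU k) := by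
    funext k
    rw [← hq]
    fin_cases k <;> rfl
  rw [this]
  exact hU idxU

theorem IsCoord.ne_of_injective (h : D.IsCoord t) {e : Fin 4 ↪ B} {v : Fin D.L.n}
    (hv : Function.Injective fun k => D.L.proj v (D.L.mark (e k))) :
    t (Sum.inl e) ≠ OnePoint.some 0 ∧ t (Sum.inl e) ≠ OnePoint.some 1 ∧
      t (Sum.inl e) ≠ OnePoint.infty := by
  obtain ⟨g, g0, g1, g2, g3⟩ := (h.crossRatioL e).exists_mob v (hv.ne (by decide))
    (hv.ne (by decide)) (hv.ne (by decide))
  refine ⟨fun e' => ?_, fun e' => ?_, fun e' => ?_⟩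
  · exact absurd (hv (smul_left_cancel g ((g3.trans e').trans g0.symm))) (by decide)
  · exact absurd (hv (smul_left_cancel g ((g3.trans e').trans g1.symm))) (by decide)
  · exact absurd (hv (smul_left_cancel g ((g3.trans e').trans g2.symm))) (by decide)

/-- The closed set of diagrams with exceptional cross ratios. -/
def boundary : Set AM :=
  -- On `V` both cross ratios avoid 0, 1, ∞. On `A₁` the second is ∞ and the first avoids these
  -- values; on `A₂` the first is 0 and the second avoids them. So the values 0 of the first and ∞
  -- of the second may only be removed jointly.
  valueLocus (Sum.inl idxOne) 1 1 ∪ valueLocus (Sum.inl idxOne) 1 0 ∪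
  valueLocus (Sum.inl idxTwo) 0 1 ∪ valueLocus (Sum.inl idxTwo) 1 1 ∪
  valueLocus (Sum.inl idxOne) 0 1 ∩ valueLocus (Sum.inl idxTwo) 1 0

theorem isClosed_boundary : IsClosed boundary :=
  ((((isClosed_valueLocus _ _ _).union (isClosed_valueLocus _ _ _)).union
    (isClosed_valueLocus _ _ _)).union (isClosed_valueLocus _ _ _)).union
    ((isClosed_valueLocus _ _ _).inter (isClosed_valueLocus _ _ _))

theorem IsCoord.mem_boundary_iff (h : D.IsCoord t) : AM.mk D ∈ boundary ↔
    t (Sum.inl idxOne) = OnePoint.some 1 ∨ t (Sum.inl idxOne) = OnePoint.infty ∨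
    t (Sum.inl idxTwo) = OnePoint.some 0 ∨ t (Sum.inl idxTwo) = OnePoint.some 1 ∨
    (t (Sum.inl idxOne) = OnePoint.some 0 ∧ t (Sum.inl idxTwo) = OnePoint.infty) := by
  simp only [boundary, Set.mem_union, Set.mem_inter_iff,
    h.mem_valueLocus_iff (isHomCoord_some 1), h.mem_valueLocus_iff (isHomCoord_some 0),
    h.mem_valueLocus_iff isHomCoord_infty, or_assoc]

/-- Outside the three families a cross ratio involving z is 0, 1 or ∞, or z splits off together with
the label that it omits. For `idxOne` this label is 1, and then `idxTwo` has the value 1; for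
`idxTwo` it is ∞, and then `idxOne` has the value ∞. Off `boundary` only the values 0 and ∞ remain,
and this pair also lies in `boundary`. -/
theorem mem_of_match {w : Fin D.U.n} {v' : Fin D.L.n} {g : Mob} (h : D.Match w v' g)
    (ht : D.IsCoord t) (hb : AM.mk D ∉ boundary) : AM.mk D ∈ V ∪ A₁ ∪ A₂ := by
  by_contra hD
  rw [ht.mem_boundary_iff] at hb
  push Not at hb
  obtain ⟨b1, b2, b3, b4, b5⟩ := hb
  have key : ∀ e : Fin 4 ↪ B, e 3 = B.z → t (Sum.inl e) = OnePoint.some 0 ∨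
      t (Sum.inl e) = OnePoint.some 1 ∨ t (Sum.inl e) = OnePoint.infty ∨
      ∃ v u i, i ≠ B.z ∧ D.L.Split v u B.z i ∧ ∀ k, e k ≠ i := by
    intro e he
    obtain ⟨v, g, g0, g1, g2, g3⟩ := D.L.isCrossRatio_iff.1 (ht.crossRatioL e)
    by_cases hv : Function.Injective fun k => D.L.proj v (D.L.mark (e k))
    · obtain ⟨u, i, hi, hs⟩ := h.exists_split hD hv
      refine Or.inr (Or.inr (Or.inr ⟨v, u, i, hi, hs, fun k hk => ?_⟩))
      have h3 : k = 3 := hv (by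
        simp only [he, hk]
        rw [hs.proj_mem (Or.inr rfl), hs.proj_mem (Or.inl rfl)])
      rw [h3, he] at hk
      exact hi hk.symm
    · by_contra hcon
      push Not at hcon
      obtain ⟨n0, n1, n2, -⟩ := hcon
      apply hv
      intro k l hkl
      have hkl' : g • D.L.proj v (D.L.mark (e k)) = g • D.L.proj v (D.L.mark (e l)) :=
        congrArg _ hkl
      rw [← g3] at n0 n1 n2
      fin_cases k <;> fin_cases l <;> simp_all
  have k1 := key idxOne rfl
  have k2 := key idxTwo rfl
  have c1 : t (Sum.inl idxOne) = OnePoint.some 0 := by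
    rcases k1 with h1 | h1 | h1 | ⟨v, u, i, hi, hs, hk⟩
    · exact h1
    · exact absurd h1 b1
    · exact absurd h1 b2
    · exfalso
      have hi1 : i = B.one := by
        have n0 := hk 0
        have n1 := hk 1
        have n2 := hk 2
        cases i
        · exact absurd rfl n0
        · rfl
        · exact absurd rfl n2
        · exact absurd rfl n1
        · exact absurd rfl hi
      subst hi1
      obtain ⟨g, -, g1, -, g3⟩ := (ht.crossRatioL idxTwo).exists_mob v
        (fun e => absurd (hs.proj_eq e) (by decide)) (fun e => absurd (hs.proj_eq e) (by decide))
        (fun e => absurd (hs.proj_eq e) (by decide))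
      apply b4
      rw [← g3, ← g1]
      exact congrArg _ ((hs.proj_mem (Or.inl rfl)).trans (hs.proj_mem (Or.inr rfl)).symm)
  have c2 : t (Sum.inl idxTwo) = OnePoint.infty := by
    rcases k2 with h1 | h1 | h1 | ⟨v, u, i, hi, hs, hk⟩
    · exact absurd h1 b3
    · exact absurd h1 b4
    · exact h1
    · exfalso
      have hi1 : i = B.inf := by
        have n0 := hk 0
        have n1 := hk 1
        have n2 := hk 2
        cases i
        · exact absurd rfl n0
        · exact absurd rfl n1
        · rfl
        · exact absurd rfl n2
        · exact absurd rfl hi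
      subst hi1
      obtain ⟨g, -, -, g2, g3⟩ := (ht.crossRatioL idxOne).exists_mob v
        (fun e => absurd (hs.proj_eq e) (by decide)) (fun e => absurd (hs.proj_eq e) (by decide))
        (fun e => absurd (hs.proj_eq e) (by decide))
      apply b2
      rw [← g3, ← g2]
      exact congrArg _ ((hs.proj_mem (Or.inl rfl)).trans (hs.proj_mem (Or.inr rfl)).symm)
  exact b5 c1 c2

end Diagram

open Diagram

/-! ### Cross ratios of the three families -/

theorem coordV_values {x : ℂ} (hx : x ∈ TV) {t : CoordIdx → P1} (h : (diagramV x hx).IsCoord t) :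
    t (Sum.inr idxU) = OnePoint.some x ∧ t (Sum.inl idxL) = OnePoint.some x ∧
    (t (Sum.inl idxOne) ≠ OnePoint.some 0 ∧ t (Sum.inl idxOne) ≠ OnePoint.some 1 ∧
      t (Sum.inl idxOne) ≠ OnePoint.infty) ∧
    (t (Sum.inl idxTwo) ≠ OnePoint.some 0 ∧ t (Sum.inl idxTwo) ≠ OnePoint.some 1 ∧
      t (Sum.inl idxTwo) ≠ OnePoint.infty) ∧
    IsHomCoord (-vr x ^ 2) (4 * x ^ 2 * (2 * x - 1) * (x - 1)) (t (Sum.inl idxOne)) := by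
  have gen := generic_of_mem_TV hx
  have pU : ∀ a, (diagramV x hx).U.proj (0 : Fin 1) ((diagramV x hx).U.mark a) = normU x a := by
    intro a
    rw [diagramV_mark_U]
    exact line.proj_self _ _
  have pL' : ∀ b, (diagramV x hx).L.proj (0 : Fin 1) ((diagramV x hx).L.mark b) =
      vG _ _ _ gen • lpos (vp x) (vq x) (vr x) b := fun b => line.proj_self _ _
  have pL : ∀ a, (diagramV x hx).L.proj (0 : Fin 1) ((diagramV x hx).L.mark (iota a)) = normU x a :=
    fun a => by rw [pL', vG_smul_lpos hx]
  have hinj : Function.Injective fun b =>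
      (diagramV x hx).L.proj (0 : Fin 1) ((diagramV x hx).L.mark b) := by
    intro b b' he
    simp only [pL'] at he
    exact gen.lpos_injective (smul_left_cancel _ he)
  have ninj : ∀ a a', a ≠ a' → normU x a ≠ normU x a' := by
    intro a a' ha he
    rw [← pL, ← pL] at he
    exact ha (iota.injective (hinj he))
  refine ⟨?_, ?_, h.ne_of_injective (hinj.comp idxOne.injective),
    h.ne_of_injective (hinj.comp idxTwo.injective), ?_⟩
  · refine RationalCurve.IsCrossRatio.unique h.crossRatioU ((RationalCurve.isCrossRatio_iff _).2
      ⟨(0 : Fin 1), 1, ?_, ?_, ?_, ?_⟩) <;> rw [one_smul]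
    · exact pU A.zero
    · exact pU A.one
    · exact pU A.inf
    · exact pU A.x
  · refine RationalCurve.IsCrossRatio.unique (h.crossRatioL idxL) ((RationalCurve.isCrossRatio_iff _).2
      ⟨(0 : Fin 1), 1, ?_, ?_, ?_, ?_⟩) <;> rw [one_smul]
    · exact pL A.zero
    · exact pL A.one
    · exact pL A.inf
    · exact pL A.x
  · obtain ⟨g, g0, g1, g2, g3⟩ := (h.crossRatioL idxOne).exists_mob (0 : Fin 1)
      (fun e => absurd (hinj e) (by decide)) (fun e => absurd (hinj e) (by decide))
      (fun e => absurd (hinj e) (by decide))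
    simp only [pL', ← mul_smul] at g0 g1 g2 g3
    have := isHomCoord_crossRatio (isHomCoord_some (vr x ^ 2)) (isHomCoord_some (vp x ^ 2))
      isHomCoord_infty (isHomCoord_some 0) g0 g1 g2
    rw [← g3]
    refine this.of_mul_eq ?_ ?_
    · right
      obtain ⟨h0, h1, h2, -⟩ := hx
      simp [h0, sub_ne_zero.2 h1, sub_ne_zero.2 h2]
    · unfold vp vr
      ring

theorem coord₁_values {c : ℂ} (hc : c ∈ TA) {t : CoordIdx → P1} (h : (diagram₁ c hc).IsCoord t) :
    t (Sum.inr idxU) = OnePoint.infty ∧ t (Sum.inl idxL) = OnePoint.infty ∧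
    (t (Sum.inl idxOne) ≠ OnePoint.some 0 ∧ t (Sum.inl idxOne) ≠ OnePoint.some 1 ∧
      t (Sum.inl idxOne) ≠ OnePoint.infty) ∧ t (Sum.inl idxTwo) = OnePoint.infty ∧
    IsHomCoord (-c ^ 2) (1 - c ^ 2) (t (Sum.inl idxOne)) := by
  have pU : ∀ (v : Fin 3) l, (diagram₁ c hc).U.proj v ((diagram₁ c hc).U.mark l) =
      pos6 (codeU₁ v (fibOfA l)) c := by
    intro v l
    rw [← proj_fpos₁ c hc]
    cases l <;> rfl
  have pL : ∀ (v : Fin 2) b, (diagram₁ c hc).L.proj v ((diagram₁ c hc).L.mark b) =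
      pos4 (codeL₁ v b) c := fun v b => proj_lpos₁ c v b
  have i6 : ∀ i j, i ≠ j → pos6 i c ≠ pos6 j c := fun i j hij he => hij (pos6_injective c hc i j he)
  have i4 : ∀ i j, i ≠ j → pos4 i c ≠ pos4 j c := fun i j hij he => hij (pos4_injective c hc i j he)
  have hne : ∀ (v : Fin 2) b b', codeL₁ v b ≠ codeL₁ v b' →
      (diagram₁ c hc).L.proj v ((diagram₁ c hc).L.mark b) ≠
      (diagram₁ c hc).L.proj v ((diagram₁ c hc).L.mark b') := fun v b b' hb => by
    rw [pL, pL]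
    exact i4 _ _ hb
  have hneU : ∀ (v : Fin 3) a a', codeU₁ v (fibOfA a) ≠ codeU₁ v (fibOfA a') →
      (diagram₁ c hc).U.proj v ((diagram₁ c hc).U.mark a) ≠
      (diagram₁ c hc).U.proj v ((diagram₁ c hc).U.mark a') := fun v a a' hb => by
    rw [pU, pU]
    exact i6 _ _ hb
  refine ⟨?_, ?_, ?_, ?_, ?_⟩
  · obtain ⟨g, g0, g1, g2, g3⟩ := h.crossRatioU.exists_mob (0 : Fin 3)
      (hneU 0 A.zero A.one (by decide)) (hneU 0 A.zero A.inf (by decide))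
      (hneU 0 A.one A.inf (by decide))
    rw [← g3, ← g2]
    exact congrArg _ ((pU 0 A.x).trans (pU 0 A.inf).symm)
  · obtain ⟨g, g0, g1, g2, g3⟩ := (h.crossRatioL idxL).exists_mob (1 : Fin 2)
      (hne 1 _ _ (by decide)) (hne 1 _ _ (by decide)) (hne 1 _ _ (by decide))
    rw [← g3, ← g2]
    exact congrArg _ ((pL 1 B.y).trans (pL 1 B.inf).symm)
  · refine h.ne_of_injective (v := (0 : Fin 2)) fun k l hkl => ?_
    by_contra hcon
    refine hne 0 _ _ ?_ hkl
    clear hkl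
    revert hcon k l
    decide
  · obtain ⟨g, g0, g1, g2, g3⟩ := (h.crossRatioL idxTwo).exists_mob (1 : Fin 2)
      (hne 1 _ _ (by decide)) (hne 1 _ _ (by decide)) (hne 1 _ _ (by decide))
    rw [← g3, ← g2]
    exact congrArg _ ((pL 1 B.z).trans (pL 1 B.y).symm)
  · obtain ⟨g, g0, g1, g2, g3⟩ := (h.crossRatioL idxOne).exists_mob (0 : Fin 2)
      (hne 0 _ _ (by decide)) (hne 0 _ _ (by decide)) (hne 0 _ _ (by decide))
    simp only [pL] at g0 g1 g2 g3
    have := isHomCoord_crossRatio (isHomCoord_some (c ^ 2)) (isHomCoord_some 1)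
      isHomCoord_infty (isHomCoord_some 0) g0 g1 g2
    rw [← g3]
    refine this.of_mul_eq (Or.inl (neg_ne_zero.2 (sq_ne_of_mem_TA hc).1)) ?_
    ring

theorem coord₂_values {c : ℂ} (hc : c ∈ TA) {t : CoordIdx → P1} (h : (diagram₂ c hc).IsCoord t) :
    t (Sum.inr idxU) = OnePoint.infty ∧ t (Sum.inl idxL) = OnePoint.infty ∧
    (t (Sum.inl idxTwo) ≠ OnePoint.some 0 ∧ t (Sum.inl idxTwo) ≠ OnePoint.some 1 ∧
      t (Sum.inl idxTwo) ≠ OnePoint.infty) ∧ t (Sum.inl idxOne) = OnePoint.some 0 ∧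
    IsHomCoord (-c ^ 2) (1 - c ^ 2) (t (Sum.inl idxTwo)) := by
  have pU : ∀ (v : Fin 2) l, (diagram₂ c hc).U.proj v ((diagram₂ c hc).U.mark l) =
      pos6 (codeU₂ v (fibOfA l)) c := by
    intro v l
    rw [← proj_fpos₂ c]
    cases l <;> rfl
  have pL : ∀ (v : Fin 2) b, (diagram₂ c hc).L.proj v ((diagram₂ c hc).L.mark b) =
      pos4 (codeL₂ v b) c := fun v b => proj_lpos₂ c v b
  have i6 : ∀ i j, i ≠ j → pos6 i c ≠ pos6 j c := fun i j hij he => hij (pos6_injective c hc i j he)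
  have i4 : ∀ i j, i ≠ j → pos4 i c ≠ pos4 j c := fun i j hij he => hij (pos4_injective c hc i j he)
  have hne : ∀ (v : Fin 2) b b', codeL₂ v b ≠ codeL₂ v b' →
      (diagram₂ c hc).L.proj v ((diagram₂ c hc).L.mark b) ≠
      (diagram₂ c hc).L.proj v ((diagram₂ c hc).L.mark b') := fun v b b' hb => by
    rw [pL, pL]
    exact i4 _ _ hb
  have hneU : ∀ (v : Fin 2) a a', codeU₂ v (fibOfA a) ≠ codeU₂ v (fibOfA a') →
      (diagram₂ c hc).U.proj v ((diagram₂ c hc).U.mark a) ≠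
      (diagram₂ c hc).U.proj v ((diagram₂ c hc).U.mark a') := fun v a a' hb => by
    rw [pU, pU]
    exact i6 _ _ hb
  refine ⟨?_, ?_, ?_, ?_, ?_⟩
  · obtain ⟨g, g0, g1, g2, g3⟩ := h.crossRatioU.exists_mob (1 : Fin 2)
      (hneU 1 A.zero A.one (by decide)) (hneU 1 A.zero A.inf (by decide))
      (hneU 1 A.one A.inf (by decide))
    rw [← g3, ← g2]
    exact congrArg _ ((pU 1 A.x).trans (pU 1 A.inf).symm)
  · obtain ⟨g, g0, g1, g2, g3⟩ := (h.crossRatioL idxL).exists_mob (0 : Fin 2)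
      (hne 0 _ _ (by decide)) (hne 0 _ _ (by decide)) (hne 0 _ _ (by decide))
    rw [← g3, ← g2]
    exact congrArg _ ((pL 0 B.y).trans (pL 0 B.inf).symm)
  · refine h.ne_of_injective (v := (0 : Fin 2)) fun k l hkl => ?_
    by_contra hcon
    refine hne 0 _ _ ?_ hkl
    clear hkl
    revert hcon k l
    decide
  · obtain ⟨g, g0, g1, g2, g3⟩ := (h.crossRatioL idxOne).exists_mob (1 : Fin 2)
      (hne 1 _ _ (by decide)) (hne 1 _ _ (by decide)) (hne 1 _ _ (by decide))
    rw [← g3, ← g0]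
    exact congrArg _ ((pL 1 B.z).trans (pL 1 B.zero).symm)
  · obtain ⟨g, g0, g1, g2, g3⟩ := (h.crossRatioL idxTwo).exists_mob (0 : Fin 2)
      (hne 0 _ _ (by decide)) (hne 0 _ _ (by decide)) (hne 0 _ _ (by decide))
    simp only [pL] at g0 g1 g2 g3
    have := isHomCoord_crossRatio (isHomCoord_some (c ^ 2)) (isHomCoord_some 1)
      isHomCoord_infty (isHomCoord_some 0) g0 g1 g2
    rw [← g3]
    refine this.of_mul_eq (Or.inl (neg_ne_zero.2 (sq_ne_of_mem_TA hc).1)) ?_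
    ring

/-! ### Local closedness -/

/-- One inclusion is the computation of the cross ratios on the normal forms. For the other,
equality of the cross ratios above and below provides a match, and the classification applies. -/
theorem union_eq_diff : V ∪ A₁ ∪ A₂ = equalLocus (Sum.inr idxU) (Sum.inl idxL) \ boundary := by
  apply Set.Subset.antisymm
  · obtain ⟨tV, -, hV⟩ := exists_coordV
    obtain ⟨t₁, -, h₁⟩ := exists_coord₁
    obtain ⟨t₂, -, h₂⟩ := exists_coord₂
    rw [V_eq, A₁_eq, A₂_eq]
    rintro α ((⟨c, hc, rfl⟩ | ⟨c, hc, rfl⟩) | ⟨c, hc, rfl⟩) <;> simp only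
    · rw [familyV_of_mem hc]
      have h : (diagramV c hc).IsCoord fun i => tV i c := hV c hc
      obtain ⟨e1, e2, ⟨n0, n1, n2⟩, ⟨m0, m1, m2⟩, -⟩ := coordV_values hc h
      refine ⟨h.mem_equalLocus_iff.2 (e1.trans e2.symm), ?_⟩
      rw [h.mem_boundary_iff]
      tauto
    · rw [family₁_of_mem hc]
      obtain ⟨e1, e2, ⟨n0, n1, n2⟩, m, -⟩ := coord₁_values hc (h₁ c hc)
      refine ⟨(h₁ c hc).mem_equalLocus_iff.2 (e1.trans e2.symm), ?_⟩
      rw [(h₁ c hc).mem_boundary_iff, m]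
      simp only [OnePoint.infty_ne_coe]
      tauto
    · rw [family₂_of_mem hc]
      obtain ⟨e1, e2, ⟨n0, n1, n2⟩, m, -⟩ := coord₂_values hc (h₂ c hc)
      refine ⟨(h₂ c hc).mem_equalLocus_iff.2 (e1.trans e2.symm), ?_⟩
      rw [(h₂ c hc).mem_boundary_iff, m]
      have k1 : (OnePoint.some (0 : ℂ) : P1) ≠ OnePoint.some 1 := by simp
      have k2 : (OnePoint.some (0 : ℂ) : P1) ≠ OnePoint.infty := by simp
      tauto
  · rintro α ⟨h1, h2⟩
    obtain ⟨D, t, rfl, ht, -⟩ := id h1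
    obtain ⟨w, v, g, hm⟩ := ht.exists_match (ht.mem_equalLocus_iff.1 h1)
    exact mem_of_match hm ht h2

/-! ### Dimension -/

theorem TA_infinite : TA.Infinite := by
  have h : ({0, 1, -1} : Set ℂ).Finite := Set.toFinite _
  refine h.infinite_compl.mono fun c hc => ?_
  simp only [Set.mem_compl_iff, Set.mem_insert_iff, Set.mem_singleton_iff, not_or] at hc
  exact hc

theorem TV_infinite : TV.Infinite := by
  let P : ℂ[X] := Polynomial.X * (Polynomial.X - 1) * (2 * Polynomial.X - 1) *
    (3 * Polynomial.X ^ 2 - 3 * Polynomial.X + 1) * (1 - Polynomial.X - Polynomial.X ^ 2) *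
    (-Polynomial.X ^ 2 + 3 * Polynomial.X - 1)
  have hP : ∀ x, P.eval x = x * (x - 1) * (2 * x - 1) * vp x * vq x * vr x := fun x => by
    simp [P, vp, vq, vr]
  have h0 : P ≠ 0 := by
    intro h
    have := hP 2
    rw [h] at this
    norm_num [vp, vq, vr] at this
  refine (Polynomial.finite_setOfPred_isRoot h0).infinite_compl.mono fun x hx => ?_
  have hx' : P.eval x ≠ 0 := hx
  rw [hP] at hx'
  simp only [ne_eq, mul_eq_zero, not_or, sub_eq_zero] at hx'
  obtain ⟨⟨⟨⟨⟨h0, h1⟩, h2⟩, h3⟩, h4⟩, h5⟩ := hx'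
  exact ⟨h0, h1, h2, h3, h4, h5⟩

/-- The equation, in the cross ratios `idxL` and `idxOne`, of the closure of the diagonal. -/
def diagonalPoly : MvPolynomial (CoordIdx × Fin 2) ℂ :=
  let X := MvPolynomial.X (Sum.inl idxL, 0)
  let Y := MvPolynomial.X (Sum.inl idxL, 1)
  let R := MvPolynomial.X (Sum.inl idxOne, 0)
  let S := MvPolynomial.X (Sum.inl idxOne, 1)
  -- This is R(p² − r²) + S r² = 0 with −r² written as (q² − r²) − q², homogenized to degree four in
  -- (X, Y).
  R * (4 * X ^ 2 * (2 * X - Y) * (X - Y)) -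
    S * (4 * X * Y * (2 * X - Y) * (X - Y) - (Y ^ 2 - X * Y - X ^ 2) ^ 2)

theorem eval_diagonalPoly (w : CoordIdx × Fin 2 → ℂ) {X Y R S : ℂ}
    (hX : w (Sum.inl idxL, 0) = X) (hY : w (Sum.inl idxL, 1) = Y)
    (hR : w (Sum.inl idxOne, 0) = R) (hS : w (Sum.inl idxOne, 1) = S) :
    MvPolynomial.eval w diagonalPoly = R * (4 * X ^ 2 * (2 * X - Y) * (X - Y)) -
      S * (4 * X * Y * (2 * X - Y) * (X - Y) - (Y ^ 2 - X * Y - X ^ 2) ^ 2) := by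
  simp [diagonalPoly, hX, hY, hR, hS]

theorem diagramV_mem_zeroLocus {x : ℂ} (hx : x ∈ TV) {t : CoordIdx → P1}
    (h : (diagramV x hx).IsCoord t) : AM.mk (diagramV x hx) ∈ zeroLocus diagonalPoly := by
  rw [h.mem_zeroLocus_iff]
  intro w hw
  obtain ⟨-, e, -, -, e'⟩ := coordV_values hx h
  have h1 := hw (Sum.inl idxL)
  rw [e] at h1
  have h2 := (e'.eq_iff (hw (Sum.inl idxOne))).1 rfl
  rw [eval_diagonalPoly w h1.2 rfl rfl rfl]
  unfold vr at h2
  linear_combination -w (Sum.inl idxL, 1) ^ 4 * h2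

/-- At Y = 0 the polynomial reduces to X⁴(8R + S), so on the locus where the cross ratio `idxL` is ∞
it vanishes only for the value −1/8 of `idxOne`. -/
theorem notMem_zeroLocus {D : Diagram} {t : CoordIdx → P1} (h : D.IsCoord t)
    (hL : t (Sum.inl idxL) = OnePoint.infty) {r s : ℂ} (hrs : 8 * r + s ≠ 0)
    (h1 : IsHomCoord r s (t (Sum.inl idxOne))) : AM.mk D ∉ zeroLocus diagonalPoly := by
  rw [h.mem_zeroLocus_iff]
  intro hw
  obtain ⟨w, hw'⟩ := exists_homCoords t
  have h2 := hw w hw'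
  have h3 := hw' (Sum.inl idxL)
  rw [hL] at h3
  have h4 := (h1.eq_iff (hw' (Sum.inl idxOne))).1 rfl
  rw [eval_diagonalPoly w rfl h3.2 rfl rfl] at h2
  have h5 : w (Sum.inl idxL, 0) ^ 4 * (8 * w (Sum.inl idxOne, 0) + w (Sum.inl idxOne, 1)) = 0 := by
    linear_combination h2
  have h6 := (mul_eq_zero.1 h5).resolve_left (pow_ne_zero 4 h3.1)
  have h7 : w (Sum.inl idxOne, 0) * (8 * r + s) = 0 := by linear_combination r * h6 - h4
  have h8 := (mul_eq_zero.1 h7).resolve_right hrs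
  rw [h8, mul_zero, zero_add] at h6
  rcases (hw' (Sum.inl idxOne)).ne_zero with h9 | h9
  · exact h9 h8
  · exact h9 h6

/-- The parameter spaces of the three families. -/
def familySet : Fin 3 → Set ℂ := ![TV, TA, TA]

/-- The three families. -/
def family : Fin 3 → ℂ → Diagram := ![familyV, family₁, family₂]

theorem exists_family_coord (i : Fin 3) : ∃ t : CoordIdx → ℂ → P1,
    (∀ j, IsPolyOn (familySet i) (t j)) ∧
    ∀ c ∈ familySet i, (family i c).IsCoord fun j => t j c := by
  fin_cases i
  · obtain ⟨t, h1, h2⟩ := exists_coordV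
    exact ⟨t, h1, fun c hc => by
      change (familyV c).IsCoord _
      rw [familyV_of_mem hc]
      exact h2 c hc⟩
  · obtain ⟨t, h1, h2⟩ := exists_coord₁
    exact ⟨t, h1, fun c hc => by
      change (family₁ c).IsCoord _
      rw [family₁_of_mem hc]
      exact h2 c hc⟩
  · obtain ⟨t, h1, h2⟩ := exists_coord₂
    exact ⟨t, h1, fun c hc => by
      change (family₂ c).IsCoord _
      rw [family₂_of_mem hc]
      exact h2 c hc⟩

theorem union_eq_iUnion :
    V ∪ A₁ ∪ A₂ = ⋃ i, (fun c => AM.mk (family i c)) '' familySet i := by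
  rw [V_eq, A₁_eq, A₂_eq]
  ext α
  simp only [Set.mem_union, Set.mem_iUnion, Fin.exists_fin_succ]
  simp [family, familySet, or_assoc]

theorem three_mem_TA : (3 : ℂ) ∈ TA := by
  refine ⟨?_, ?_, ?_⟩ <;> norm_num

theorem three_mem_TV : (3 : ℂ) ∈ TV := by
  refine ⟨?_, ?_, ?_, ?_, ?_, ?_⟩ <;> norm_num [vp, vq, vr]

/-- The separating closed sets are the zero locus of `diagonalPoly` for `V`, the locus `idxTwo` = ∞
for `A₁`, and the locus `idxOne` = 0 for `A₂`. The parameter 2 witnesses that the other families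
leave them. -/
theorem family_mem_closed (i j : Fin 3) (hij : i ≠ j) : ∃ K, IsClosed K ∧
    (∀ c ∈ familySet i, AM.mk (family i c) ∈ K) ∧ ∃ c ∈ familySet j, AM.mk (family j c) ∉ K := by
  obtain ⟨tV, -, hV⟩ := exists_coordV
  obtain ⟨t₁, -, h₁⟩ := exists_coord₁
  obtain ⟨t₂, -, h₂⟩ := exists_coord₂
  have hV' : ∀ c (hc : c ∈ TV), (diagramV c hc).IsCoord fun i => tV i c := hV
  have v2 := coordV_values two_mem_TV (hV' 2 two_mem_TV)
  have a2 := coord₁_values two_mem_TA (h₁ 2 two_mem_TA)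
  have b2 := coord₂_values two_mem_TA (h₂ 2 two_mem_TA)
  have eV : familyV 2 = diagramV 2 two_mem_TV := familyV_of_mem _
  have e₁ : family₁ 2 = diagram₁ 2 two_mem_TA := family₁_of_mem _
  have e₂ : family₂ 2 = diagram₂ 2 two_mem_TA := family₂_of_mem _
  fin_cases i
  · refine ⟨zeroLocus diagonalPoly, isClosed_zeroLocus _, fun c hc => ?_, 2, ?_⟩
    · change AM.mk (familyV c) ∈ _
      rw [familyV_of_mem hc]
      exact diagramV_mem_zeroLocus hc (hV' c hc)
    · fin_cases j
      · exact absurd rfl hij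
      · refine ⟨two_mem_TA, ?_⟩
        change AM.mk (family₁ 2) ∉ _
        rw [e₁]
        exact notMem_zeroLocus (h₁ 2 two_mem_TA) a2.2.1 (by norm_num) a2.2.2.2.2
      · refine ⟨two_mem_TA, ?_⟩
        change AM.mk (family₂ 2) ∉ _
        rw [e₂]
        refine notMem_zeroLocus (h₂ 2 two_mem_TA) b2.2.1 (r := 0) (s := 1) (by norm_num) ?_
        rw [b2.2.2.2.1]
        exact isHomCoord_some 0
  · refine ⟨valueLocus (Sum.inl idxTwo) 1 0, isClosed_valueLocus _ _ _, fun c hc => ?_, 2, ?_⟩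
    · change AM.mk (family₁ c) ∈ _
      rw [family₁_of_mem hc]
      exact ((h₁ c hc).mem_valueLocus_iff isHomCoord_infty).2 (coord₁_values hc (h₁ c hc)).2.2.2.1
    · fin_cases j
      · refine ⟨two_mem_TV, ?_⟩
        change AM.mk (familyV 2) ∉ _
        rw [eV, (hV' 2 two_mem_TV).mem_valueLocus_iff isHomCoord_infty]
        exact v2.2.2.2.1.2.2
      · exact absurd rfl hij
      · refine ⟨two_mem_TA, ?_⟩
        change AM.mk (family₂ 2) ∉ _
        rw [e₂, (h₂ 2 two_mem_TA).mem_valueLocus_iff isHomCoord_infty]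
        exact b2.2.2.1.2.2
  · refine ⟨valueLocus (Sum.inl idxOne) 0 1, isClosed_valueLocus _ _ _, fun c hc => ?_, 2, ?_⟩
    · change AM.mk (family₂ c) ∈ _
      rw [family₂_of_mem hc]
      exact ((h₂ c hc).mem_valueLocus_iff (isHomCoord_some 0)).2
        (coord₂_values hc (h₂ c hc)).2.2.2.1
    · fin_cases j
      · refine ⟨two_mem_TV, ?_⟩
        change AM.mk (familyV 2) ∉ _
        rw [eV, (hV' 2 two_mem_TV).mem_valueLocus_iff (isHomCoord_some 0)]
        exact v2.2.2.1.1
      · refine ⟨two_mem_TA, ?_⟩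
        change AM.mk (family₁ 2) ∉ _
        rw [e₁, (h₁ 2 two_mem_TA).mem_valueLocus_iff (isHomCoord_some 0)]
        exact a2.2.2.1.1
      · exact absurd rfl hij

/-- The parameters 2 and 3 are told apart by `idxL` on `V`, by `idxOne` on `A₁` and by `idxTwo` on
`A₂`. -/
theorem family_nonconst (i : Fin 3) : ∃ c ∈ familySet i, ∃ c' ∈ familySet i,
    AM.mk (family i c') ∉ closure {AM.mk (family i c)} := by
  fin_cases i
  · obtain ⟨t, -, h⟩ := exists_coordV
    have h' : ∀ c (hc : c ∈ TV), (diagramV c hc).IsCoord fun i => t i c := h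
    refine ⟨2, two_mem_TV, 3, three_mem_TV, ?_⟩
    change AM.mk (familyV 3) ∉ closure {AM.mk (familyV 2)}
    rw [familyV_of_mem two_mem_TV, familyV_of_mem three_mem_TV]
    intro hcl
    have h1 := congrFun ((h' 3 three_mem_TV).eq_of_mem_closure (h' 2 two_mem_TV) hcl) (Sum.inl idxL)
    rw [(coordV_values three_mem_TV (h' 3 three_mem_TV)).2.1,
      (coordV_values two_mem_TV (h' 2 two_mem_TV)).2.1] at h1
    rw [OnePoint.coe_eq_coe] at h1
    norm_num at h1
  · obtain ⟨t, -, h⟩ := exists_coord₁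
    refine ⟨2, two_mem_TA, 3, three_mem_TA, ?_⟩
    change AM.mk (family₁ 3) ∉ closure {AM.mk (family₁ 2)}
    rw [family₁_of_mem two_mem_TA, family₁_of_mem three_mem_TA]
    intro hcl
    have h1 := congrFun ((h 3 three_mem_TA).eq_of_mem_closure (h 2 two_mem_TA) hcl)
      (Sum.inl idxOne)
    have h2 := ((coord₁_values three_mem_TA (h 3 three_mem_TA)).2.2.2.2.eq_iff
      (coord₁_values two_mem_TA (h 2 two_mem_TA)).2.2.2.2).1 h1
    norm_num at h2
  · obtain ⟨t, -, h⟩ := exists_coord₂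
    refine ⟨2, two_mem_TA, 3, three_mem_TA, ?_⟩
    change AM.mk (family₂ 3) ∉ closure {AM.mk (family₂ 2)}
    rw [family₂_of_mem two_mem_TA, family₂_of_mem three_mem_TA]
    intro hcl
    have h1 := congrFun ((h 3 three_mem_TA).eq_of_mem_closure (h 2 two_mem_TA) hcl)
      (Sum.inl idxTwo)
    have h2 := ((coord₂_values three_mem_TA (h 3 three_mem_TA)).2.2.2.2.eq_iff
      (coord₂_values two_mem_TA (h 2 two_mem_TA)).2.2.2.2).1 h1
    norm_num at h2

theorem isPureDim_union : IsPureDim (V ∪ A₁ ∪ A₂) 1 := by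
  refine isPureDim_one (T := familySet) (φ := fun i c => AM.mk (family i c)) (fun i => ?_)
    (fun i K hK => ?_) union_eq_iUnion family_mem_closed ?_ family_nonconst
  · fin_cases i
    · exact TV_infinite
    · exact TA_infinite
    · exact TA_infinite
  · obtain ⟨t, h1, h2⟩ := exists_family_coord i
    exact closed_finite_or_all (t := fun c j => t j c) h2 h1 K hK
  -- Specialization between classes that have coordinates means equality of the coordinates, so it
  -- is symmetric.
  · have key : ∀ α ∈ V ∪ A₁ ∪ A₂, ∃ D t, AM.mk D = α ∧ D.IsCoord t := by
      rw [union_eq_diff]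
      rintro α ⟨⟨D, t, h, ht, -⟩, -⟩
      exact ⟨D, t, h, ht⟩
    intro α hα β hβ hcl
    obtain ⟨D, t, rfl, ht⟩ := key α hα
    obtain ⟨E, s, rfl, hs⟩ := key β hβ
    have hts := ht.eq_of_mem_closure hs hcl
    subst hts
    exact hs.mem_closure ht

theorem isLocallyClosed_union : IsLocallyClosed (V ∪ A₁ ∪ A₂) := by
  rw [union_eq_diff, Set.sdiff_eq]
  exact (isClosed_zeroLocus _).isLocallyClosed.inter
    isClosed_boundary.isOpen_compl.isLocallyClosed

end AugDef

end

/-- The set `V ∪ A₁ ∪ A₂` is algebraic (locally closed) of pure dimension one, it is contained in the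
equalizer `AV`, and its complement in `AV` is finite. -/
theorem proposition4p2 :
    (IsLocallyClosed (AugDef.V ∪ AugDef.A₁ ∪ AugDef.A₂) ∧
      AugDef.IsPureDim (AugDef.V ∪ AugDef.A₁ ∪ AugDef.A₂) 1) ∧
    AugDef.V ∪ AugDef.A₁ ∪ AugDef.A₂ ⊆ AugDef.AV ∧
    (AugDef.AV \ (AugDef.V ∪ AugDef.A₁ ∪ AugDef.A₂)).Finite := by
  exact ⟨⟨AugDef.isLocallyClosed_union, AugDef.isPureDim_union⟩, AugDef.subset_AV,
    AugDef.Diagram.finite_exceptional⟩
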